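/- **Definitions.** *Chord data.* A twisted chord datum of rank $N\ge 0$ is a pair $(P,s)$ with $P$ a partition of $\{1,\dots,2N\}$ into two-element parts and $s:P\to\mathbb{Z}/2$. Its boundary graph has vertices $(i,\pm1)$, $1\le i\le 2N$, and edges $(i,+1)-(i+1,-1)$ for $1\le i<2N$; $(i,+1)-(j,-1)$ and $(i,-1)-(j,+1)$ for each part $\{i,j\}$ with $s=0$; $(i,+1)-(j,+1)$ and $(i,-1)-(j,-1)$ for each part $\{i,j\}$ with $s=1$. Let $\mathcal{TC}^*_N$ be the set of those $(P,s)$ of rank $N$ whose boundary graph is connected (the rank $0$ datum is included). Let $\text{Möb}$ be the rank $1$ datum with $P=\{\{1,2\}\}$, $s=1$, and $\text{Tor}$ the rank $2$ datum with $P=\{\{1,3\},\{2,4\}\}$, $s=0$. *SWB data.* A frame of rank $N$ is $F=(P,s,f)$ with $(P,s)\in\mathcal{TC}^*_N$ and $f:P\cup\{\{0\},\{2N+1\}\}\to\mathbb{Z}_{\ge0}$. Write $f(i)$ for the value of $f$ on the part containing $i$. The vertex set is $V_F=\{(i,a):0\le i\le 2N+1,\ 1\le a\le f(i)\}$, totally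 ordered by $(i,a)\prec(j,b)$ if $i<j$, or $i=j\le 2N$ and $a<b$, or $i=j=2N+1$ and $a>b$. Vertices with $1\le i\le 2N$ are internal; on them define the involution $\iota_F(i,a)=(j,f(p)+1-a)$ if $p=\{i,j\}\in P$ and $s(p)=0$, and $\iota_F(i,a)=(j,a)$ if $s(p)=1$. A square with bands (SWB) datum of rank $N$ is $\Theta=(F,E)$ with $E$ a crossingless partition of $(V_F,\prec)$ into two-element parts; it has type $(n,m)$ if $f(0)=n$ and $f(2N+1)=m$. Let $Sq_N(n,m)$ be the set of SWB data of rank $N$ and type $(n,m)$, and $Sq_{\text{Tor}}(n,m)$, $Sq_{\text{Möb}}(n,m)$ the sets of those of type $(n,m)$ with $(P,s)=\text{Tor}$, resp. $(P,s)=\text{Möb}$. The curve graph $G(\Theta)$ has vertex set $V_F$ and edges $E\cup\{v-\iota_F(v): v \text{ internal}\}$. For a graph $G$ and a set $U$ of vertices, the contraction $G/U$ has as vertices those of $G$ outside $U$, two distinct ones being adjacent if some path of $G$ joins them with all interior vertices in $U$. "OP" means order preserving. *Vertical juxtaposition.* For $\Theta_1$ of rank $N_1$ and type $(n,m)$ and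 $\Theta_2$ of rank $N_2$ and type $(m,l)$, $\Theta_2\#\Theta_1$ is the unique SWB datum of rank $N_1+N_2$ and type $(n,l)$ such that its parts, twists and values of $f$ on $\{1,\dots,2N_1\}$ are those of $\Theta_1$, those on $\{2N_1+1,\dots,2N_1+2N_2\}$ are those of $\Theta_2$ shifted by $2N_1$, and its curve graph is the contraction of $G(\Theta_1)\cup G(\Theta_2)$, glued along $(2N_1+1,a)\sim(0,a)$ for $1\le a\le m$, on the $m$ glued vertices, with the remaining vertices of $\Theta_1$ kept and those of $\Theta_2$ shifted by $2N_1$ in the first coordinate. *Isotopy.* If $u=(i,a)$ and $v=(i,a+1)$ are internal vertices with $\{u,v\}\in E$ and $\{\iota_F(u),\iota_F(v)\}\notin E$, the pull-through at $(i,a)$ replaces $\Theta$ by the unique SWB datum with the same $(P,s)$, with $f$ decreased by $2$ on the part containing $i$ and otherwise unchanged, and with curve graph $G(\Theta)/\{u,v,\iota_F(u),\iota_F(v)\}$ up to the OP bijection of vertices. Isotopy is the equivalence relation generated by pull-throughs. *Handle slides.* Let $1\le i\le 2N$, $\epsilon\in\{\pm1\}$. If $(i,\epsilon)$ is not admissible,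 where admissible means $1\le i+\epsilon\le 2N$ and $\{i,i+\epsilon\}\notin P$, put $H_{(i,\epsilon)}(\Theta)=\Theta$. Otherwise let $i\in p\in P$ and $q=\{i+\epsilon,i'\}\in P$, and let $\sigma$ be the permutation of $\{1,\dots,2N\}$ that is OP on the complement of $\{i\}$ with $\sigma(i)=\sigma(i')+\epsilon(-1)^{s(q)}$, extended to fix $0$ and $2N+1$. Let $F'$ be the frame with parts $\sigma(r)$, $r\in P$, in which $\sigma(p)$ has twist $s(p)+s(q)$ and $\sigma(q)$ has $f$-value $f(q)+f(p)$, all other twists and $f$-values being transported unchanged by $\sigma$. Let $U\subset V_{F'}$ be the convex subset of order $2f(p)$ that contains all vertices with first coordinate $\sigma(i)$ and is contained in those with first coordinate $\sigma(i)$ or $\sigma(i')$, and let $o:V_F\to V_{F'}\smallsetminus U$ be the OP bijection. Then $H_{(i,\epsilon)}(\Theta)$ is the unique SWB datum with frame $F'$ whose curve graph is obtained from $G(\Theta)$ by deleting the edges $u-\iota_F(u)$, $u\in V_F$ with first coordinate $i$, that are not in $E$, applying $o$, and adding, for each $u\in V_F$ with first coordinate $i$, the path $$o(u)\;-\;\iota_{F'}(o(u))\;-\;\iota_{F'}(o(\iota_F(u)))\;-\;o(\iota_F(u)).$$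 Handle slides act on isotopy classes, and $\Theta\overset{\text{h.s.}}{\sim}\Theta'$ means that the isotopy class of $\Theta$ is the image of that of $\Theta'$ under a finite (possibly empty) composite of handle slides. **Corollary.** Let $N>0$, $n,m\ge0$ and $\Theta\in Sq_N(n,m)$. There is exactly one pair $(g,t)$ with $g\in\mathbb{Z}_{\ge0}$, $t\in\{0,1,2\}$ and $2g+t=N$ for which there exist $l_1,\dots,l_{g+t-1}\in\mathbb{Z}_{\ge0}$ and, setting $l_0=n$ and $l_{g+t}=m$, data $\Theta_i\in Sq_{\text{Tor}}(l_{i-1},l_i)$ for $1\le i\le g$ and $\Psi_i\in Sq_{\text{Möb}}(l_{g+i-1},l_{g+i})$ for $1\le i\le t$ such that $$\Theta\ \overset{\text{h.s.}}{\sim}\ (\Psi_t\#\cdots\#\Psi_1)\#(\Theta_g\#\cdots\#\Theta_1),$$ where an empty factor is left out. -/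

import Mathlib

/-- A twisted chord datum of rank `N`: a pair-partition `P` of `{1, …, 2N}` together with a
`ℤ/2`-valued function on its parts. The partition is recorded by the fixed-point-free involution
`mate` of `{1, …, 2N}` that exchanges the two elements of each part (so the parts are the sets
`{i, mate i}`), and the twist `s(p)` of the part `p` is the common value of `twist` on the two
elements of `p`. Outside `{1, …, 2N}`, `mate` is the identity and `twist` is `0`, so that two data
are equal as terms exactly when they have the same rank, partition and twists. -/
@[ext]
structure TCD where
  rank : ℕ
  mate : ℕ → ℕ
  twist : ℕ → ZMod 2
  mate_mate : ∀ i, mate (mate i) = i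
  mate_eq_self_iff : ∀ i, mate i = i ↔ ¬ (1 ≤ i ∧ i ≤ 2 * rank)
  twist_mate : ∀ i, twist (mate i) = twist i
  twist_outside : ∀ i, ¬ (1 ≤ i ∧ i ≤ 2 * rank) → twist i = 0

namespace TCD

/-- `i` is one of the `2N` sites `1, …, 2N`. -/
def IsSite (C : TCD) (i : ℕ) : Prop := 1 ≤ i ∧ i ≤ 2 * C.rank

/-- The boundary graph, on the vertices `(i, ±1)` with `i` a site: `(i, +1)` is joined to
`(i + 1, -1)`; the ends of an untwisted arc `{i, j}` are joined by `(i, +1) - (j, -1)` and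
`(i, -1) - (j, +1)`, those of a twisted one by `(i, +1) - (j, +1)` and `(i, -1) - (j, -1)`. -/
def boundaryGraph (C : TCD) : SimpleGraph (ℕ × ℤˣ) :=
  SimpleGraph.fromRel fun x y =>
    C.IsSite x.1 ∧ C.IsSite y.1 ∧
      ((y.1 = x.1 + 1 ∧ x.2 = 1 ∧ y.2 = -1) ∨
        (y.1 = C.mate x.1 ∧ C.twist x.1 = 0 ∧ y.2 = -x.2) ∨
        (y.1 = C.mate x.1 ∧ C.twist x.1 = 1 ∧ y.2 = x.2))

/-- The boundary graph is connected, that is, the surface described by the datum has exactly one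
boundary component. (The rank zero datum, which describes the square, satisfies this: its boundary
graph is empty.) -/
def OneBoundary (C : TCD) : Prop :=
  ∀ x y : ℕ × ℤˣ, C.IsSite x.1 → C.IsSite y.1 → C.boundaryGraph.Reachable x y

/-- The datum `Möb`: one twisted arc `{1, 2}`. -/
def Mob : TCD where
  rank := 1
  mate i := if i = 1 then 2 else if i = 2 then 1 else i
  twist i := if i = 1 ∨ i = 2 then 1 else 0
  mate_mate i := by split_ifs <;> omega
  mate_eq_self_iff i := by split_ifs <;> omega
  twist_mate i := by
    by_cases h1 : i = 1
    · simp [h1]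
    · by_cases h2 : i = 2 <;> simp [h1, h2]
  twist_outside i hi := if_neg (by omega)

/-- The datum `Tor`: two untwisted arcs `{1, 3}` and `{2, 4}`. -/
def Tor : TCD where
  rank := 2
  mate i := if i = 1 ∨ i = 2 then i + 2 else if i = 3 ∨ i = 4 then i - 2 else i
  twist _ := 0
  mate_mate i := by split_ifs <;> omega
  mate_eq_self_iff i := by split_ifs <;> omega
  twist_mate _ := rfl
  twist_outside _ _ := rfl

/-- The site `i + ε`. (For a site `i` the integer `i + ε` is nonnegative.) -/
def next (i : ℕ) (ε : ℤˣ) : ℕ := ((i : ℤ) + (ε : ℤ)).toNat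

/-- `(i, ε)` is an admissible pair: `i` and `i + ε` are sites and `{i, i + ε}` is not a part. -/
def Admissible (C : TCD) (i : ℕ) (ε : ℤˣ) : Prop :=
  C.IsSite i ∧ C.IsSite (next i ε) ∧ C.mate i ≠ next i ε

/-- `σ` is the permutation of the sites by which the site `i` is slid over the band `q` that
contains `i + ε`: with `q = {i + ε, i'}`, it preserves the order of the sites other than `i`, and
`σ i = σ i' + ε (-1) ^ s(q)`. (It is extended by the identity to all of `ℕ`.) -/
structure IsSlidePerm (C : TCD) (i : ℕ) (ε : ℤˣ) (σ : Equiv.Perm ℕ) : Prop where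
  outside : ∀ k, ¬ C.IsSite k → σ k = k
  mono : ∀ k l, C.IsSite k → C.IsSite l → k ≠ i → l ≠ i → k < l → σ k < σ l
  place : (σ i : ℤ) =
    σ (C.mate (next i ε)) + (ε : ℤ) * (if C.twist (next i ε) = 0 then 1 else -1)

end TCD

/-- A frame `(P, s, f)` of rank `N`: a twisted chord datum `(P, s)` with one boundary component,
and a function `f` with values in `ℕ` on the parts of `P` and on the two extra parts `{0}` and
`{2N + 1}`. Here `mult i` is the value of `f` on the part that contains `i`; it is set to `0` for
`i > 2N + 1`. -/
@[ext]
structure Frame extends TCD where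
  oneBoundary : toTCD.OneBoundary
  mult : ℕ → ℕ
  mult_mate : ∀ i, mult (mate i) = mult i
  mult_outside : ∀ i, 2 * rank + 1 < i → mult i = 0

namespace Frame

/-- The vertex set `V_F` of all `(i, a)` with `0 ≤ i ≤ 2N + 1` and `1 ≤ a ≤ f(i)`. -/
def verts (F : Frame) : Set (ℕ × ℕ) := {v | 1 ≤ v.2 ∧ v.2 ≤ F.mult v.1}

/-- The internal vertices, those on the sites `1, …, 2N`. -/
def intVerts (F : Frame) : Set (ℕ × ℕ) := {v | v ∈ F.verts ∧ F.IsSite v.1}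

/-- The total order `≺` of the vertices: `(i, a) ≺ (j, b)` if `i < j`, or `i = j ≤ 2N` and `a < b`,
or `i = j = 2N + 1` and `a > b`. -/
def prec (F : Frame) (u v : ℕ × ℕ) : Prop :=
  u.1 < v.1 ∨ (u.1 = v.1 ∧ u.1 ≤ 2 * F.rank ∧ u.2 < v.2) ∨
    (u.1 = v.1 ∧ u.1 = 2 * F.rank + 1 ∧ v.2 < u.2)

/-- The involution `ι_F` of the internal vertices, which exchanges the two ends of each of the
`f(p)` parallel arcs in the band `p`. -/
def iota (F : Frame) (v : ℕ × ℕ) : ℕ × ℕ :=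
  (F.mate v.1, if F.twist v.1 = 0 then F.mult v.1 + 1 - v.2 else v.2)

/-- `o` is an order preserving bijection from the subset `A` of the vertices of `F` onto the subset
`B` of the vertices of `F'`. (There is at most one, as both sets are finite and totally ordered.) -/
def IsOrderIso (F F' : Frame) (A B : Set (ℕ × ℕ)) (o : ℕ × ℕ → ℕ × ℕ) : Prop :=
  Set.BijOn o A B ∧ ∀ u ∈ A, ∀ v ∈ A, F.prec u v → F'.prec (o u) (o v)

end Frame

/-- The contraction `G / U` of a graph on a set `U` of vertices: its vertices are those outside `U`,
and two of them are adjacent if they are joined by a path of `G` all of whose interior vertices lie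
in `U` (in particular if they are adjacent in `G`). The vertices in `U` remain as isolated points of
the ambient type. -/
def SimpleGraph.contract {α : Type*} (G : SimpleGraph α) (U : Set α) : SimpleGraph α :=
  SimpleGraph.fromRel fun u v =>
    u ∉ U ∧ v ∉ U ∧ ∃ p : G.Walk u v, p.IsPath ∧ ∀ x ∈ p.support, x = u ∨ x = v ∨ x ∈ U

/-- A square with bands datum `Θ = (F, E)`: a frame `F` and a crossingless pair-partition `E` of its
vertex set. The partition is recorded by the fixed-point-free involution `pair` of the vertex set
that exchanges the two elements of each part; it is the identity on the non-vertices. -/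
@[ext]
structure SWB extends Frame where
  pair : ℕ × ℕ → ℕ × ℕ
  pair_pair : ∀ v, pair (pair v) = v
  pair_eq_self_iff : ∀ v, pair v = v ↔ v ∉ toFrame.verts
  crossingless : ∀ u ∈ toFrame.verts, ∀ v ∈ toFrame.verts,
    ¬ (toFrame.prec u v ∧ toFrame.prec v (pair u) ∧ toFrame.prec (pair u) (pair v))

namespace SWB

/-- The set `Sq_N(n, m)` of the data of rank `N` and type `(n, m)`, that is, with `n` southern and
`m` northern vertices. -/
def Sq (N n m : ℕ) : Set SWB := {Θ | Θ.rank = N ∧ Θ.mult 0 = n ∧ Θ.mult (2 * N + 1) = m}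

/-- The set `Sq_Tor(n, m)` of the data of type `(n, m)` with chord datum `Tor`. -/
def SqTor (n m : ℕ) : Set SWB := {Θ | Θ ∈ Sq 2 n m ∧ Θ.toTCD = TCD.Tor}

/-- The set `Sq_Möb(n, m)` of the data of type `(n, m)` with chord datum `Möb`. -/
def SqMob (n m : ℕ) : Set SWB := {Θ | Θ ∈ Sq 1 n m ∧ Θ.toTCD = TCD.Mob}

/-- The curve graph `G(Θ)`, with vertex set `V_F` and edge set `E ∪ D_F`, where `D_F` consists of
the edges `v - ι_F(v)` for the internal vertices `v`. (All other points of `ℕ × ℕ` are isolated.) -/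
def curveGraph (Θ : SWB) : SimpleGraph (ℕ × ℕ) :=
  SimpleGraph.fromRel fun u v =>
    (u ∈ Θ.verts ∧ Θ.pair u = v) ∨ (u ∈ Θ.intVerts ∧ Θ.iota u = v)

/-! ### Vertical juxtaposition -/

/-- The inclusion of `V_{F₁}` into the glued vertex set `V_{F₁,F₂}`, whose points are written
`inr a` for the identified vertices `(2N₁ + 1, a) ∼ (0, a)` and `inl w` for all others, with `w` the
corresponding vertex of the juxtaposed frame. -/
def lower (N₁ : ℕ) (v : ℕ × ℕ) : (ℕ × ℕ) ⊕ ℕ :=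
  if v.1 = 2 * N₁ + 1 then Sum.inr v.2 else Sum.inl v

/-- The inclusion of `V_{F₂}` into the glued vertex set `V_{F₁,F₂}`. -/
def upper (N₁ : ℕ) (v : ℕ × ℕ) : (ℕ × ℕ) ⊕ ℕ :=
  if v.1 = 0 then Sum.inr v.2 else Sum.inl (v.1 + 2 * N₁, v.2)

/-- The composite graph `G(Θ₁, Θ₂)`, the union of the two curve graphs on the glued vertex set. -/
def compositeGraph (Θ₁ Θ₂ : SWB) : SimpleGraph ((ℕ × ℕ) ⊕ ℕ) :=
  SimpleGraph.fromRel fun x y =>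
    (∃ u v, Θ₁.curveGraph.Adj u v ∧ x = lower Θ₁.rank u ∧ y = lower Θ₁.rank v) ∨
      (∃ u v, Θ₂.curveGraph.Adj u v ∧ x = upper Θ₁.rank u ∧ y = upper Θ₁.rank v)

/-- `Θ` is the vertical juxtaposition `Θ₂ # Θ₁` (`Θ₂` on top of `Θ₁`) of a datum `Θ₁` of type
`(n, m)` and a datum `Θ₂` of type `(m, l)`: its frame is `F₂ # F₁`, and its curve graph is the
contraction of the composite graph `G(Θ₁, Θ₂)` on the glued vertices, under the order preserving
bijection of the remaining vertices with those of `F₂ # F₁`, which fixes the vertices of `F₁` and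
shifts the sites of the vertices of `F₂` by `2N₁`. -/
structure IsJuxt (Θ₂ Θ₁ Θ : SWB) : Prop where
  glue : Θ₁.mult (2 * Θ₁.rank + 1) = Θ₂.mult 0
  rank_eq : Θ.rank = Θ₁.rank + Θ₂.rank
  mate_lower : ∀ i, i ≤ 2 * Θ₁.rank → Θ.mate i = Θ₁.mate i
  mate_upper : ∀ i, 1 ≤ i → Θ.mate (i + 2 * Θ₁.rank) = Θ₂.mate i + 2 * Θ₁.rank
  twist_lower : ∀ i, i ≤ 2 * Θ₁.rank → Θ.twist i = Θ₁.twist i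
  twist_upper : ∀ i, 1 ≤ i → Θ.twist (i + 2 * Θ₁.rank) = Θ₂.twist i
  mult_lower : ∀ i, i ≤ 2 * Θ₁.rank → Θ.mult i = Θ₁.mult i
  mult_upper : ∀ i, 1 ≤ i → Θ.mult (i + 2 * Θ₁.rank) = Θ₂.mult i
  graph : ∀ u v, Θ.curveGraph.Adj u v ↔
    ((compositeGraph Θ₁ Θ₂).contract (Set.range Sum.inr)).Adj (Sum.inl u) (Sum.inl v)

/-- `IsStack [Θ₁, …, Θ_k] Φ`: `Φ` is the vertical juxtaposition `Θ_k # ⋯ # Θ₁`, for `k ≥ 1`. -/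
def IsStack : List SWB → SWB → Prop
  | [], _ => False
  | [Θ], Φ => Φ = Θ
  | Θ :: Θ' :: L, Φ => ∃ Ψ, IsStack (Θ' :: L) Ψ ∧ IsJuxt Ψ Θ Φ

/-- `IsTwoStack [Θ₁, …, Θ_g] [Ψ₁, …, Ψ_t] Φ`: `Φ` is the vertical juxtaposition
`(Ψ_t # ⋯ # Ψ₁) # (Θ_g # ⋯ # Θ₁)`, where an empty factor is left out. -/
def IsTwoStack : List SWB → List SWB → SWB → Prop
  | Ts, [], Φ => IsStack Ts Φ
  | [], Ms, Φ => IsStack Ms Φ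
  | Ts, Ms, Φ => ∃ A B, IsStack Ts A ∧ IsStack Ms B ∧ IsJuxt B A Φ

/-! ### Isotopy -/

/-- `Θ'` is obtained from `Θ` by the pull-through at `(i, a)`: the internal vertices `u = (i, a)` and
`v = (i, a + 1)` form a part of `E`, while `ι_F(u)` and `ι_F(v)` do not; the value of `f` on the part
that contains `i` drops by two, and the curve graph is contracted on the four vertices
`u, v, ι_F(u), ι_F(v)`. -/
def IsPullThrough (Θ : SWB) (i a : ℕ) (Θ' : SWB) : Prop :=
  (i, a) ∈ Θ.intVerts ∧ (i, a + 1) ∈ Θ.intVerts ∧ Θ.pair (i, a) = (i, a + 1) ∧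
    Θ.pair (Θ.iota (i, a)) ≠ Θ.iota (i, a + 1) ∧
    Θ'.toTCD = Θ.toTCD ∧
    (∀ k, Θ'.mult k = Θ.mult k - if k = i ∨ k = Θ.mate i then 2 else 0) ∧
    ∃ (U : Set (ℕ × ℕ)) (o : ℕ × ℕ → ℕ × ℕ),
      U = {(i, a), (i, a + 1), Θ.iota (i, a), Θ.iota (i, a + 1)} ∧
      Θ.toFrame.IsOrderIso Θ'.toFrame (Θ.verts \ U) Θ'.verts o ∧
      ∀ x ∈ Θ.verts \ U, ∀ y ∈ Θ.verts \ U,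
        Θ'.curveGraph.Adj (o x) (o y) ↔ (Θ.curveGraph.contract U).Adj x y

/-- Isotopy: the equivalence relation generated by the pull-throughs. -/
def Isotopic : SWB → SWB → Prop :=
  Relation.EqvGen fun Θ Θ' => ∃ i a, IsPullThrough Θ i a Θ'

/-! ### Handle slides -/

/-- With `σ` the permutation of the slide of the site `i` over the band `q ∋ i + ε`, and `p ∋ i`, the
frame of `Θ'` is `F_{(i,ε)}`: the partition is moved by `σ`, the twist of `p` is changed by that of
`q`, and the value of `f` on `q` is increased by `f(p)`. -/
structure IsSlideFrame (F : Frame) (i : ℕ) (ε : ℤˣ) (σ : Equiv.Perm ℕ) (F' : Frame) : Prop where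
  rank_eq : F'.rank = F.rank
  mate_eq : ∀ k, F'.mate (σ k) = σ (F.mate k)
  twist_eq : ∀ k, F'.twist (σ k) =
    F.twist k + if k = i ∨ k = F.mate i then F.twist (TCD.next i ε) else 0
  mult_eq : ∀ k, F'.mult (σ k) =
    F.mult k + if k = TCD.next i ε ∨ k = F.mate (TCD.next i ε) then F.mult i else 0

/-- `U` is the convex subset with `2 f(p)` elements of the vertices of the slid frame that contains
all vertices on the site `σ i` and is contained in the vertices on the sites `σ i` and `σ i'`, where
`i ∈ p` and `{i + ε, i'}` is a part. -/
structure IsSlideSet (F : Frame) (i : ℕ) (ε : ℤˣ) (σ : Equiv.Perm ℕ) (F' : Frame)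
    (U : Set (ℕ × ℕ)) : Prop where
  finite : U.Finite
  card : U.ncard = 2 * F.mult i
  subset : U ⊆ F'.verts
  convex : ∀ u ∈ U, ∀ w ∈ U, ∀ v ∈ F'.verts, F'.prec u v → F'.prec v w → v ∈ U
  contains : ∀ v ∈ F'.verts, v.1 = σ i → v ∈ U
  sites : ∀ v ∈ U, v.1 = σ i ∨ v.1 = σ (F.mate (TCD.next i ε))

/-- The curve graph of the slid datum: the edges `u - ι_F(u)` with `u` on the site `i` are removed
from `G(Θ)` unless they belong to `E`, the rest is transported by `o`, and each of these `u` gives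
the path `o(u) - ι'(o(u)) - ι'(o(ι_F(u))) - o(ι_F(u))`, with `ι' = ι_{F'}` for the slid frame `F'`. -/
def slideGraph (Θ : SWB) (i : ℕ) (F' : Frame) (o : ℕ × ℕ → ℕ × ℕ) : SimpleGraph (ℕ × ℕ) :=
  SimpleGraph.fromRel fun x y =>
    (∃ u v, Θ.curveGraph.Adj u v ∧
      (¬ ∃ w ∈ Θ.verts, w.1 = i ∧ Θ.pair w ≠ Θ.iota w ∧ s(u, v) = s(w, Θ.iota w)) ∧
      x = o u ∧ y = o v) ∨
    (∃ u ∈ Θ.verts, u.1 = i ∧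
      ((x = o u ∧ y = F'.iota (o u)) ∨
        (x = F'.iota (o u) ∧ y = F'.iota (o (Θ.iota u))) ∨
        (x = F'.iota (o (Θ.iota u)) ∧ y = o (Θ.iota u))))

/-- `Θ'` is the result `H_{(i,ε)}(Θ)` of the handle slide of `Θ` at the site `i` in the direction
`ε`; for a pair `(i, ε)` that is not admissible this is `Θ` itself. -/
def IsHandleSlide (Θ : SWB) (i : ℕ) (ε : ℤˣ) (Θ' : SWB) : Prop :=
  (Θ.Admissible i ε ∧
    ∃ (σ : Equiv.Perm ℕ) (U : Set (ℕ × ℕ)) (o : ℕ × ℕ → ℕ × ℕ),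
      Θ.IsSlidePerm i ε σ ∧
      IsSlideFrame Θ.toFrame i ε σ Θ'.toFrame ∧
      IsSlideSet Θ.toFrame i ε σ Θ'.toFrame U ∧
      Θ.toFrame.IsOrderIso Θ'.toFrame Θ.verts (Θ'.verts \ U) o ∧
      Θ'.curveGraph = slideGraph Θ i Θ'.toFrame o) ∨
  (¬ Θ.Admissible i ε ∧ Θ' = Θ)

/-- Handle slide equivalence: the isotopy class of `Θ` is the image of that of `Θ'` under a finite,
possibly empty, composite of handle slides (acting on isotopy classes). -/
def HSEquiv (Θ Θ' : SWB) : Prop :=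
  Relation.ReflTransGen
    (fun X Y => Isotopic X Y ∨ ∃ i ε, X.IsSite i ∧ IsHandleSlide X i ε Y) Θ' Θ

end SWB

/-! The chord datum of `Θ` describes a compact surface with one boundary circle, and the statement
is the classification of such surfaces carried along with the curves drawn on them. Only the surface
needs to be normalised; the curves follow, because every slide of the chord datum lifts to the
square with bands datum.

Existence on the level of chord data is `TCD.exists_normal`. If two untwisted arcs cross, foreign
sites are slid out of the way until the four ends are consecutive, which splits off a copy of `Tor`.
If all remaining arcs are untwisted, a crossing must exist, since an uncrossed untwisted arc would
enclose a boundary component of its own. If some arc is twisted, a copy of `Möb` splits off in the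
same manner. Three copies of `Möb` in a row can be slid so that two untwisted arcs cross (Dyck's
relation), so at most two twisted arcs remain. The argument uses repeatedly that slides keep the
boundary connected, `TCD.slide_oneBoundary`.

The lift is `SWB.exists_lift_slide`. The relation `HSEquiv Θ Φ` asks for a way from `Φ` to `Θ`, so a
slide of the chord datum of `Θ` has to be matched by a datum from which the opposite slide leads
back to `Θ`. Not every datum is the result of a slide: the strands at the moved site must all run
parallel into the neighbouring end of a band. Inverse pull-throughs achieve this
(`SWB.exists_parallel`), and afterwards the parallel strands can be erased and the slide undone
(`SWB.exists_unslide`).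

A datum whose first `2k` sites are matched among themselves is cut along a horizontal line
(`SWB.exists_isJuxt`); the edges that cross the line become the glued vertices. Iterating this turns
a datum over the normal form into the required juxtaposition.

For uniqueness, `2g + t = N` fixes the parity of `t`, so only `t = 0` and `t = 2` can be confused.
They are told apart by orientability, that is, by whether all twists vanish, which isotopies and
slides preserve (`SWB.HSEquiv.untwisted_iff`). -/

/-- The permutation of `ℕ` that moves `i` to `t` and preserves the order of all other numbers. -/
def siteMove (i t : ℕ) : Equiv.Perm ℕ where
  toFun k := if k = i then t else if i < k ∧ k ≤ t then k - 1 else if t ≤ k ∧ k < i then k + 1 else k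
  invFun k := if k = t then i else if t < k ∧ k ≤ i then k - 1 else if i ≤ k ∧ k < t then k + 1 else k
  left_inv k := by dsimp only; split_ifs <;> omega
  right_inv k := by dsimp only; split_ifs <;> omega

theorem siteMove_apply (i t k : ℕ) : siteMove i t k =
    if k = i then t else if i < k ∧ k ≤ t then k - 1 else if t ≤ k ∧ k < i then k + 1 else k := rfl

@[simp] theorem siteMove_siteMove (i t k : ℕ) : siteMove i t (siteMove t i k) = k :=
  (siteMove i t).right_inv k

theorem siteMove_self_left (i t : ℕ) : siteMove i t i = t := by simp [siteMove_apply]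

/-! ### Handle slides of twisted chord data and the slides that undo them -/

namespace TCD

variable (C : TCD)

theorem isSite_mate {C : TCD} {i : ℕ} (h : C.IsSite i) : C.IsSite (C.mate i) := by
  by_contra h'
  have h1 := (C.mate_eq_self_iff (C.mate i)).2 h'
  rw [C.mate_mate] at h1
  exact (C.mate_eq_self_iff i).1 h1.symm h

theorem mate_ne {C : TCD} {i : ℕ} (h : C.IsSite i) : C.mate i ≠ i := fun h' =>
  (C.mate_eq_self_iff i).1 h' h

theorem mate_of_not {C : TCD} {i : ℕ} (h : ¬ C.IsSite i) : C.mate i = i :=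
  (C.mate_eq_self_iff i).2 h

theorem mate_inj {C : TCD} {i k : ℕ} (h : C.mate i = C.mate k) : i = k := by
  rw [← C.mate_mate i, h, C.mate_mate]

/-- The datum obtained from `C` by moving the site `j` to the place `t` and adding the twist of `h`
to that of the part of `j`. -/
def moved (j h t : ℕ) (hj : C.IsSite j) (ht : C.IsSite t) : TCD where
  rank := C.rank
  mate k := siteMove j t (C.mate (siteMove t j k))
  twist k := C.twist (siteMove t j k) +
    if siteMove t j k = j ∨ siteMove t j k = C.mate j then C.twist h else 0
  mate_mate k := by simp [C.mate_mate]
  mate_eq_self_iff k := by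
    have h1 : siteMove j t (C.mate (siteMove t j k)) = k ↔
        C.mate (siteMove t j k) = siteMove t j k := by
      constructor
      · intro h; rw [← siteMove_siteMove t j (C.mate _), h]
      · intro h; rw [h]; simp
    rw [h1, C.mate_eq_self_iff]
    obtain ⟨a, b⟩ := hj
    obtain ⟨c, d⟩ := ht
    rw [siteMove_apply]
    split_ifs <;> omega
  twist_mate k := by
    simp only [siteMove_siteMove, C.twist_mate]
    have e1 : C.mate (siteMove t j k) = j ↔ siteMove t j k = C.mate j :=
      ⟨fun h => by rw [← C.mate_mate (siteMove t j k), h], fun h => by rw [h, C.mate_mate]⟩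
    have e2 : C.mate (siteMove t j k) = C.mate j ↔ siteMove t j k = j :=
      ⟨mate_inj, fun h => by rw [h]⟩
    simp only [e1, e2, or_comm]
  twist_outside k hk := by
    have hk' : siteMove t j k = k := by
      obtain ⟨a, b⟩ := hj
      obtain ⟨c, d⟩ := ht
      rw [siteMove_apply]
      split_ifs <;> omega
    have h1 : k ≠ j := fun h => hk (h ▸ hj)
    have h2 : k ≠ C.mate j := fun h => hk (h ▸ isSite_mate hj)
    simp [hk', h1, h2, C.twist_outside k hk]

/-- The side of the site `mate h` on which a site arrives that is slid over the band of `h` in the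
direction `η`. -/
def side (h : ℕ) (η : ℤˣ) : ℤˣ := if C.twist h = 0 then η else -η

/-- The place to which the site `j` is slid in the direction `η`. -/
def target (j : ℕ) (η : ℤˣ) : ℕ :=
  -- If `j` lies to the left of the far end, taking `j` out moves that end one place to the left;
  -- hence the off-by-one between the two branches.
  if j < C.mate (next j η) then
    if C.side (next j η) η = 1 then C.mate (next j η) else C.mate (next j η) - 1
  else if C.side (next j η) η = 1 then C.mate (next j η) + 1 else C.mate (next j η)

theorem next_one (j : ℕ) : next j 1 = j + 1 := by simp [next]

theorem next_neg_one (j : ℕ) : next j (-1) = j - 1 := by simp [next]; omega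

variable {C}

theorem next_ne {j : ℕ} {η : ℤˣ} (h : C.Admissible j η) : next j η ≠ j := by
  obtain ⟨⟨h1, -⟩, h2, -⟩ := h
  rcases Int.units_eq_one_or η with rfl | rfl
  · rw [next_one]; omega
  · rw [next_neg_one]; omega

theorem mate_next_ne {j : ℕ} {η : ℤˣ} (h : C.Admissible j η) : C.mate (next j η) ≠ j := fun e =>
  h.2.2 (by rw [← C.mate_mate (next j η), e])

theorem isSite_target {j : ℕ} {η : ℤˣ} (h : C.Admissible j η) : C.IsSite (C.target j η) := by
  have h1 := isSite_mate h.2.1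
  have h2 := h.1
  have h3 := mate_next_ne h
  obtain ⟨a, b⟩ := h1
  obtain ⟨c, d⟩ := h2
  unfold target IsSite
  split_ifs <;> omega

/-- The datum obtained from `C` by the handle slide of the site `j` in the direction `η`. -/
def slide (C : TCD) (j : ℕ) (η : ℤˣ) (h : C.Admissible j η) : TCD :=
  C.moved j (next j η) (C.target j η) h.1 (isSite_target h)

section
variable {j : ℕ} {η : ℤˣ} (h : C.Admissible j η)

theorem slide_rank : (C.slide j η h).rank = C.rank := rfl

theorem slide_mate (k : ℕ) : (C.slide j η h).mate (siteMove j (C.target j η) k) =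
    siteMove j (C.target j η) (C.mate k) := by
  simp [slide, moved]

theorem slide_twist (k : ℕ) : (C.slide j η h).twist (siteMove j (C.target j η) k) =
    C.twist k + if k = j ∨ k = C.mate j then C.twist (next j η) else 0 := by
  simp [slide, moved]

theorem slide_isSite (k : ℕ) :
    (C.slide j η h).IsSite (siteMove j (C.target j η) k) ↔ C.IsSite k := by
  have h1 := h.1
  have h2 := isSite_target h
  unfold IsSite at *
  rw [slide_rank, siteMove_apply]
  split_ifs <;> omega

theorem slide_isSite' (k : ℕ) : (C.slide j η h).IsSite k ↔ C.IsSite k := Iff.rfl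

theorem target_eq {j : ℕ} {η : ℤˣ} (h : C.Admissible j η) : (C.target j η : ℤ) =
    siteMove j (C.target j η) (C.mate (next j η)) + (C.side (next j η) η : ℤ) := by
  have h1 := (isSite_mate h.2.1).1
  have h3 := mate_next_ne h
  rw [siteMove_apply]
  unfold target
  rcases Int.units_eq_one_or (C.side (next j η) η) with e | e <;> rw [e] <;>
  simp only [reduceIte, if_neg (show ¬ (-1 : ℤˣ) = 1 by decide), Units.val_one, Units.val_neg] <;>
  split_ifs <;> omega

/-- The slid site sits beside the far end of the band, on the side recorded by `side`. A step in the
opposite direction meets the same band again, so the slide can be undone by a slide. -/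
theorem next_target {j : ℕ} {η : ℤˣ} (h : C.Admissible j η) : next (C.target j η) (-C.side (next j η) η) =
    siteMove j (C.target j η) (C.mate (next j η)) := by
  have := target_eq h
  rw [next]
  push_cast
  omega

theorem slide_admissible : (C.slide j η h).Admissible (C.target j η) (-C.side (next j η) η) := by
  refine ⟨isSite_target h, ?_, ?_⟩
  · rw [next_target h, slide_isSite h]; exact isSite_mate h.2.1
  · have h1 : C.target j η = siteMove j (C.target j η) j := (siteMove_self_left _ _).symm
    rw [next_target h]
    conv_lhs => rw [h1]
    rw [slide_mate]
    intro e
    exact next_ne h (mate_inj ((siteMove _ _).injective e)).symm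

theorem slide_isSlidePerm : (C.slide j η h).IsSlidePerm (C.target j η) (-C.side (next j η) η)
    (siteMove (C.target j η) j) where
  outside k hk := by
    have h1 := h.1
    have h2 := isSite_target h
    unfold IsSite at *
    rw [slide_rank] at hk
    rw [siteMove_apply]
    split_ifs <;> omega
  mono k l _ _ hk hl hkl := by
    simp only [siteMove_apply]
    split_ifs <;> omega
  place := by
    -- By admissibility `j` is not an end of the band it slides over, so that band keeps its twist.
    have e : (C.slide j η h).twist (next (C.target j η) (-C.side (next j η) η)) =
        C.twist (next j η) := by
      rw [next_target h, slide_twist, C.twist_mate, if_neg, add_zero]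
      rintro (e | e)
      · exact mate_next_ne h e
      · exact next_ne h (mate_inj e)
    rw [e, siteMove_self_left, next_target h, slide_mate, siteMove_siteMove, C.mate_mate]
    have h1 := h.1.1
    unfold side next
    rcases Int.units_eq_one_or η with e | e <;> subst e <;> split_ifs <;> simp <;> omega

end

/-! ### Connectedness of the boundary under slides -/

theorem Reachable.line {k : ℕ} (h1 : C.IsSite k) (h2 : C.IsSite (k + 1)) :
    C.boundaryGraph.Reachable (k, 1) (k + 1, -1) := by
  apply SimpleGraph.Adj.reachable
  rw [boundaryGraph, SimpleGraph.fromRel_adj]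
  refine ⟨by simp, Or.inl ⟨h1, h2, Or.inl ⟨rfl, rfl, rfl⟩⟩⟩

theorem Reachable.band {k : ℕ} (h1 : C.IsSite k) (κ : ℤˣ) :
    C.boundaryGraph.Reachable (k, κ) (C.mate k, C.side k (-κ)) := by
  apply SimpleGraph.Adj.reachable
  rw [boundaryGraph, SimpleGraph.fromRel_adj]
  refine ⟨fun e => mate_ne h1 (congrArg Prod.fst e).symm, Or.inl ⟨h1, isSite_mate h1, Or.inr ?_⟩⟩
  unfold side
  by_cases h : C.twist k = 0
  · exact Or.inl ⟨rfl, h, by simp [h]⟩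
  · have : ∀ x : ZMod 2, x ≠ 0 → x = 1 := by decide
    exact Or.inr ⟨rfl, this _ h, by simp [h]⟩

/-- To map boundary graphs it suffices to treat the two kinds of edges. -/
theorem reachable_map {α : Type*} {G : SimpleGraph α} (ψ : ℕ × ℤˣ → α)
    (hl : ∀ k, C.IsSite k → C.IsSite (k + 1) → G.Reachable (ψ (k, 1)) (ψ (k + 1, -1)))
    (hb : ∀ k κ, C.IsSite k → G.Reachable (ψ (k, κ)) (ψ (C.mate k, C.side k (-κ))))
    {x y : ℕ × ℤˣ} (h : C.boundaryGraph.Reachable x y) : G.Reachable (ψ x) (ψ y) := by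
  obtain ⟨w⟩ := h
  induction w with
  | nil => rfl
  | @cons u v z huv p ih =>
    refine SimpleGraph.Reachable.trans ?_ ih
    have key : ∀ x y : ℕ × ℤˣ, (C.IsSite x.1 ∧ C.IsSite y.1 ∧
      ((y.1 = x.1 + 1 ∧ x.2 = 1 ∧ y.2 = -1) ∨
        (y.1 = C.mate x.1 ∧ C.twist x.1 = 0 ∧ y.2 = -x.2) ∨
        (y.1 = C.mate x.1 ∧ C.twist x.1 = 1 ∧ y.2 = x.2))) → G.Reachable (ψ x) (ψ y) := by
      rintro ⟨a, κ⟩ ⟨b, μ⟩ ⟨h1, h2, h⟩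
      dsimp only at *
      rcases h with ⟨rfl, rfl, rfl⟩ | ⟨rfl, h, rfl⟩ | ⟨rfl, h, rfl⟩
      · exact hl _ h1 h2
      · simpa [side, h] using hb a κ h1
      · simpa [side, h] using hb a μ h1
    rw [boundaryGraph, SimpleGraph.fromRel_adj] at huv
    rcases huv.2 with h | h
    · exact key _ _ h
    · exact (key _ _ h).symm

/-- Twists add in `ZMod 2` and `side` is the corresponding sign, so on the part of `j` the two signs
compose. -/
theorem slide_side {j : ℕ} {η : ℤˣ} (h : C.Admissible j η) (k : ℕ) (κ : ℤˣ) :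
    (C.slide j η h).side (siteMove j (C.target j η) k) κ =
      if k = j ∨ k = C.mate j then C.side k (C.side (next j η) κ) else C.side k κ := by
  have key : ∀ x y : ZMod 2, (x + y = 0 ↔ (x = 0 ↔ y = 0)) := by decide
  unfold side
  rw [slide_twist]
  by_cases e : k = j ∨ k = C.mate j
  · simp only [if_pos e, key]
    split_ifs <;> simp_all
  · simp only [if_neg e, add_zero]

set_option maxHeartbeats 1600000 in
-- The boundary of the surface is followed through the slide by a map `ψ` of boundary vertices that
-- sends each old edge to a path of the new graph. The corner between `j` and the band it slides
-- over collapses to a point, as does the adjacent side of that band; the piece of boundary before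
-- `j` is rerouted along this side of the band. The two new vertices missed by `ψ` lie on that
-- detour.
theorem slide_oneBoundary {j : ℕ} {η : ℤˣ} (h : C.Admissible j η) (hC : C.OneBoundary) :
    (C.slide j η h).OneBoundary := by
  have hjs := h.1
  have hhs := h.2.1
  have hms := isSite_mate h.2.1
  have hts := isSite_target h
  have hhj := next_ne h
  have hmj := mate_next_ne h
  have hmh := mate_ne h.2.1
  have hpj := mate_ne h.1
  have hph : C.mate j ≠ next j η := h.2.2
  have hpm : C.mate j ≠ C.mate (next j η) := fun e => hhj (mate_inj e).symm
  have hline : ∀ a b, C.IsSite a → C.IsSite b → b = a + 1 →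
      (C.slide j η h).boundaryGraph.Reachable (a, 1) (b, -1) := by
    rintro a b ha hb rfl
    exact Reachable.line ha hb
  have hband : ∀ k κ, C.IsSite k → (C.slide j η h).boundaryGraph.Reachable
      (siteMove j (C.target j η) k, κ) (siteMove j (C.target j η) (C.mate k),
        if k = j ∨ k = C.mate j then C.side k (C.side (next j η) (-κ)) else C.side k (-κ)) := by
    intro k κ hk
    have := Reachable.band (C := C.slide j η h) ((slide_isSite h k).2 hk) κ
    rwa [slide_mate, slide_side] at this
  -- The detour: from the end of the band that faced `j`, along the band (`c1`), and then to the
  -- slid site next to its far end (`c2`).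
  have c1 : (C.slide j η h).boundaryGraph.Reachable (siteMove j (C.target j η) (next j η), -η)
      (siteMove j (C.target j η) (C.mate (next j η)), C.side (next j η) η) := by
    have := hband (next j η) (-η) hhs
    rwa [if_neg (by rintro (e | e); exacts [hhj e, hph e.symm]), neg_neg] at this
  have hteq := target_eq h
  have hτ : ∀ k, siteMove j (C.target j η) k = if k = j then C.target j η else
    if j < k ∧ k ≤ C.target j η then k - 1 else
      if C.target j η ≤ k ∧ k < j then k + 1 else k := siteMove_apply _ _
  have hτs : ∀ k, C.IsSite k → C.IsSite (siteMove j (C.target j η) k) := fun k hk =>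
    (slide_isSite h k).2 hk
  have hsq : ∀ x : ℤˣ, x * x = 1 := fun x => Int.units_mul_self x
  have hsd : ∀ k κ, C.side k (-κ) = - C.side k κ := by
    intro k κ; unfold side; split_ifs <;> rfl
  have hsm : ∀ k κ κ', C.side k (κ * κ') = C.side k κ * κ' := by
    intro k κ κ'; unfold side; split_ifs <;> simp
  have hss : ∀ k κ, C.side k (C.side k κ) = κ := by
    intro k κ; unfold side; split_ifs <;> simp
  have hsmate : ∀ k κ, C.side (C.mate k) κ = C.side k κ := by
    intro k κ; unfold side; rw [C.twist_mate]
  have hjn : next j η = if η = 1 then j + 1 else j - 1 := by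
    rcases Int.units_eq_one_or η with e | e <;> rw [e]
    · rw [next_one]; rfl
    · rw [next_neg_one]; rfl
  have hδη : C.side (next j η) η * η = C.side (next j η) 1 := by
    conv_lhs => rw [← hsm, hsq]
  generalize hh : next j η = i at *
  generalize hm : C.mate i = m at *
  generalize hδ : C.side i η = δ at *
  generalize ht : C.target j η = t at *
  generalize hτ' : siteMove j t = τ at *
  have c2 : (C.slide j η h).boundaryGraph.Reachable (τ m, δ) (t, -δ) := by
    rcases Int.units_eq_one_or δ with e | e <;> rw [e] at hteq ⊢
    · exact hline _ _ (hτs _ hms) hts (by simp at hteq; omega)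
    · exact (hline _ _ hts (hτs _ hms) (by simp at hteq; omega)).symm
  have c3 := c1.trans c2
  have hi' : C.mate m = i := by rw [← hm, C.mate_mate]
  -- The vertices `(j, η)`, `(i, -η)` and `(m, δ)`, consecutive on the old boundary, all go to `(t,
  -- δ)`. The factor `δ * η` at `j` records whether the slid end arrives with its two sides
  -- exchanged.
  let ψ : ℕ × ℤˣ → ℕ × ℤˣ := fun x =>
    if (x.1 = i ∧ x.2 = -η) ∨ (x.1 = m ∧ x.2 = δ) then (t, δ)
    else if x.1 = j then (t, x.2 * (δ * η)) else (τ x.1, x.2)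
  have hψj : ∀ κ, ψ (j, κ) = (t, κ * (δ * η)) := by
    intro κ
    simp only [ψ]
    rw [if_neg (by rintro (⟨e, -⟩ | ⟨e, -⟩); exacts [hhj e.symm, hmj e.symm])]
    simp
  have hψX : ψ (i, -η) = (t, δ) := by simp [ψ]
  have hψY : ψ (m, δ) = (t, δ) := by simp [ψ]
  have hψi : ψ (i, η) = (τ i, η) := by
    have : η ≠ -η := by rcases Int.units_eq_one_or η with e | e <;> rw [e] <;> decide
    simp [ψ, this, hhj, hmh.symm]
  have hψm : ψ (m, -δ) = (τ m, -δ) := by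
    have : -δ ≠ δ := by rcases Int.units_eq_one_or δ with e | e <;> rw [e] <;> decide
    simp [ψ, this, hmj, hmh]
  have hψo : ∀ k κ, k ≠ i → k ≠ m → k ≠ j → ψ (k, κ) = (τ k, κ) := by
    intro k κ h1 h2 h3
    simp [ψ, h1, h2, h3]
  have hmap : ∀ x y, C.IsSite x.1 → C.IsSite y.1 →
      (C.slide j η h).boundaryGraph.Reachable (ψ x) (ψ y) := by
    intro x y hx hy
    refine reachable_map ψ ?_ ?_ (hC x y hx hy)
    · intro k hk hk'
      have hlineκ : ∀ (κ : ℤˣ) a b, C.IsSite a → C.IsSite b → (b : ℤ) = a + κ →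
          (C.slide j η h).boundaryGraph.Reachable (a, κ) (b, -κ) := by
        intro κ a b ha hb e
        rcases Int.units_eq_one_or κ with rfl | rfl
        · exact hline a b ha hb (by simp at e; omega)
        · exact (hline b a hb ha (by simp at e; omega)).symm
      have hij : (i : ℤ) = j + η := by
        have := hjs.1
        rcases Int.units_eq_one_or η with rfl | rfl <;> simp at hjn ⊢ <;> omega
      -- Without `j`, its other neighbour `a` is adjacent to `i`, and from there the detour `c3`
      -- leads to `(t, -δ)`. The exception is `a = m` with `η = δ`: then the slid site lands between
      -- `a` and `i`, and the line starts at `(t, δ)`.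
      have hjA : ∀ a, C.IsSite a → (a : ℤ) + η = j →
          (C.slide j η h).boundaryGraph.Reachable (ψ (a, η)) (t, -δ) := by
        intro a ha e
        have hai : a ≠ i := by rintro rfl; rcases Int.units_eq_one_or η with rfl | rfl <;>
          simp at hij e <;> omega
        have haj : a ≠ j := by rintro rfl; rcases Int.units_eq_one_or η with rfl | rfl <;>
          simp at e
        by_cases ham : a = m
        · subst ham
          by_cases hδ' : η = δ
          · subst hδ'
            rw [hψY]
            refine (hlineκ η t _ hts (hτs _ hhs) ?_).trans c3
            rw [hτ] at hteq ⊢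
            rcases Int.units_eq_one_or η with rfl | rfl <;> simp at hij e hteq ⊢ <;>
            split_ifs at hteq ⊢ <;> omega
          · obtain rfl : η = -δ := Int.units_ne_iff_eq_neg.1 hδ'
            rw [hψm]
            refine (hlineκ (-δ) _ _ (hτs _ ha) (hτs _ hhs) ?_).trans c3
            rw [hτ] at hteq ⊢
            rw [hτ]
            rcases Int.units_eq_one_or δ with rfl | rfl <;> simp at hij e hteq ⊢ <;>
            split_ifs at hteq ⊢ <;> omega
        · rw [hψo _ _ hai ham haj]
          refine (hlineκ _ _ _ (hτs _ ha) (hτs _ hhs) ?_).trans c3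
          rw [hτ] at hteq ⊢
          rw [hτ]
          rcases Int.units_eq_one_or η with rfl | rfl <;>
          rcases Int.units_eq_one_or δ with rfl | rfl <;> simp at hij e hteq ⊢ <;>
          split_ifs at hteq ⊢ <;> omega
      -- The line that used to leave the far end `m` in the direction `δ` now leaves the slid site,
      -- which has been put in between.
      have hYB : ∀ b, C.IsSite b → b ≠ j → (b : ℤ) = m + δ →
          (C.slide j η h).boundaryGraph.Reachable (t, δ) (ψ (b, -δ)) := by
        intro b hb hbj e
        have hbm : b ≠ m := by rintro rfl; rcases Int.units_eq_one_or δ with rfl | rfl <;>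
          simp at e
        have h1 : ψ (b, -δ) = (τ b, -δ) := by
          by_cases hbi : b = i
          · subst hbi
            rcases Int.units_eq_one_or η with rfl | rfl <;>
            rcases Int.units_eq_one_or δ with rfl | rfl
            · simp at hij e; omega
            · exact hψi
            · exact hψi
            · simp at hij e; omega
          · exact hψo _ _ hbi hbm hbj
        rw [h1]
        refine hlineκ _ _ _ hts (hτs _ hb) ?_
        rw [hτ] at hteq ⊢
        rcases Int.units_eq_one_or δ with rfl | rfl <;> simp at e hteq ⊢ <;>
          split_ifs at hteq ⊢ <;> omega
      -- Away from `j`, from the sites facing `j`, and from `(m, δ)`, the map `ψ` only renumbers the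
      -- sites.
      have hgen : ∀ a (κ : ℤˣ), a ≠ j → (a : ℤ) + κ ≠ j → ¬ (a = m ∧ κ = δ) → ψ (a, κ) = (τ a, κ) := by
        intro a κ h1 h2 h3
        by_cases e1 : a = i
        · subst e1
          obtain rfl : κ = η := by
            rcases Int.units_eq_one_or η with rfl | rfl <;>
            rcases Int.units_eq_one_or κ with rfl | rfl <;> simp at hij h2 ⊢ <;> omega
          exact hψi
        by_cases e2 : a = m
        · subst e2
          obtain rfl : κ = -δ := by
            rcases Int.units_eq_one_or δ with rfl | rfl <;>
            rcases Int.units_eq_one_or κ with rfl | rfl <;> simp at h3 ⊢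
          exact hψm
        exact hψo _ _ e1 e2 h1
      have hmain : ∀ (κ : ℤˣ) a b, C.IsSite a → C.IsSite b → (b : ℤ) = a + κ → b = j →
          (C.slide j η h).boundaryGraph.Reachable (ψ (a, κ)) (ψ (b, -κ)) := by
        intro κ a b ha hb e e'
        subst e'
        rcases Int.units_eq_one_or (κ * η) with e1 | e1
        · obtain rfl : κ = η := by rw [← mul_one κ, ← hsq η, ← mul_assoc, e1, one_mul]
          rw [hψj, mul_comm δ, ← mul_assoc, neg_mul, hsq, neg_one_mul]
          exact hjA a ha e.symm
        · obtain rfl : κ = -η := by rw [← mul_one κ, ← hsq η, ← mul_assoc, e1, neg_one_mul]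
          obtain rfl : a = i := by push_cast at e; omega
          rw [hψX, hψj, neg_neg, mul_comm δ, ← mul_assoc, hsq, one_mul]
      by_cases e1 : k + 1 = j
      · exact hmain 1 k (k + 1) hk hk' (by simp) e1
      by_cases e2 : k = j
      · exact (hmain (-1) (k + 1) k hk' hk (by simp) e2).symm
      by_cases e3 : k = m ∧ 1 = δ
      · obtain ⟨rfl, rfl⟩ := e3
        rw [hψY]
        exact hYB _ hk' e1 (by simp)
      by_cases e4 : k + 1 = m ∧ -1 = δ
      · obtain ⟨rfl, rfl⟩ := e4
        rw [hψY]
        exact (hYB _ hk e2 (by simp)).symm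
      rw [hgen k 1 e2 (by simp; omega) e3, hgen (k + 1) (-1) e1 (by simp; omega) e4]
      refine hlineκ 1 _ _ (hτs _ hk) (hτs _ hk') ?_
      rw [hτ] at hteq ⊢
      rw [hτ]
      rcases Int.units_eq_one_or δ with rfl | rfl <;> simp at e3 e4 hteq ⊢ <;>
          split_ifs at hteq ⊢ <;> omega
    · have hj : ∀ κ, (C.slide j η h).boundaryGraph.Reachable (ψ (j, κ))
          (ψ (C.mate j, C.side j (-κ))) := by
        intro κ
        -- The factor `δ * η` is the sign of the band slid over; it cancels against the twist which
        -- the part of `j` gains.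
        have := hband j (κ * (δ * η)) hjs
        rw [if_pos (Or.inl rfl), hτ j, if_pos rfl, hδη,
          show -(κ * C.side i 1) = C.side i 1 * -κ by rw [mul_neg, mul_comm], hsm, hss, one_mul] at this
        rw [hψj, hψo _ _ hph hpm hpj, hδη]
        exact this
      -- Of the two sides of this band, the one next to `j` is collapsed by `ψ` and the other one is
      -- kept.
      have hi : ∀ κ, (C.slide j η h).boundaryGraph.Reachable (ψ (i, κ))
          (ψ (m, C.side i (-κ))) := by
        intro κ
        rcases (Int.units_eq_one_or (κ * η)) with e | e
        · obtain rfl : κ = η := by rw [← mul_one κ, ← hsq η, ← mul_assoc, e, one_mul]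
          have := hband i κ hhs
          rw [if_neg (by rintro (e | e); exacts [hhj e, hph e.symm]), hm, hsd, hδ] at this
          rw [hsd, hδ, hψi, hψm]
          exact this
        · obtain rfl : κ = -η := by rw [← mul_one κ, ← hsq η, ← mul_assoc, e, neg_one_mul]
          rw [neg_neg, hδ, hψX, hψY]
      intro k κ hk
      by_cases e1 : k = j
      · subst e1; exact hj κ
      by_cases e2 : k = i
      · subst e2; rw [hm]; exact hi κ
      by_cases e3 : k = C.mate j
      · subst e3
        have := (hj (C.side j (-κ))).symm
        rw [← hsd, neg_neg, hss] at this
        rwa [C.mate_mate, hsmate]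
      by_cases e4 : k = m
      · subst e4
        have := (hi (C.side i (-κ))).symm
        rw [← hsd, neg_neg, hss] at this
        rwa [hi', ← hm, hsmate, hm]
      have e5 : C.mate k ≠ j := fun e => e3 (by rw [← e, C.mate_mate])
      rw [hψo _ _ e2 e4 e1, hψo _ _ (fun e => e4 (by rw [← hm, ← e, C.mate_mate]))
        (fun e => e2 (mate_inj (e.trans hm.symm))) e5]
      have := hband k κ hk
      rwa [if_neg (by rintro (e | e); exacts [e1 e, e3 e])] at this
  -- The image of `ψ` misses only `(τ i, -η)` and `(τ m, δ)`. Both are joined to `(t, -δ)`, the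
  -- image of `(j, -η)`, by the detour.
  have hall : ∀ x, C.IsSite x.1 → (C.slide j η h).boundaryGraph.Reachable (ψ (j, 1)) x := by
    rintro ⟨b, κ⟩ hb
    have h3 : (C.slide j η h).boundaryGraph.Reachable (ψ (j, 1)) (t, -δ) := by
      have := hmap (j, 1) (j, -η) hjs hjs
      rwa [hψj (-η), show -η * (δ * η) = -δ by rw [mul_comm δ, ← mul_assoc, neg_mul, hsq,
        neg_one_mul]] at this
    obtain ⟨a, rfl⟩ := τ.surjective b
    have ha : C.IsSite a := (slide_isSite h a).1 (by rw [ht, hτ']; exact hb)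
    by_cases e1 : a = j
    · subst e1
      have := hmap (a, 1) (a, κ * (δ * η)) ha ha
      rwa [hψj (κ * _), mul_assoc, hsq, mul_one, ← if_pos (α := ℕ) (rfl : a = a) (t := t), ← hτ] at this
    by_cases e2 : a = i
    · subst e2
      rcases (Int.units_eq_one_or (κ * η)) with e | e
      · obtain rfl : κ = η := by rw [← mul_one κ, ← hsq η, ← mul_assoc, e, one_mul]
        rw [← hψi]; exact hmap _ _ hjs ha
      · obtain rfl : κ = -η := by rw [← mul_one κ, ← hsq η, ← mul_assoc, e, neg_one_mul]
        exact h3.trans c3.symm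
    by_cases e3 : a = m
    · subst e3
      rcases (Int.units_eq_one_or (κ * δ)) with e | e
      · obtain rfl : κ = δ := by rw [← mul_one κ, ← hsq δ, ← mul_assoc, e, one_mul]
        exact h3.trans c2.symm
      · obtain rfl : κ = -δ := by rw [← mul_one κ, ← hsq δ, ← mul_assoc, e, neg_one_mul]
        rw [← hψm]; exact hmap _ _ hjs ha
    rw [← hψo _ _ e2 e3 e1]
    exact hmap _ _ hjs ha
  intro x y hx hy
  exact (hall x hx).symm.trans (hall y hy)

end TCD

/-! ### Normal form of chord data with one boundary component -/

namespace TCD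

/-- `C₁` is obtained from `C` by one handle slide. -/
def Slides (C C₁ : TCD) : Prop := ∃ j η, ∃ h : C.Admissible j η, C₁ = C.slide j η h

/-- `C₁` is obtained from `C` by handle slides, and they agree on the sites up to `L`. -/
structure SlidesAbove (L : ℕ) (C C₁ : TCD) : Prop where
  slides : Relation.ReflTransGen Slides C C₁
  rank_eq : C₁.rank = C.rank
  mate_eq : ∀ k ≤ L, C₁.mate k = C.mate k
  twist_eq : ∀ k ≤ L, C₁.twist k = C.twist k

/-- The sites up to `L` are matched among themselves. -/
def ClosedBelow (C : TCD) (L : ℕ) : Prop := ∀ k ≤ L, C.mate k ≤ L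

/-- There are two untwisted crossing arcs above `L`. -/
def HasCross (C : TCD) (L : ℕ) : Prop := ∃ a₁ a₂ b₁ b₂, L < a₁ ∧ a₁ < a₂ ∧ a₂ < b₁ ∧ b₁ < b₂ ∧
  C.mate a₁ = b₁ ∧ C.mate a₂ = b₂ ∧ C.twist a₁ = 0 ∧ C.twist a₂ = 0

/-- The four sites after `L` carry two crossing untwisted arcs. -/
def TorAt (C : TCD) (L : ℕ) : Prop :=
  C.mate (L + 1) = L + 3 ∧ C.mate (L + 2) = L + 4 ∧ C.twist (L + 1) = 0 ∧ C.twist (L + 2) = 0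

/-- The two sites after `L` carry a twisted arc. -/
def MobAt (C : TCD) (L : ℕ) : Prop := C.mate (L + 1) = L + 2 ∧ C.twist (L + 1) = 1

variable {C C₁ C₂ : TCD} {L : ℕ}

theorem SlidesAbove.refl (C : TCD) (L : ℕ) : SlidesAbove L C C := ⟨.refl, rfl, by simp, by simp⟩

theorem SlidesAbove.trans (h₁ : SlidesAbove L C C₁) (h₂ : SlidesAbove L C₁ C₂) :
    SlidesAbove L C C₂ where
  slides := h₁.slides.trans h₂.slides
  rank_eq := h₂.rank_eq.trans h₁.rank_eq
  mate_eq k hk := (h₂.mate_eq k hk).trans (h₁.mate_eq k hk)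
  twist_eq k hk := (h₂.twist_eq k hk).trans (h₁.twist_eq k hk)

theorem SlidesAbove.mono {L' : ℕ} (h : SlidesAbove L C C₁) (hL : L' ≤ L) : SlidesAbove L' C C₁ :=
  ⟨h.slides, h.rank_eq, fun k hk => h.mate_eq k (hk.trans hL), fun k hk => h.twist_eq k (hk.trans hL)⟩

theorem SlidesAbove.closedBelow (h : SlidesAbove L C C₁) (hC : C.ClosedBelow L) :
    C₁.ClosedBelow L := fun k hk => by rw [h.mate_eq k hk]; exact hC k hk

theorem SlidesAbove.oneBoundary (h : SlidesAbove L C C₁) (hC : C.OneBoundary) :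
    C₁.OneBoundary := by
  have := h.slides
  clear h
  induction this with
  | refl => exact hC
  | tail _ h ih => obtain ⟨j, η, h, rfl⟩ := h; exact slide_oneBoundary h ih

theorem SlidesAbove.torAt {r : ℕ} (h : SlidesAbove L C C₁) (hr : r + 4 ≤ L) (hC : C.TorAt r) :
    C₁.TorAt r := by
  unfold TorAt at *
  rw [h.mate_eq _ (by omega), h.mate_eq _ (by omega), h.twist_eq _ (by omega),
    h.twist_eq _ (by omega)]
  exact hC

theorem SlidesAbove.mobAt {r : ℕ} (h : SlidesAbove L C C₁) (hr : r + 2 ≤ L) (hC : C.MobAt r) :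
    C₁.MobAt r := by
  unfold MobAt at *
  rw [h.mate_eq _ (by omega), h.twist_eq _ (by omega)]
  exact hC

theorem lt_mate_of_closedBelow (hL : C.ClosedBelow L) {k : ℕ} (hk : L < k) : L < C.mate k := by
  by_contra h
  have := hL _ (not_lt.1 h)
  rw [C.mate_mate] at this
  omega

theorem isSite_of_mate_ne {k : ℕ} (h : C.mate k ≠ k) : C.IsSite k := by
  by_contra h'
  exact h (mate_of_not h')

/-- Both ends of the band slid over lie above `L`, hence so does the landing place, and the move
permutes only sites above `L`. -/
theorem slidesAbove_slide {j : ℕ} {η : ℤˣ} (h : C.Admissible j η) (hL : C.ClosedBelow L)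
    (hj : L < j) (hn : L < next j η) : SlidesAbove L C (C.slide j η h) := by
  have hm := lt_mate_of_closedBelow hL hn
  have hmj := mate_next_ne h
  have ht : L < C.target j η := by
    unfold target
    split_ifs <;> omega
  have hfix : ∀ k ≤ L, siteMove j (C.target j η) k = k := by
    intro k hk
    rw [siteMove_apply]
    split_ifs <;> omega
  refine ⟨.single ⟨j, η, h, rfl⟩, rfl, fun k hk => ?_, fun k hk => ?_⟩
  · have := slide_mate h k
    rwa [hfix k hk, hfix _ (hL k hk)] at this
  · have := slide_twist h k
    rwa [hfix k hk, if_neg, add_zero] at this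
    rintro (rfl | rfl)
    · omega
    · have := hL _ hk
      rw [C.mate_mate] at this
      omega

/-- The slide of `x` to the right over an untwisted band. -/
theorem exists_slide_untwisted (hL : C.ClosedBelow L) {x : ℕ} (hx : L < x)
    (hs : C.IsSite (x + 1)) (hne : C.mate (x + 1) ≠ x) (ht : C.twist (x + 1) = 0) :
    ∃ C₁ t, SlidesAbove L C C₁ ∧ (t = if x < C.mate (x + 1) then C.mate (x + 1)
        else C.mate (x + 1) + 1) ∧
      (∀ k, C₁.mate (siteMove x t k) = siteMove x t (C.mate k)) ∧
      ∀ k, C₁.twist (siteMove x t k) = C.twist k := by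
  have h : C.Admissible x 1 := by
    refine ⟨⟨by omega, by have := hs.2; omega⟩, by rwa [next_one], fun e => hne ?_⟩
    rw [next_one] at e
    rw [← e, C.mate_mate]
  refine ⟨C.slide x 1 h, C.target x 1, slidesAbove_slide h hL hx (by rw [next_one]; omega), ?_,
    slide_mate h, fun k => ?_⟩
  · simp [target, side, next_one, ht]
  · rw [slide_twist, next_one, ht, ite_self, add_zero]

/-- The slide of `x` to the right over a twisted band. -/
theorem exists_slide_twisted_right (hL : C.ClosedBelow L) {x : ℕ} (hx : L < x)
    (hs : C.IsSite (x + 1)) (hlt : x < C.mate (x + 1)) (ht : C.twist (x + 1) = 1) :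
    ∃ C₁ t, SlidesAbove L C C₁ ∧ t = C.mate (x + 1) - 1 ∧
      (∀ k, C₁.mate (siteMove x t k) = siteMove x t (C.mate k)) ∧
      ∀ k, C₁.twist (siteMove x t k) = C.twist k + if k = x ∨ k = C.mate x then 1 else 0 := by
  have h : C.Admissible x 1 := by
    refine ⟨⟨by omega, by have := hs.2; omega⟩, by rwa [next_one], fun e => hlt.ne ?_⟩
    rw [next_one] at e
    rw [← e, C.mate_mate]
  refine ⟨C.slide x 1 h, C.target x 1, slidesAbove_slide h hL hx (by rw [next_one]; omega), ?_,
    slide_mate h, fun k => ?_⟩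
  · simp [target, side, next_one, ht, hlt]
  · rw [slide_twist, next_one, ht]

/-- The slide of `x` to the left over a twisted band. -/
theorem exists_slide_twisted_left (hL : C.ClosedBelow L) {x : ℕ} (hx : L < x)
    (hs : C.IsSite (x + 1)) (hlt : x + 1 < C.mate x) (ht : C.twist x = 1) :
    ∃ C₁ t, SlidesAbove L C C₁ ∧ t = C.mate x ∧
      (∀ k, C₁.mate (siteMove (x + 1) t k) = siteMove (x + 1) t (C.mate k)) ∧
      ∀ k, C₁.twist (siteMove (x + 1) t k) =
        C.twist k + if k = x + 1 ∨ k = C.mate (x + 1) then 1 else 0 := by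
  have h : C.Admissible (x + 1) (-1) := by
    refine ⟨hs, ?_, fun e => hlt.ne ?_⟩
    · rw [next_neg_one]; exact ⟨by omega, by have := hs.2; omega⟩
    · rw [next_neg_one, Nat.add_sub_cancel] at e
      rw [← congrArg C.mate e, C.mate_mate]
  refine ⟨C.slide (x + 1) (-1) h, C.target (x + 1) (-1), slidesAbove_slide h hL (by omega)
    (by rw [next_neg_one]; omega), ?_, slide_mate h, fun k => ?_⟩
  · simp [target, side, next_neg_one, ht, hlt]
  · rw [slide_twist, next_neg_one, Nat.add_sub_cancel, ht]

/-- As long as the four ends of the crossing arcs are not the first four sites above `L`, one of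
them has a foreign site directly before it. That site is slid to the right over the arc in question
and leaves the gap. -/
theorem exists_torAt (hL : C.ClosedBelow L) (h : C.HasCross L) :
    ∃ C₁, SlidesAbove L C C₁ ∧ C₁.TorAt L := by
  obtain ⟨a₁, a₂, b₁, b₂, h0, h1, h2, h3, m1, m2, t1, t2⟩ := h
  -- A foreign site before `a₁`, `a₂`, `b₁`, `b₂` lands just after `b₁`, `b₂`, `a₁`, `a₂`
  -- respectively. The four gaps `(a₁ - L, a₂ - a₁, b₁ - a₂, b₂ - b₁)` change by `(-1, 0, 0, 1)`,
  -- `(0, -1, 0, 0)`, `(0, 1, -1, 0)`, `(0, 0, 1, -1)`; with the weights `4, 1, 2, 3` every move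
  -- lowers the total by one.
  induction hW : 4 * (a₁ - L) + (a₂ - a₁) + 2 * (b₁ - a₂) + 3 * (b₂ - b₁) using
    Nat.strong_induction_on generalizing C a₁ a₂ b₁ b₂ with
  | _ W ih =>
    have n1 : C.mate b₁ = a₁ := by rw [← m1, C.mate_mate]
    have n2 : C.mate b₂ = a₂ := by rw [← m2, C.mate_mate]
    have u1 : C.twist b₁ = 0 := by rw [← m1, C.twist_mate, t1]
    have u2 : C.twist b₂ = 0 := by rw [← m2, C.twist_mate, t2]
    have s1 : C.IsSite a₁ := isSite_of_mate_ne (by omega)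
    have s2 : C.IsSite a₂ := isSite_of_mate_ne (by omega)
    have s3 : C.IsSite b₁ := isSite_of_mate_ne (by omega)
    have s4 : C.IsSite b₂ := isSite_of_mate_ne (by omega)
    have step : ∀ x, L < x → (x + 1 = a₁ ∨ x + 1 = a₂ ∨ x + 1 = b₁ ∨ x + 1 = b₂) → x ≠ a₁ →
        x ≠ a₂ → x ≠ b₁ → x ≠ b₂ → ∃ C₁, SlidesAbove L C C₁ ∧ C₁.TorAt L := by
      intro x hx hx1 d1 d2 d3 d4
      obtain ⟨C₁, t, hS, ht, hm, htw⟩ := exists_slide_untwisted hL hx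
        (by rcases hx1 with e | e | e | e <;> rw [e] <;> assumption)
        (by rcases hx1 with e | e | e | e <;> rw [e] <;> omega)
        (by rcases hx1 with e | e | e | e <;> rw [e] <;> assumption)
      have fin : ∀ c₁ c₂ d₁ d₂, siteMove x t a₁ = c₁ → siteMove x t a₂ = c₂ →
          siteMove x t b₁ = d₁ → siteMove x t b₂ = d₂ → L < c₁ → c₁ < c₂ → c₂ < d₁ → d₁ < d₂ →
          4 * (c₁ - L) + (c₂ - c₁) + 2 * (d₁ - c₂) + 3 * (d₂ - d₁) < W →
          ∃ C₁, SlidesAbove L C C₁ ∧ C₁.TorAt L := by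
        rintro c₁ c₂ d₁ d₂ rfl rfl rfl rfl g0 g1 g2 g3 g4
        obtain ⟨C₂, hS', hT⟩ := ih _ g4 (hS.closedBelow hL) _ _ _ _ g0 g1 g2 g3
          (by rw [hm, m1]) (by rw [hm, m2]) (by rw [htw, t1]) (by rw [htw, t2]) rfl
        exact ⟨C₂, hS.trans hS', hT⟩
      rcases hx1 with e | e | e | e <;> rw [e] at ht
      · obtain rfl : t = b₁ := by rw [ht, m1, if_pos (by omega)]
        refine fin (a₁ - 1) (a₂ - 1) (t - 1) b₂ ?_ ?_ ?_ ?_ ?_ ?_ ?_ ?_ ?_ <;>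
          first | omega | (rw [siteMove_apply]; split_ifs <;> omega)
      · obtain rfl : t = b₂ := by rw [ht, m2, if_pos (by omega)]
        refine fin a₁ (a₂ - 1) (b₁ - 1) (t - 1) ?_ ?_ ?_ ?_ ?_ ?_ ?_ ?_ ?_ <;>
          first | omega | (rw [siteMove_apply]; split_ifs <;> omega)
      · obtain rfl : t = a₁ + 1 := by rw [ht, n1, if_neg (by omega)]
        refine fin a₁ (a₂ + 1) b₁ b₂ ?_ ?_ ?_ ?_ ?_ ?_ ?_ ?_ ?_ <;>
          first | omega | (rw [siteMove_apply]; split_ifs <;> omega)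
      · obtain rfl : t = a₂ + 1 := by rw [ht, n2, if_neg (by omega)]
        refine fin a₁ a₂ (b₁ + 1) b₂ ?_ ?_ ?_ ?_ ?_ ?_ ?_ ?_ ?_ <;>
          first | omega | (rw [siteMove_apply]; split_ifs <;> omega)
    by_cases e1 : a₁ = L + 1
    · by_cases e2 : a₂ = a₁ + 1
      · by_cases e3 : b₁ = a₂ + 1
        · by_cases e4 : b₂ = b₁ + 1
          · refine ⟨C, .refl _ _, ?_⟩
            subst e1; subst e2; subst e3; subst e4
            exact ⟨m1, m2, t1, t2⟩
          · exact step (b₂ - 1) (by omega) (by omega) (by omega) (by omega) (by omega) (by omega)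
        · exact step (b₁ - 1) (by omega) (by omega) (by omega) (by omega) (by omega) (by omega)
      · exact step (a₂ - 1) (by omega) (by omega) (by omega) (by omega) (by omega) (by omega)
    · exact step (a₁ - 1) (by omega) (by omega) (by omega) (by omega) (by omega) (by omega)

/-- A site before the twisted arc slides over it into its inside, and a site inside slides over it
to beyond its right end. Clearing first the sites before the arc and then those inside makes the two
ends consecutive. -/
theorem exists_mobAt (hL : C.ClosedBelow L) {a b : ℕ} (h0 : L < a) (h1 : a < b)
    (m : C.mate a = b) (ht : C.twist a = 1) :
    ∃ C₁, SlidesAbove L C C₁ ∧ C₁.MobAt L := by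
  -- Moving a site from before the arc to its inside lowers `a - L` and raises `b - a` by one;
  -- moving one out of the inside lowers `b - a`. The factor `2` makes both moves decrease the
  -- total.
  induction hW : 2 * (a - L) + (b - a) using Nat.strong_induction_on generalizing C a b with
  | _ W ih =>
    have s1 : C.IsSite a := isSite_of_mate_ne (by omega)
    have s2 : C.IsSite b := by rw [← m]; exact isSite_mate s1
    by_cases e1 : a = L + 1
    · by_cases e2 : b = a + 1
      · subst e1; subst e2
        exact ⟨C, .refl _ _, m, ht⟩
      · obtain ⟨C₁, t, hS, rfl, hm, htw⟩ := exists_slide_twisted_left hL h0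
          ⟨by omega, by have := s2.2; omega⟩ (by omega) ht
        have q := htw a
        rw [if_neg (by
          rintro (e | e)
          · omega
          · have := C.mate_mate (a + 1)
            rw [← e] at this; omega), add_zero] at q
        obtain ⟨C₂, hS', hT⟩ := ih _ (by
            subst hW; rw [siteMove_apply, siteMove_apply]; split_ifs <;> omega)
          (hS.closedBelow hL) (a := siteMove (a + 1) (C.mate a) a)
          (b := siteMove (a + 1) (C.mate a) b)
          (by rw [siteMove_apply]; split_ifs <;> omega)
          (by rw [siteMove_apply, siteMove_apply]; split_ifs <;> omega)
          (by rw [hm, m]) (by rw [q, ht]) rfl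
        exact ⟨C₂, hS.trans hS', hT⟩
    · obtain ⟨x, rfl⟩ : ∃ x, a = x + 1 := ⟨a - 1, by omega⟩
      obtain ⟨C₁, t, hS, ht', hm, htw⟩ := exists_slide_twisted_right hL (x := x) (by omega)
        s1 (by omega) ht
      have q := htw (x + 1)
      rw [if_neg (by
          rintro (e | e)
          · omega
          · have := C.mate_mate x
            rw [← e] at this; omega), add_zero] at q
      obtain ⟨C₂, hS', hT⟩ := ih _ (by
          subst hW; rw [siteMove_apply, siteMove_apply]; split_ifs <;> omega)
        (hS.closedBelow hL) (a := siteMove x t (x + 1)) (b := siteMove x t b)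
        (by rw [siteMove_apply]; split_ifs <;> omega)
        (by rw [siteMove_apply, siteMove_apply]; split_ifs <;> omega)
        (by rw [hm, m]) (by rw [q, ht]) rfl
      exact ⟨C₂, hS.trans hS', hT⟩

/-- Without a crossing, every arc that starts under the arc of `L + 1` also ends there. As nothing
is twisted, the inner side of this arc and the boundary vertices beneath it are then closed under
adjacency, while the outer side of the arc is not among them; so the boundary is disconnected. -/
theorem hasCross_of_untwisted (hC : C.OneBoundary) (hL : C.ClosedBelow L) (hlt : L < 2 * C.rank)
    (ht : ∀ k, L < k → C.twist k = 0) : C.HasCross L := by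
  by_contra hx
  have hs : C.IsSite (L + 1) := ⟨by omega, by omega⟩
  have h1 := lt_mate_of_closedBelow hL (show L < L + 1 by omega)
  have h2 := mate_ne hs
  have h3 := C.mate_mate (L + 1)
  have hin : ∀ k, L + 1 < k → k < C.mate (L + 1) →
      L + 1 < C.mate k ∧ C.mate k < C.mate (L + 1) := by
    intro k hk hk'
    have a1 := lt_mate_of_closedBelow hL (show L < k by omega)
    have a2 : C.mate k ≠ L + 1 := fun e => by have := C.mate_mate k; rw [e] at this; omega
    have a3 : C.mate k ≠ C.mate (L + 1) := fun e => by have := mate_inj e; omega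
    refine ⟨by omega, ?_⟩
    by_contra h
    exact hx ⟨L + 1, k, C.mate (L + 1), C.mate k, by omega, hk, hk', by omega, rfl, rfl,
      ht _ (by omega), ht _ (by omega)⟩
  let ψ : ℕ × ℤˣ → Prop := fun x => (L + 1 < x.1 ∧ x.1 < C.mate (L + 1)) ∨
    (x.1 = L + 1 ∧ x.2 = 1) ∨ (x.1 = C.mate (L + 1) ∧ x.2 = -1)
  have hu : ∀ κ : ℤˣ, -κ = 1 ↔ κ = -1 := by decide
  have hu' : ∀ κ : ℤˣ, -κ = -1 ↔ κ = 1 := by decide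
  have hu1 : (1 : ℤˣ) ≠ -1 := by decide
  -- A set closed under adjacency is a map to the edgeless graph on `Prop`, where reachability is
  -- equality.
  have key := reachable_map (G := (⊥ : SimpleGraph Prop)) (C := C) ψ
    (fun k hk hk' => by
      rw [SimpleGraph.reachable_bot]
      apply propext
      simp only [ψ, hu1, hu1.symm, and_true, and_false, or_false, false_or]
      omega)
    (fun k κ hk => by
      rw [SimpleGraph.reachable_bot]
      apply propext
      by_cases hkL : k ≤ L
      · have := hL k hkL
        simp only [ψ]
        constructor <;> rintro (h | h | h) <;> omega
      · have hside : C.side k (-κ) = -κ := by simp [side, ht k (by omega)]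
        have b1 : C.mate k = L + 1 ↔ k = C.mate (L + 1) :=
          ⟨fun e => by rw [← e, C.mate_mate], fun e => by rw [e, C.mate_mate]⟩
        have b2 : C.mate k = C.mate (L + 1) ↔ k = L + 1 :=
          ⟨fun e => mate_inj e, fun e => by rw [e]⟩
        have b3 : (L + 1 < k ∧ k < C.mate (L + 1)) ↔
            (L + 1 < C.mate k ∧ C.mate k < C.mate (L + 1)) :=
          ⟨fun h => hin k h.1 h.2, fun h => by have := hin _ h.1 h.2; rwa [C.mate_mate] at this⟩
        simp only [ψ, hside, b1, b2, ← b3, hu, hu']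
        tauto) (hC (L + 1, 1) (L + 1, -1) hs hs)
  rw [SimpleGraph.reachable_bot] at key
  have k1 : ψ (L + 1, 1) := Or.inr (Or.inl ⟨rfl, rfl⟩)
  rw [key] at k1
  rcases k1 with h | h | h
  · simp at h
  · exact hu1.symm h.2
  · simp at h; omega

theorem hasCross_or_exists_mobAt (hC : C.OneBoundary) (hL : C.ClosedBelow L)
    (hlt : L < 2 * C.rank) : C.HasCross L ∨ ∃ C₁, SlidesAbove L C C₁ ∧ C₁.MobAt L := by
  by_cases h : ∀ k, L < k → C.twist k = 0
  · exact Or.inl (hasCross_of_untwisted hC hL hlt h)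
  · right
    push Not at h
    obtain ⟨k, hk, hk'⟩ := h
    have h1 : C.twist k = 1 := (by decide : ∀ x : ZMod 2, x ≠ 0 → x = 1) _ hk'
    have hs : C.IsSite k := by by_contra h; exact hk' (C.twist_outside k h)
    have hm := lt_mate_of_closedBelow hL hk
    rcases lt_or_gt_of_ne (mate_ne hs) with hl | hl
    · exact exists_mobAt hL hm hl (C.mate_mate k) (by rw [C.twist_mate, h1])
    · exact exists_mobAt hL hk hl rfl h1

theorem MobAt.closedBelow (h : C.MobAt L) (hL : C.ClosedBelow L) : C.ClosedBelow (L + 2) := by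
  intro k hk
  rcases (by omega : k ≤ L ∨ k = L + 1 ∨ k = L + 2) with e | rfl | rfl
  · have := hL k e; omega
  · have := h.1; omega
  · have e := C.mate_mate (L + 1); rw [h.1] at e; omega

theorem TorAt.closedBelow (h : C.TorAt L) (hL : C.ClosedBelow L) : C.ClosedBelow (L + 4) := by
  intro k hk
  rcases (by omega : k ≤ L ∨ k = L + 1 ∨ k = L + 2 ∨ k = L + 3 ∨ k = L + 4) with
    e | rfl | rfl | rfl | rfl
  · have := hL k e; omega
  · have := h.1; omega
  · have := h.2.1; omega
  · have e := C.mate_mate (L + 1); rw [h.1] at e; omega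
  · have e := C.mate_mate (L + 2); rw [h.2.1] at e; omega

theorem HasCross.mono {L' : ℕ} (h : C.HasCross L') (hL : L ≤ L') : C.HasCross L := by
  obtain ⟨a₁, a₂, b₁, b₂, h0, h⟩ := h
  exact ⟨a₁, a₂, b₁, b₂, by omega, h⟩

theorem HasCross.lt (h : C.HasCross L) : L + 4 ≤ 2 * C.rank := by
  obtain ⟨a₁, a₂, b₁, b₂, h0, h1, h2, h3, m1, m2, -⟩ := h
  have := (isSite_mate (isSite_of_mate_ne (show C.mate a₂ ≠ a₂ by omega))).2
  omega

/-- Three consecutive twisted arcs can be slid so that two untwisted arcs cross. -/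
theorem exists_hasCross_of_mobAt (hL : C.ClosedBelow L) (h1 : C.MobAt L) (h2 : C.MobAt (L + 2))
    (h3 : C.MobAt (L + 4)) : ∃ C₁, SlidesAbove L C C₁ ∧ C₁.HasCross L := by
  obtain ⟨m1, t1⟩ := h1
  obtain ⟨m2, t2⟩ := h2
  obtain ⟨m3, t3⟩ := h3
  have n1 : C.mate (L + 2) = L + 1 := by rw [← m1, C.mate_mate]
  have n2 : C.mate (L + 4) = L + 3 := by rw [← m2, C.mate_mate]
  simp only [add_assoc, Nat.reduceAdd] at m2 m3 t2 t3
  -- Sliding `L + 2` over the twisted arc `{L + 3, L + 4}` gives `{L + 1, L + 3}` with twist `1 + 1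
  -- = 0`, and `{L + 2, L + 4}`, still twisted.
  obtain ⟨C₁, t, hS, ht, hm, htw⟩ := exists_slide_twisted_right hL (x := L + 2) (by omega)
    (isSite_of_mate_ne (by simp only [add_assoc, Nat.reduceAdd]; omega))
    (by simp only [add_assoc, Nat.reduceAdd]; omega) (by simpa only [add_assoc, Nat.reduceAdd])
  obtain rfl : t = L + 3 := by simp only [add_assoc, Nat.reduceAdd] at ht; omega
  have hmv : ∀ k k' : ℕ, (k' = if k = 2 then 3 else if k = 3 then 2 else k) →
      siteMove (L + 2) (L + 3) (L + k) = L + k' := by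
    intro k k' e
    rw [siteMove_apply]
    split_ifs at e ⊢ <;> omega
  have p1 := hm (L + 1)
  have p2 := hm (L + 3)
  have p3 := hm (L + 5)
  have w1 := htw (L + 1)
  have w2 := htw (L + 3)
  have w3 := htw (L + 5)
  rw [m1, hmv 1 1 rfl, hmv 2 3 rfl] at p1
  rw [m2, hmv 3 2 rfl, hmv 4 4 rfl] at p2
  rw [m3, hmv 5 5 rfl, hmv 6 6 rfl] at p3
  rw [hmv 1 1 rfl, t1, if_pos (by rw [n1]; simp)] at w1
  rw [hmv 3 2 rfl, t2, if_neg (by rw [n1]; simp)] at w2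
  rw [hmv 5 5 rfl, t3, if_neg (by rw [n1]; simp)] at w3
  clear hm htw hmv
  have r2 : C₁.mate (L + 4) = L + 2 := by rw [← p2, C₁.mate_mate]
  -- Sliding `L + 4` over the twisted arc `{L + 5, L + 6}` turns `{L + 2, L + 4}` into `{L + 2, L +
  -- 5}` and removes its twist; it crosses `{L + 1, L + 3}`.
  obtain ⟨C₂, t, hS', ht, hm, htw⟩ := exists_slide_twisted_right (hS.closedBelow hL) (x := L + 4)
    (by omega) (isSite_of_mate_ne (by simp only [add_assoc, Nat.reduceAdd]; omega))
    (by simp only [add_assoc, Nat.reduceAdd]; omega)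
    (by simpa only [add_assoc, Nat.reduceAdd, add_zero] using w3)
  obtain rfl : t = L + 5 := by simp only [add_assoc, Nat.reduceAdd] at ht; omega
  have hmv : ∀ k k' : ℕ, (k' = if k = 4 then 5 else if k = 5 then 4 else k) →
      siteMove (L + 4) (L + 5) (L + k) = L + k' := by
    intro k k' e
    rw [siteMove_apply]
    split_ifs at e ⊢ <;> omega
  refine ⟨C₂, hS.trans hS', L + 1, L + 2, L + 3, L + 5, by omega, by omega, by omega, by omega,
    ?_, ?_, ?_, ?_⟩
  · have := hm (L + 1)
    rwa [p1, hmv 1 1 rfl, hmv 3 3 rfl] at this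
  · have := hm (L + 2)
    rwa [p2, hmv 2 2 rfl, hmv 4 5 rfl] at this
  · have := htw (L + 1)
    rw [w1, hmv 1 1 rfl, if_neg (by rw [r2]; simp)] at this
    rw [this]; decide
  · have := htw (L + 2)
    rw [w2, hmv 2 2 rfl, if_pos (by rw [r2]; simp)] at this
    rw [this]; decide

/-- A one-boundary datum can be slid to a sequence of `g` copies of `Tor` followed by at most two
copies of `Möb`. -/
theorem exists_normal (C : TCD) (hC : C.OneBoundary) : ∃ C₁ g t,
    Relation.ReflTransGen Slides C C₁ ∧ t ≤ 2 ∧ C₁.rank = 2 * g + t ∧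
      (∀ r < g, C₁.TorAt (4 * r)) ∧ ∀ r < t, C₁.MobAt (4 * g + 2 * r) := by
  -- Here `g` copies of `Tor` have been split off and `n` is the rank that is left. Each crossing
  -- lowers `n` by two.
  suffices H : ∀ n g (C : TCD), C.rank = 2 * g + n → C.OneBoundary → C.ClosedBelow (4 * g) →
      (∀ r < g, C.TorAt (4 * r)) → ∃ C₁ g t,
      Relation.ReflTransGen Slides C C₁ ∧ t ≤ 2 ∧ C₁.rank = 2 * g + t ∧
      (∀ r < g, C₁.TorAt (4 * r)) ∧ ∀ r < t, C₁.MobAt (4 * g + 2 * r) by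
    refine H C.rank 0 C (by simp) hC ?_ (by simp)
    intro k hk
    rw [mate_of_not (by rintro ⟨h, -⟩; omega)]; exact hk
  clear hC C
  intro n
  induction n using Nat.strong_induction_on with
  | _ n ih =>
  intro g C hr hC hL hT
  have cross : ∀ C₁, SlidesAbove (4 * g) C C₁ → C₁.HasCross (4 * g) → ∃ C₁ g t,
      Relation.ReflTransGen Slides C C₁ ∧ t ≤ 2 ∧ C₁.rank = 2 * g + t ∧
      (∀ r < g, C₁.TorAt (4 * r)) ∧ ∀ r < t, C₁.MobAt (4 * g + 2 * r) := by
    intro C₁ hS hX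
    have hlt := hX.lt
    obtain ⟨C₂, hS', hT'⟩ := exists_torAt (hS.closedBelow hL) hX
    have hS2 := hS.trans hS'
    have := hS2.rank_eq
    have := hS.rank_eq
    obtain ⟨C₃, g', t, h1, h2⟩ := ih (n - 2) (by omega) (g + 1) C₂ (by omega)
      (hS2.oneBoundary hC) (hT'.closedBelow (hS2.closedBelow hL)) (fun r hr => by
        rcases Nat.lt_succ_iff_lt_or_eq.1 hr with h | rfl
        · exact hS2.torAt (by omega) (hT r h)
        · exact hT')
    exact ⟨C₃, g', t, hS2.slides.trans h1, h2⟩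
  have done : ∀ C₁, SlidesAbove (4 * g) C C₁ → ∀ t, t ≤ 2 → n = t →
      (∀ r < t, C₁.MobAt (4 * g + 2 * r)) → ∃ C₁ g t,
      Relation.ReflTransGen Slides C C₁ ∧ t ≤ 2 ∧ C₁.rank = 2 * g + t ∧
      (∀ r < g, C₁.TorAt (4 * r)) ∧ ∀ r < t, C₁.MobAt (4 * g + 2 * r) := by
    rintro C₁ hS t ht rfl hM
    exact ⟨C₁, g, n, hS.slides, ht, by rw [hS.rank_eq, hr],
      fun r hr => hS.torAt (by omega) (hT r hr), hM⟩
  by_cases n0 : n = 0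
  · exact done C (.refl _ _) 0 (by omega) n0 (by simp)
  rcases hasCross_or_exists_mobAt hC hL (by omega) with hX | ⟨C₁, S1, M1⟩
  · exact cross C (.refl _ _) hX
  by_cases n1 : n = 1
  · refine done C₁ S1 1 (by omega) n1 ?_
    intro r hr
    obtain rfl : r = 0 := by omega
    exact M1
  have r1 := S1.rank_eq
  have L1 := M1.closedBelow (S1.closedBelow hL)
  rcases hasCross_or_exists_mobAt (S1.oneBoundary hC) L1 (by omega) with hX | ⟨C₂, S2, M2⟩
  -- A crossing above the split-off twisted arc is also a crossing above `4 * g`. The twisted arc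
  -- need not survive the slides that follow, because the induction makes no assumption on what lies
  -- above the copies of `Tor`.
  · exact cross C₁ S1 (hX.mono (by omega))
  have S2' := S1.trans (S2.mono (by omega))
  have r2 := S2'.rank_eq
  have M1' := S2.mobAt le_rfl M1
  by_cases n2 : n = 2
  · refine done C₂ S2' 2 (by omega) n2 ?_
    intro r hr
    interval_cases r
    · exact M1'
    · exact M2
  have L2 := M2.closedBelow (S2.closedBelow L1)
  rcases hasCross_or_exists_mobAt (S2'.oneBoundary hC) L2 (by omega) with hX | ⟨C₃, S3, M3⟩
  · exact cross C₂ S2' (hX.mono (by omega))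
  have S3' := S2'.trans (S3.mono (by omega))
  -- Three twisted arcs in a row produce a crossing, so the process can stop only with at most two
  -- of them.
  obtain ⟨C₄, S4, hX⟩ := exists_hasCross_of_mobAt (S3'.closedBelow hL) (S3.mobAt (by omega) M1')
    (S3.mobAt le_rfl M2) M3
  exact cross C₄ (S3'.trans S4) hX

end TCD

/-! ### The vertex order, the band involution, and pairings -/

namespace Frame

variable {F F' : Frame}

theorem mem_verts {v : ℕ × ℕ} : v ∈ F.verts ↔ 1 ≤ v.2 ∧ v.2 ≤ F.mult v.1 := Iff.rfl

theorem le_of_mem_verts {v : ℕ × ℕ} (h : v ∈ F.verts) : v.1 ≤ 2 * F.rank + 1 := by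
  by_contra h'
  have := F.mult_outside v.1 (by omega)
  obtain ⟨h1, h2⟩ := h
  omega

theorem prec_irrefl (v : ℕ × ℕ) : ¬ F.prec v v := by
  unfold prec; omega

theorem prec_trans {u v w : ℕ × ℕ} (h : F.prec u v) (h' : F.prec v w) : F.prec u w := by
  unfold prec at *; omega

theorem prec_asymm {u v : ℕ × ℕ} (h : F.prec u v) : ¬ F.prec v u := fun h' =>
  prec_irrefl _ (prec_trans h h')

theorem prec_trichotomy {u v : ℕ × ℕ} (hu : u ∈ F.verts) (hv : v ∈ F.verts) :
    F.prec u v ∨ u = v ∨ F.prec v u := by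
  have h1 := le_of_mem_verts hu
  have h2 := le_of_mem_verts hv
  unfold prec
  rw [Prod.ext_iff]
  omega

theorem iota_mem {v : ℕ × ℕ} (h : v ∈ F.intVerts) : F.iota v ∈ F.intVerts := by
  obtain ⟨⟨h1, h2⟩, h3⟩ := h
  refine ⟨?_, TCD.isSite_mate h3⟩
  rw [mem_verts]
  simp only [iota, F.mult_mate]
  split_ifs <;> omega

theorem iota_iota {v : ℕ × ℕ} (h : v ∈ F.verts) : F.iota (F.iota v) = v := by
  obtain ⟨h1, h2⟩ := h
  simp only [iota, F.mult_mate, F.mate_mate, F.twist_mate]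
  ext
  · rfl
  · dsimp only
    split_ifs <;> omega

theorem iota_ne {v : ℕ × ℕ} (h : v ∈ F.intVerts) : F.iota v ≠ v := fun e =>
  TCD.mate_ne h.2 (congrArg Prod.fst e)

end Frame

namespace SWB

variable {Θ : SWB}

theorem pair_mem {v : ℕ × ℕ} (h : v ∈ Θ.verts) : Θ.pair v ∈ Θ.verts := by
  by_contra h'
  have h1 := (Θ.pair_eq_self_iff _).2 h'
  rw [Θ.pair_pair] at h1
  exact (Θ.pair_eq_self_iff _).1 h1.symm h

theorem pair_ne {v : ℕ × ℕ} (h : v ∈ Θ.verts) : Θ.pair v ≠ v := fun e =>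
  (Θ.pair_eq_self_iff v).1 e h

theorem pair_inj {u v : ℕ × ℕ} (h : Θ.pair u = Θ.pair v) : u = v := by
  rw [← Θ.pair_pair u, h, Θ.pair_pair]

theorem curveGraph_adj {u v : ℕ × ℕ} : Θ.curveGraph.Adj u v ↔
    (u ∈ Θ.verts ∧ Θ.pair u = v) ∨ (u ∈ Θ.intVerts ∧ Θ.iota u = v) := by
  rw [curveGraph, SimpleGraph.fromRel_adj]
  constructor
  · rintro ⟨-, h | ⟨h, rfl⟩ | ⟨h, rfl⟩⟩
    · exact h
    · exact Or.inl ⟨pair_mem h, Θ.pair_pair _⟩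
    · exact Or.inr ⟨Frame.iota_mem h, Frame.iota_iota h.1⟩
  · intro h
    refine ⟨?_, Or.inl h⟩
    rcases h with ⟨h, rfl⟩ | ⟨h, rfl⟩
    · exact (pair_ne h).symm
    · exact (Frame.iota_ne h).symm

theorem mem_verts_of_adj {u v : ℕ × ℕ} (h : Θ.curveGraph.Adj u v) : u ∈ Θ.verts := by
  rcases curveGraph_adj.1 h with h | h
  · exact h.1
  · exact h.1.1

/-- A pairing given by a relation. -/
theorem exists_of_rel (F : Frame) (R : ℕ × ℕ → ℕ × ℕ → Prop)
    (hR : ∀ u ∈ F.verts, ∃ v ∈ F.verts, R u v) (hs : ∀ u v, R u v → R v u)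
    (hf : ∀ u v w, R u v → R u w → v = w) (hi : ∀ u, ¬ R u u)
    (hc : ∀ u ∈ F.verts, ∀ u' ∈ F.verts, ∀ v ∈ F.verts, ∀ v' ∈ F.verts, R u u' → R v v' →
      ¬ (F.prec u v ∧ F.prec v u' ∧ F.prec u' v')) :
    ∃ Θ : SWB, Θ.toFrame = F ∧ ∀ u ∈ F.verts, ∀ v, R u v → Θ.pair u = v := by
  classical
  choose! p hp hp' using hR
  have hpp : ∀ v ∈ F.verts, p (p v) = v := fun v hv =>
    hf _ _ _ (hp' _ (hp v hv)) (hs _ _ (hp' v hv))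
  refine ⟨
    { toFrame := F
      pair := fun v => if v ∈ F.verts then p v else v
      pair_pair := ?_
      pair_eq_self_iff := ?_
      crossingless := ?_ }, rfl, ?_⟩
  · intro v
    by_cases hv : v ∈ F.verts
    · simp [hv, hp v hv, hpp v hv]
    · simp [hv]
  · intro v
    by_cases hv : v ∈ F.verts
    · simp only [hv, if_true, not_true, iff_false]
      intro e
      have := hp' v hv
      rw [e] at this
      exact hi _ this
    · simp [hv]
  · intro u hu v hv
    simp only [hu, hv, if_true]
    exact hc u hu _ (hp u hu) v hv _ (hp v hv) (hp' u hu) (hp' v hv)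
  · intro u hu v h
    simp only [hu, if_true]
    exact hf _ _ _ (hp' u hu) h

/-- A square with bands datum can be restricted along an order preserving map of vertex sets whose
image is closed under the pairing. -/
theorem exists_transport (Θ : SWB) (F : Frame) (o : ℕ × ℕ → ℕ × ℕ)
    (hmem : ∀ v ∈ F.verts, o v ∈ Θ.verts)
    (hprec : ∀ u ∈ F.verts, ∀ v ∈ F.verts, F.prec u v → Θ.prec (o u) (o v))
    (hcl : ∀ v ∈ F.verts, ∃ w ∈ F.verts, o w = Θ.pair (o v)) :
    ∃ Θ' : SWB, Θ'.toFrame = F ∧ ∀ v ∈ F.verts, o (Θ'.pair v) = Θ.pair (o v) := by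
  have hinj : ∀ u ∈ F.verts, ∀ v ∈ F.verts, o u = o v → u = v := by
    intro u hu v hv e
    rcases Frame.prec_trichotomy hu hv with h | h | h
    · exact absurd (e ▸ hprec u hu v hv h) (Frame.prec_irrefl _)
    · exact h
    · exact absurd (e ▸ hprec v hv u hu h) (Frame.prec_irrefl _)
  obtain ⟨Θ', rfl, hΘ'⟩ := exists_of_rel F
    (fun u v => u ∈ F.verts ∧ v ∈ F.verts ∧ o v = Θ.pair (o u))
    (fun u hu => by obtain ⟨w, hw, e⟩ := hcl u hu; exact ⟨w, hw, hu, hw, e⟩)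
    (fun u v ⟨hu, hv, e⟩ => ⟨hv, hu, by rw [e, Θ.pair_pair]⟩)
    (fun u v w ⟨_, hv, e⟩ ⟨_, hw, e'⟩ => hinj _ hv _ hw (e.trans e'.symm))
    (fun u ⟨hu, _, e⟩ => pair_ne (hmem u hu) e.symm)
    (fun u hu u' hu' v hv v' hv' ⟨_, _, e⟩ ⟨_, _, e'⟩ ⟨h1, h2, h3⟩ =>
      Θ.crossingless _ (hmem u hu) _ (hmem v hv) (by
        rw [← e, ← e']
        exact ⟨hprec _ hu _ hv h1, hprec _ hv _ hu' h2, hprec _ hu' _ hv' h3⟩))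
  refine ⟨Θ', rfl, fun v hv => ?_⟩
  obtain ⟨w, hw, e⟩ := hcl v hv
  rw [hΘ' v hv w ⟨hv, hw, e⟩, e]

end SWB

/-! ### Contraction of graphs -/

namespace SimpleGraph

variable {α : Type*} {G : SimpleGraph α} {U : Set α} {u v : α}

theorem contract_adj_of_walk (huv : u ≠ v) (hu : u ∉ U) (hv : v ∉ U) (p : G.Walk u v)
    (hp : ∀ x ∈ p.support, x = u ∨ x = v ∨ x ∈ U) : (G.contract U).Adj u v := by
  classical
  rw [contract, fromRel_adj]
  exact ⟨huv, Or.inl ⟨hu, hv, p.bypass, p.bypass_isPath,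
    fun x hx => hp x (p.support_bypass_subset_support hx)⟩⟩

theorem contract_adj_of_adj (hu : u ∉ U) (hv : v ∉ U) (h : G.Adj u v) :
    (G.contract U).Adj u v :=
  contract_adj_of_walk h.ne hu hv (.cons h .nil) (by simp)

theorem exists_adj_of_walk {β : Type*} (c : α → β)
    (hc : ∀ a ∈ U, ∀ b ∈ U, G.Adj a b → c a = c b) (hv : v ∉ U) {a : α} (p : G.Walk a v)
    (ha : a ∈ U) (hp : ∀ x ∈ p.support, x = v ∨ x ∈ U) : ∃ b ∈ U, G.Adj b v ∧ c a = c b := by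
  induction p with
  | nil => exact absurd ha hv
  | @cons a b v h p ih =>
    rcases hp b (by simp) with rfl | hb
    · exact ⟨a, ha, h, rfl⟩
    · obtain ⟨b', h1, h2, h3⟩ := ih hv hb fun x hx => hp x (by simp [hx])
      exact ⟨b', h1, h2, (hc a ha b hb h).trans h3⟩

/-- A path through `U` enters at some `a` and leaves at some `b`, and a label `c` that is constant
along the edges inside `U` agrees at both. A constant label suffices for pull-throughs; the identity
is used for juxtapositions, where no two glued vertices are adjacent. -/
theorem of_contract_adj {β : Type*} (c : α → β) (hc : ∀ a ∈ U, ∀ b ∈ U, G.Adj a b → c a = c b)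
    (h : (G.contract U).Adj u v) : u ≠ v ∧ u ∉ U ∧ v ∉ U ∧
      (G.Adj u v ∨ ∃ a ∈ U, ∃ b ∈ U, G.Adj u a ∧ G.Adj b v ∧ c a = c b) := by
  have key : ∀ u v : α, u ≠ v → (u ∉ U ∧ v ∉ U ∧
      ∃ p : G.Walk u v, p.IsPath ∧ ∀ x ∈ p.support, x = u ∨ x = v ∨ x ∈ U) →
      G.Adj u v ∨ ∃ a ∈ U, ∃ b ∈ U, G.Adj u a ∧ G.Adj b v ∧ c a = c b := by
    rintro u v huv ⟨hu, hv, p, hp, hs⟩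
    cases p with
    | nil => exact absurd rfl huv
    | @cons _ a _ h p =>
      rw [Walk.cons_isPath_iff] at hp
      have hs' : ∀ x ∈ p.support, x = v ∨ x ∈ U := by
        intro x hx
        rcases hs x (by simp [hx]) with rfl | h
        · exact absurd hx hp.2
        · exact h
      rcases hs' a (by simp) with rfl | ha
      · exact Or.inl h
      · obtain ⟨b, h1, h2, h3⟩ := exists_adj_of_walk c hc hv p ha hs'
        exact Or.inr ⟨a, ha, b, h1, h, h2, h3⟩
  rw [contract, fromRel_adj] at h
  obtain ⟨huv, h | h⟩ := h
  · exact ⟨huv, h.1, h.2.1, key u v huv h⟩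
  · refine ⟨huv, h.2.1, h.1, ?_⟩
    rcases key v u huv.symm h with h' | ⟨a, ha, b, hb, h1, h2, h3⟩
    · exact Or.inl h'.symm
    · exact Or.inr ⟨b, hb, a, ha, h2.symm, h1.symm, h3.symm⟩

end SimpleGraph

/-! ### Insertion of new vertices into a crossingless pairing -/

namespace Frame

variable {F : Frame}

/-- `v` lies strictly between `u` and `w`. -/
def Btw (F : Frame) (u v w : ℕ × ℕ) : Prop :=
  (F.prec u v ∧ F.prec v w) ∨ (F.prec w v ∧ F.prec v u)

/-- The order of the vertices is that of an injective numbering. -/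
theorem exists_pos (F : Frame) : ∃ pos : ℕ × ℕ → ℕ,
    (∀ u ∈ F.verts, ∀ v ∈ F.verts, F.prec u v ↔ pos u < pos v) ∧
      ∀ u ∈ F.verts, ∀ v ∈ F.verts, pos u = pos v → u = v := by
  obtain ⟨M, hM⟩ : ∃ M, ∀ v ∈ F.verts, v.2 ≤ M := by
    refine ⟨∑ k ∈ Finset.range (2 * F.rank + 2), F.mult k, fun v hv => ?_⟩
    have := le_of_mem_verts hv
    exact hv.2.trans (Finset.single_le_sum (f := F.mult) (fun _ _ => Nat.zero_le _)
      (Finset.mem_range.2 (by omega)))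
  -- The numbering is lexicographic with second coordinates bounded by `M`, reversed on the topmost
  -- coordinate `2 * F.rank + 1`. It reduces all comparisons of vertices to linear arithmetic.
  have key : ∀ u ∈ F.verts, ∀ v ∈ F.verts, F.prec u v →
      u.1 * (M + 1) + (if u.1 ≤ 2 * F.rank then u.2 else M - u.2) <
      v.1 * (M + 1) + (if v.1 ≤ 2 * F.rank then v.2 else M - v.2) := by
    intro u hu v hv h
    have h1 := hM u hu
    have h2 := hM v hv
    have h3 := hu.1
    have h4 := hv.1
    have h5 := le_of_mem_verts hu
    have h6 := le_of_mem_verts hv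
    rcases h with h | h | h
    · have := Nat.mul_le_mul_right (M + 1) (show u.1 + 1 ≤ v.1 from h)
      rw [Nat.add_mul] at this
      split_ifs <;> omega
    · rw [h.1, if_pos (by omega), if_pos (by omega)]; omega
    · rw [h.1, if_neg (by omega), if_neg (by omega)]; omega
  refine ⟨_, fun u hu v hv => ⟨key u hu v hv, fun h => ?_⟩, fun u hu v hv h => ?_⟩
  · rcases prec_trichotomy hu hv with h' | rfl | h'
    · exact h'
    · exact absurd h (lt_irrefl _)
    · exact absurd (key v hv u hu h') (by omega)
  · rcases prec_trichotomy hu hv with h' | rfl | h'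
    · exact absurd (key u hu v hv h') (by omega)
    · rfl
    · exact absurd (key v hv u hu h') (by omega)

end Frame

namespace SWB

/-- Insertion of the neighbours `n₁`, `n₂` into the edge between `x` and its partner, and of a new
edge between the neighbours `z₁`, `z₂`. -/
theorem exists_insert (Θ : SWB) (F : Frame) (ι : ℕ × ℕ → ℕ × ℕ) (n₁ n₂ z₁ z₂ x : ℕ × ℕ)
    (hι : ∀ v ∈ Θ.verts, ι v ∈ F.verts)
    (hmono : ∀ u ∈ Θ.verts, ∀ v ∈ Θ.verts, Θ.prec u v → F.prec (ι u) (ι v))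
    (hcov : ∀ v ∈ F.verts, v = n₁ ∨ v = n₂ ∨ v = z₁ ∨ v = z₂ ∨ ∃ w ∈ Θ.verts, ι w = v)
    (hnew : ∀ w ∈ Θ.verts, ι w ≠ n₁ ∧ ι w ≠ n₂ ∧ ι w ≠ z₁ ∧ ι w ≠ z₂)
    (hn₁ : n₁ ∈ F.verts) (hn₂ : n₂ ∈ F.verts) (hz₁ : z₁ ∈ F.verts) (hz₂ : z₂ ∈ F.verts)
    (hnn : n₁ ≠ n₂) (hzz : z₁ ≠ z₂) (h11 : n₁ ≠ z₁) (h12 : n₁ ≠ z₂) (h21 : n₂ ≠ z₁) (h22 : n₂ ≠ z₂)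
    (hn : ∀ w ∈ F.verts, ¬ F.Btw n₁ w n₂) (hz : ∀ w ∈ F.verts, ¬ F.Btw z₁ w z₂)
    (hx : x ∈ Θ.verts) (hn₂x : ¬ F.Btw n₁ n₂ (ι x))
    (hzone : ∀ w ∈ Θ.verts, F.Btw n₁ (ι w) (ι x) → F.Btw n₁ (ι (Θ.pair w)) (ι x)) :
    ∃ Θ' : SWB, Θ'.toFrame = F ∧
      (∀ w ∈ Θ.verts, w ≠ x → w ≠ Θ.pair x → Θ'.pair (ι w) = ι (Θ.pair w)) ∧
      Θ'.pair n₁ = ι x ∧ Θ'.pair n₂ = ι (Θ.pair x) ∧ Θ'.pair z₁ = z₂ := by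
  have hy := pair_mem hx
  have hyx := pair_ne hx
  have hinj : ∀ u ∈ Θ.verts, ∀ v ∈ Θ.verts, ι u = ι v → u = v := by
    intro u hu v hv e
    rcases Frame.prec_trichotomy hu hv with h | h | h
    · exact absurd (e ▸ hmono u hu v hv h) (Frame.prec_irrefl _)
    · exact h
    · exact absurd (e ▸ hmono v hv u hu h) (Frame.prec_irrefl _)
  have hpy := Θ.pair_pair x
  generalize hye : Θ.pair x = y at *
  -- The new pairing: the edge from `x` to `y` is cut open into `x - n₁` and `n₂ - y`, the edge `z₁
  -- - z₂` is added, and all other edges are kept.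
  let R : ℕ × ℕ → ℕ × ℕ → Prop := fun u v =>
    (u = n₁ ∧ v = ι x) ∨ (u = ι x ∧ v = n₁) ∨ (u = n₂ ∧ v = ι y) ∨ (u = ι y ∧ v = n₂) ∨
    (u = z₁ ∧ v = z₂) ∨ (u = z₂ ∧ v = z₁) ∨
    ∃ a ∈ Θ.verts, a ≠ x ∧ a ≠ y ∧ u = ι a ∧ v = ι (Θ.pair a)
  have hold : ∀ a ∈ Θ.verts, a ≠ x → a ≠ y →
      Θ.pair a ∈ Θ.verts ∧ Θ.pair a ≠ x ∧ Θ.pair a ≠ y := fun a ha h1 h2 =>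
    ⟨pair_mem ha, fun e => h2 (by rw [← hye, ← e, Θ.pair_pair]),
      fun e => h1 (by rw [← hpy, ← e, Θ.pair_pair])⟩
  have hRs : ∀ u v, R u v → R v u := by
    rintro u v (h | h | h | h | h | h | ⟨a, ha, h1, h2, rfl, rfl⟩)
    · exact Or.inr (Or.inl h.symm)
    · exact Or.inl h.symm
    · exact Or.inr (Or.inr (Or.inr (Or.inl h.symm)))
    · exact Or.inr (Or.inr (Or.inl h.symm))
    · exact Or.inr (Or.inr (Or.inr (Or.inr (Or.inr (Or.inl h.symm)))))
    · exact Or.inr (Or.inr (Or.inr (Or.inr (Or.inl h.symm))))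
    · obtain ⟨h3, h4, h5⟩ := hold a ha h1 h2
      exact Or.inr (Or.inr (Or.inr (Or.inr (Or.inr (Or.inr
        ⟨_, h3, h4, h5, rfl, by rw [Θ.pair_pair]⟩)))))
  have hRold : ∀ a ∈ Θ.verts, a ≠ x → a ≠ y → R (ι a) (ι (Θ.pair a)) := fun a ha h1 h2 =>
    Or.inr (Or.inr (Or.inr (Or.inr (Or.inr (Or.inr ⟨a, ha, h1, h2, rfl, rfl⟩)))))
  have hRf : ∀ u v w, R u v → R u w → v = w := by
    obtain ⟨x1, x2, x3, x4⟩ := hnew x hx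
    obtain ⟨y1, y2, y3, y4⟩ := hnew y hy
    have hxy' : ι x ≠ ι y := fun e => hyx (hinj _ hx _ hy e).symm
    have hax : ∀ a ∈ Θ.verts, a ≠ x → ι a ≠ ι x := fun a ha h e => h (hinj _ ha _ hx e)
    have hay : ∀ a ∈ Θ.verts, a ≠ y → ι a ≠ ι y := fun a ha h e => h (hinj _ ha _ hy e)
    intro u v w h h'
    rcases h with ⟨e1, rfl⟩ | ⟨e1, rfl⟩ | ⟨e1, rfl⟩ | ⟨e1, rfl⟩ | ⟨e1, rfl⟩ | ⟨e1, rfl⟩ |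
      ⟨a, ha, h1, h2, e1, rfl⟩
    case' inr.inr.inr.inr.inr.inr =>
      obtain ⟨a1, a2, a3, a4⟩ := hnew a ha
      have a5 := hax a ha h1
      have a6 := hay a ha h2
    all_goals
      rcases h' with ⟨e, rfl⟩ | ⟨e, rfl⟩ | ⟨e, rfl⟩ | ⟨e, rfl⟩ | ⟨e, rfl⟩ | ⟨e, rfl⟩ |
        ⟨b, hb, h3, h4, e, rfl⟩
      case' inr.inr.inr.inr.inr.inr =>
        obtain ⟨b1, b2, b3, b4⟩ := hnew b hb
        have b5 := hax b hb h3
        have b6 := hay b hb h4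
      all_goals
        have e := e1.symm.trans e
        first
        | rfl
        | exact absurd e (by assumption)
        | exact absurd e.symm (by assumption)
        | (rw [hinj _ ha _ hb e])
  have hRi : ∀ u, ¬ R u u := by
    have hx' := hnew x hx
    have hy' := hnew y hy
    rintro u (⟨rfl, h⟩ | ⟨h, rfl⟩ | ⟨rfl, h⟩ | ⟨h, rfl⟩ | ⟨rfl, h⟩ | ⟨rfl, h⟩ | ⟨a, ha, h1, h2, rfl, h⟩)
    · exact hx'.1 h.symm
    · exact hx'.1 h.symm
    · exact hy'.2.1 h.symm
    · exact hy'.2.1 h.symm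
    · exact hzz h
    · exact hzz h.symm
    · exact pair_ne ha (hinj _ ha _ (hold a ha h1 h2).1 h).symm
  have hRt : ∀ u ∈ F.verts, ∃ v ∈ F.verts, R u v := by
    intro u hu
    rcases hcov u hu with rfl | rfl | rfl | rfl | ⟨w, hw, rfl⟩
    · exact ⟨_, hι x hx, Or.inl ⟨rfl, rfl⟩⟩
    · exact ⟨_, hι y hy, Or.inr (Or.inr (Or.inl ⟨rfl, rfl⟩))⟩
    · exact ⟨_, hz₂, Or.inr (Or.inr (Or.inr (Or.inr (Or.inl ⟨rfl, rfl⟩))))⟩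
    · exact ⟨_, hz₁, Or.inr (Or.inr (Or.inr (Or.inr (Or.inr (Or.inl ⟨rfl, rfl⟩)))))⟩
    · by_cases h1 : w = x
      · subst h1; exact ⟨_, hn₁, Or.inr (Or.inl ⟨rfl, rfl⟩)⟩
      by_cases h2 : w = y
      · subst h2; exact ⟨_, hn₂, Or.inr (Or.inr (Or.inr (Or.inl ⟨rfl, rfl⟩)))⟩
      exact ⟨_, hι _ (hold w hw h1 h2).1, hRold w hw h1 h2⟩
  obtain ⟨pos, hpos, hpinj⟩ := F.exists_pos
  have hb : ∀ u ∈ F.verts, ∀ v ∈ F.verts, ∀ w ∈ F.verts, F.Btw u v w ↔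
      (pos u < pos v ∧ pos v < pos w) ∨ (pos w < pos v ∧ pos v < pos u) := by
    intro u hu v hv w hw
    rw [Frame.Btw, hpos u hu v hv, hpos v hv w hw, hpos w hw v hv, hpos v hv u hu]
  have hx' := hι x hx
  have hy' := hι y hy
  have hyz : ¬ F.Btw n₁ (ι y) (ι x) := by
    intro h
    have := hzone y hy h
    rw [hpy, hb _ hn₁ _ hx' _ hx'] at this
    omega
  -- The zone strictly between `n₁` and `ι x` is closed under the new pairing: by hypothesis for old
  -- edges, and for `z₁ - z₂` because nothing, in particular neither `n₁` nor `ι x`, lies between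
  -- these two.
  have hR1 : ∀ v ∈ F.verts, ∀ v' ∈ F.verts, R v v' → F.Btw n₁ v (ι x) → F.Btw n₁ v' (ι x) := by
    have hzz' : F.Btw n₁ z₁ (ι x) ↔ F.Btw n₁ z₂ (ι x) := by
      have e1 := hz _ hn₁
      have e2 := hz _ hx'
      have f1 := mt (hpinj _ hn₁ _ hz₁) h11
      have f2 := mt (hpinj _ hn₁ _ hz₂) h12
      have f3 := mt (hpinj _ hx' _ hz₁) (hnew x hx).2.2.1
      have f4 := mt (hpinj _ hx' _ hz₂) (hnew x hx).2.2.2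
      rw [hb _ hz₁ _ hn₁ _ hz₂] at e1
      rw [hb _ hz₁ _ hx' _ hz₂] at e2
      rw [hb _ hn₁ _ hz₁ _ hx', hb _ hn₁ _ hz₂ _ hx']
      omega
    rintro v hv v' hv' (⟨rfl, rfl⟩ | ⟨rfl, rfl⟩ | ⟨rfl, rfl⟩ | ⟨rfl, rfl⟩ | ⟨rfl, rfl⟩ |
      ⟨rfl, rfl⟩ | ⟨a, ha, h1, h2, rfl, rfl⟩) h
    · rw [hb _ hv _ hv _ hx'] at h; omega
    · rw [hb _ hv' _ hv _ hv] at h; omega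
    · exact absurd h hn₂x
    · exact absurd h hyz
    · exact hzz'.1 h
    · exact hzz'.2 h
    · exact hzone a ha h
  -- An edge `c - d` is crossed by no other edge once the zone between `c` and `d` is closed under
  -- the pairing. This disposes of `n₁ - x` and, with an empty zone, of `z₁ - z₂`.
  have hnest : ∀ c ∈ F.verts, ∀ d ∈ F.verts, (R c d) →
      (∀ v ∈ F.verts, ∀ v' ∈ F.verts, R v v' → F.Btw c v d → F.Btw c v' d) →
      ∀ u ∈ F.verts, ∀ u' ∈ F.verts, ∀ v ∈ F.verts, ∀ v' ∈ F.verts, R u u' → R v v' →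
      (u = c ∨ u = d ∨ v = c ∨ v = d) →
      ¬ (F.prec u v ∧ F.prec v u' ∧ F.prec u' v') := by
    rintro c hc d hd hcd hcl u hu u' hu' v hv v' hv' hRu hRv h ⟨g1, g2, g3⟩
    rw [hpos _ hu _ hv] at g1
    rw [hpos _ hv _ hu'] at g2
    rw [hpos _ hu' _ hv'] at g3
    have k1 := hcl v hv v' hv' hRv
    have k2 := hcl u' hu' u hu (hRs _ _ hRu)
    rw [hb _ hc _ hv _ hd, hb _ hc _ hv' _ hd] at k1
    rw [hb _ hc _ hu' _ hd, hb _ hc _ hu _ hd] at k2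
    rcases h with rfl | rfl | rfl | rfl
    · obtain rfl := hRf _ _ _ hRu hcd
      omega
    · obtain rfl := hRf _ _ _ hRu (hRs _ _ hcd)
      omega
    · obtain rfl := hRf _ _ _ hRv hcd
      omega
    · obtain rfl := hRf _ _ _ hRv (hRs _ _ hcd)
      omega
  have hn₁R : R n₁ (ι x) := Or.inl ⟨rfl, rfl⟩
  have hn₂R : R n₂ (ι y) := Or.inr (Or.inr (Or.inl ⟨rfl, rfl⟩))
  have hzR : R z₁ z₂ := Or.inr (Or.inr (Or.inr (Or.inr (Or.inl ⟨rfl, rfl⟩))))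
  -- For the remaining edges `n₂` takes over the role of `x`, so that `n₂ - y` stands for the old
  -- edge `x - y`.
  let Q : ℕ × ℕ → ℕ × ℕ → Prop := fun u a =>
    (u = n₂ ∧ a = x) ∨ (a ∈ Θ.verts ∧ a ≠ x ∧ u = ι a)
  have hQ : ∀ u ∈ F.verts, ∀ u' ∈ F.verts, R u u' →
      (u = n₁ ∨ u = ι x ∨ u = z₁ ∨ u = z₂) ∨ ∃ a ∈ Θ.verts, Q u a ∧ Q u' (Θ.pair a) := by
    rintro u hu u' hu' (⟨rfl, rfl⟩ | ⟨rfl, rfl⟩ | ⟨rfl, rfl⟩ | ⟨rfl, rfl⟩ | ⟨rfl, rfl⟩ |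
      ⟨rfl, rfl⟩ | ⟨a, ha, h1, h2, rfl, rfl⟩)
    · simp
    · simp
    · exact Or.inr ⟨x, hx, Or.inl ⟨rfl, rfl⟩, Or.inr (by rw [hye]; exact ⟨hy, hyx, rfl⟩)⟩
    · exact Or.inr ⟨y, hy, Or.inr ⟨hy, hyx, rfl⟩, Or.inl ⟨rfl, hpy⟩⟩
    · simp
    · simp
    · obtain ⟨h3, h4, h5⟩ := hold a ha h1 h2
      exact Or.inr ⟨a, ha, Or.inr ⟨ha, h1, rfl⟩, Or.inr ⟨h3, h4, rfl⟩⟩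
  have hrefl : ∀ a ∈ Θ.verts, ∀ b ∈ Θ.verts, F.prec (ι a) (ι b) → Θ.prec a b := by
    intro a ha b hb h
    rcases Frame.prec_trichotomy ha hb with h' | rfl | h'
    · exact h'
    · exact absurd h (Frame.prec_irrefl _)
    · exact absurd h (Frame.prec_asymm (hmono _ hb _ ha h'))
  have hord : ∀ u w a b, Q u a → Q w b →
      (¬ F.Btw n₁ u (ι x) ∧ ¬ F.Btw n₁ w (ι x)) ∨ (F.Btw n₁ u (ι x) ∧ F.Btw n₁ w (ι x)) →
      u ≠ n₁ → w ≠ n₁ → F.prec u w → Θ.prec a b := by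
    -- Since `n₁` and `n₂` are neighbours and `n₂` is not in the zone, only `n₁` and the zone lie
    -- between `n₂` and `ι x`. Every other vertex therefore compares with `n₂` as it does with `ι
    -- x`.
    have hcmp : ∀ b ∈ Θ.verts, b ≠ x → ¬ F.Btw n₁ (ι b) (ι x) → ι b ≠ n₁ →
        (F.prec n₂ (ι b) ↔ F.prec (ι x) (ι b)) ∧ (F.prec (ι b) n₂ ↔ F.prec (ι b) (ι x)) := by
      intro b hb' hbx h1 h2
      have hb'' := hι b hb'
      have h3 := hn _ hb''
      have h4 := mt (hpinj _ hb'' _ hn₁) h2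
      have h5 := mt (hpinj _ hb'' _ hn₂) (hnew b hb').2.1
      have h6 := mt (hpinj _ hb'' _ hx') (fun e => hbx (hinj _ hb' _ hx e))
      rw [hb _ hn₁ _ hb'' _ hn₂] at h3
      rw [hb _ hn₁ _ hb'' _ hx'] at h1
      rw [hb _ hn₁ _ hn₂ _ hx'] at hn₂x
      rw [hpos _ hn₂ _ hb'', hpos _ hx' _ hb'', hpos _ hb'' _ hn₂, hpos _ hb'' _ hx']
      have h7 := mt (hpinj _ hn₁ _ hn₂) hnn
      have h8 := mt (hpinj _ hx' _ hn₁) (hnew x hx).1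
      have h9 := mt (hpinj _ hx' _ hn₂) (hnew x hx).2.1
      have h10 := hn _ hx'
      rw [hb _ hn₁ _ hx' _ hn₂] at h10
      omega
    rintro u w a b (⟨rfl, rfl⟩ | ⟨ha, hax, rfl⟩) (⟨rfl, rfl⟩ | ⟨hb', hbx, rfl⟩) hzn hu1 hw1 h
    · exact absurd h (Frame.prec_irrefl _)
    · rcases hzn with ⟨-, hzn⟩ | ⟨hzn, -⟩
      · exact hrefl _ hx _ hb' (((hcmp b hb' hbx hzn hw1).1).1 h)
      · exact absurd hzn hn₂x
    · rcases hzn with ⟨hzn, -⟩ | ⟨-, hzn⟩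
      · exact hrefl _ ha _ hx (((hcmp a ha hax hzn hu1).2).1 h)
      · exact absurd hzn hn₂x
    · exact hrefl _ ha _ hb' h
  obtain ⟨Θ', hF, hΘ'⟩ := exists_of_rel F R hRt hRs hRf hRi (by
    intro u hu u' hu' v hv v' hv' hRu hRv
    by_cases hX : u = n₁ ∨ u = ι x ∨ v = n₁ ∨ v = ι x
    · exact hnest _ hn₁ _ hx' hn₁R hR1 u hu u' hu' v hv v' hv' hRu hRv hX
    by_cases hZ : u = z₁ ∨ u = z₂ ∨ v = z₁ ∨ v = z₂
    · exact hnest _ hz₁ _ hz₂ hzR (fun w hw _ _ _ h => absurd h (hz w hw))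
        u hu u' hu' v hv v' hv' hRu hRv hZ
    push Not at hX hZ
    rintro ⟨g1, g2, g3⟩
    rcases hQ u hu u' hu' hRu with h | ⟨a, ha, qa, qa'⟩
    · rcases h with h | h | h | h
      · exact hX.1 h
      · exact hX.2.1 h
      · exact hZ.1 h
      · exact hZ.2.1 h
    rcases hQ v hv v' hv' hRv with h | ⟨b, hb', qb, qb'⟩
    · rcases h with h | h | h | h
      · exact hX.2.2.1 h
      · exact hX.2.2.2 h
      · exact hZ.2.2.1 h
      · exact hZ.2.2.2 h
    have u1 := hR1 u hu u' hu' hRu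
    have u2 := hR1 u' hu' u hu (hRs _ _ hRu)
    have v1 := hR1 v hv v' hv' hRv
    have v2 := hR1 v' hv' v hv (hRs _ _ hRv)
    have hn₁' : ∀ w w', R w w' → w ≠ ι x → w' ≠ n₁ := by
      rintro w w' hw h rfl
      exact h (hRf _ _ _ (hRs _ _ hw) hn₁R)
    have hu'n := hn₁' _ _ hRu hX.2.1
    have hv'n := hn₁' _ _ hRv hX.2.2.2
    by_cases hzz : (F.Btw n₁ u (ι x) ↔ F.Btw n₁ v (ι x))
    · have fin := fun z1 z2 z3 => Θ.crossingless a ha b hb' ⟨hord _ _ _ _ qa qb z1 hX.1 hX.2.2.1 g1,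
        hord _ _ _ _ qb qa' z2 hX.2.2.1 hu'n g2, hord _ _ _ _ qa' qb' z3 hu'n hv'n g3⟩
      by_cases zu : F.Btw n₁ u (ι x)
      · have zv := hzz.1 zu
        exact fin (Or.inr ⟨zu, zv⟩) (Or.inr ⟨zv, u1 zu⟩) (Or.inr ⟨u1 zu, v1 zv⟩)
      · have zv := mt hzz.2 zu
        exact fin (Or.inl ⟨zu, zv⟩) (Or.inl ⟨zv, mt u2 zu⟩) (Or.inl ⟨mt u2 zu, mt v2 zv⟩)
    -- One edge lies in the zone and the other lies outside it; the zone is an interval, so they do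
    -- not cross.
    · rw [hb _ hn₁ _ hu _ hx', hb _ hn₁ _ hu' _ hx'] at u1 u2
      rw [hb _ hn₁ _ hv _ hx', hb _ hn₁ _ hv' _ hx'] at v1 v2
      rw [hb _ hn₁ _ hv _ hx', hb _ hn₁ _ hu _ hx'] at hzz
      rw [hpos _ hu _ hv] at g1
      rw [hpos _ hv _ hu'] at g2
      rw [hpos _ hu' _ hv'] at g3
      omega)
  refine ⟨Θ', hF, fun w hw h1 h2 => hΘ' _ (hι w hw) _ (hRold w hw h1 h2), hΘ' _ hn₁ _ hn₁R,
    hΘ' _ hn₂ _ hn₂R, hΘ' _ hz₁ _ hzR⟩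

end SWB

/-! ### Widening a band by two strands: inverse pull-throughs -/

namespace Frame

variable {F : Frame} {h b : ℕ}

/-- The frame with two more strands in the band of `h`. -/
def widen (F : Frame) (h : ℕ) (hs : F.IsSite h) : Frame where
  toTCD := F.toTCD
  oneBoundary := F.oneBoundary
  mult k := F.mult k + if k = h ∨ k = F.mate h then 2 else 0
  mult_mate k := by
    have e1 : F.mate k = h ↔ k = F.mate h :=
      ⟨fun e => by rw [← e, F.mate_mate], fun e => by rw [e, F.mate_mate]⟩
    have e2 : F.mate k = F.mate h ↔ k = h := ⟨TCD.mate_inj, fun e => by rw [e]⟩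
    simp only [F.mult_mate, e1, e2, or_comm]
  mult_outside k hk := by
    have := hs.2
    have := (TCD.isSite_mate hs).2
    rw [F.mult_outside k hk, if_neg (by omega)]

/-- The gap in the end `mate h` of a band that corresponds to the gap `b` in the end `h`. -/
def oppGap (F : Frame) (h b : ℕ) : ℕ := if F.twist h = 0 then F.mult h - b else b

/-- The inclusion of the vertices into those of the widened frame, where the new vertices are put
into the gap `b` of the site `h`. -/
def widenMap (F : Frame) (h b : ℕ) (v : ℕ × ℕ) : ℕ × ℕ :=
  (v.1, if (v.1 = h ∧ b < v.2) ∨ (v.1 = F.mate h ∧ F.oppGap h b < v.2) then v.2 + 2 else v.2)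

/-- The left inverse of `widenMap`. -/
def narrowMap (F : Frame) (h b : ℕ) (v : ℕ × ℕ) : ℕ × ℕ :=
  (v.1, if (v.1 = h ∧ b + 2 < v.2) ∨ (v.1 = F.mate h ∧ F.oppGap h b + 2 < v.2) then v.2 - 2 else v.2)

theorem narrowMap_widenMap (hs : F.IsSite h) (v : ℕ × ℕ) :
    F.narrowMap h b (F.widenMap h b v) = v := by
  have h1 := TCD.mate_ne hs
  unfold narrowMap widenMap
  ext
  · rfl
  · dsimp only
    split_ifs <;> omega

theorem oppGap_le (hb : b ≤ F.mult h) : F.oppGap h b ≤ F.mult h := by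
  unfold oppGap; split_ifs <;> omega

theorem widenMap_mem (hs : F.IsSite h) {v : ℕ × ℕ} (hv : v ∈ F.verts) :
    F.widenMap h b v ∈ (F.widen h hs).verts := by
  obtain ⟨h1, h2⟩ := hv
  simp only [mem_verts, widenMap, widen]
  split_ifs <;> omega

theorem widenMap_prec (hs : F.IsSite h) {u v : ℕ × ℕ} (huv : F.prec u v) :
    (F.widen h hs).prec (F.widenMap h b u) (F.widenMap h b v) := by
  have := hs.2
  have := (TCD.isSite_mate hs).2
  have h1 := TCD.mate_ne hs
  have hr : (F.widen h hs).rank = F.rank := rfl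
  unfold prec at *
  simp only [widenMap, hr]
  rcases huv with h | ⟨h2, h3, h4⟩ | ⟨h2, h3, h4⟩
  · exact Or.inl h
  · right; left
    rw [← h2]
    refine ⟨rfl, h3, ?_⟩
    split_ifs <;> omega
  · right; right
    rw [← h2]
    refine ⟨rfl, h3, ?_⟩
    rw [if_neg (by omega), if_neg (by omega)]
    exact h4

theorem widen_cover (hs : F.IsSite h) (hb : b ≤ F.mult h) {v : ℕ × ℕ}
    (hv : v ∈ (F.widen h hs).verts) :
    v = (h, b + 1) ∨ v = (h, b + 2) ∨ v = (F.mate h, F.oppGap h b + 1) ∨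
      v = (F.mate h, F.oppGap h b + 2) ∨ ∃ w ∈ F.verts, F.widenMap h b w = v := by
  have h1 := TCD.mate_ne hs
  obtain ⟨k, a⟩ := v
  by_cases e : (k = h ∧ (a = b + 1 ∨ a = b + 2)) ∨
    (k = F.mate h ∧ (a = F.oppGap h b + 1 ∨ a = F.oppGap h b + 2))
  · simp only [Prod.mk.injEq]; tauto
  · right; right; right; right
    refine ⟨F.narrowMap h b (k, a), ?_, ?_⟩
    · have h2 := F.mult_mate h
      have h3 : k = h → F.mult k = F.mult h := congrArg _
      have h4 : k = F.mate h → F.mult k = F.mult (F.mate h) := congrArg _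
      have h5 := oppGap_le hb
      simp only [mem_verts, narrowMap, widen] at *
      split_ifs at * <;> omega
    · unfold narrowMap widenMap
      ext
      · rfl
      · dsimp only
        split_ifs <;> omega

theorem widenMap_new (hs : F.IsSite h) (v : ℕ × ℕ) :
    F.widenMap h b v ≠ (h, b + 1) ∧ F.widenMap h b v ≠ (h, b + 2) ∧
      F.widenMap h b v ≠ (F.mate h, F.oppGap h b + 1) ∧
      F.widenMap h b v ≠ (F.mate h, F.oppGap h b + 2) := by
  have h1 := TCD.mate_ne hs
  simp only [widenMap, ne_eq, Prod.mk.injEq]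
  refine ⟨?_, ?_, ?_, ?_⟩ <;> split_ifs <;> omega

/-- The gaps at the two ends correspond under the band involution, which is what `oppGap` is made
for; the old strands on either side of the gap keep their partners. -/
theorem widen_iota (hs : F.IsSite h) (hb : b ≤ F.mult h) {v : ℕ × ℕ} (hv : v ∈ F.intVerts) :
    (F.widen h hs).iota (F.widenMap h b v) = F.widenMap h b (F.iota v) := by
  have h1 := TCD.mate_ne hs
  have e1 : F.mate v.1 = h ↔ v.1 = F.mate h :=
    ⟨fun e => by rw [← e, F.mate_mate], fun e => by rw [e, F.mate_mate]⟩
  have e2 : F.mate v.1 = F.mate h ↔ v.1 = h := ⟨TCD.mate_inj, fun e => by rw [e]⟩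
  obtain ⟨⟨h2, h3⟩, h4⟩ := hv
  have hm : (F.widen h hs).mult v.1 = F.mult v.1 + if v.1 = h ∨ v.1 = F.mate h then 2 else 0 := rfl
  have hmt : (F.widen h hs).mate v.1 = F.mate v.1 := rfl
  have htt : (F.widen h hs).twist v.1 = F.twist v.1 := rfl
  have hmm := F.mult_mate h
  have htm := F.twist_mate h
  simp only [widenMap, iota, hm, hmt, htt, oppGap, e1, e2]
  ext
  · rfl
  · dsimp only
    by_cases c1 : v.1 = h
    · by_cases c2 : F.twist h = 0 <;> simp only [c1, c2, h1.symm, if_true, if_false, true_and,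
        false_and, or_false, false_or] at * <;> split_ifs <;> omega
    · by_cases c3 : v.1 = F.mate h
      · by_cases c2 : F.twist h = 0 <;> simp only [c3, c2, h1, htm, hmm, if_true, if_false, true_and,
          false_and, or_false, false_or, or_true] at * <;> split_ifs <;> omega
      · simp only [c1, c3, false_and, or_false, if_false, add_zero]

/-- An untwisted band reverses the order of the two new strands, a twisted one keeps it. Both cases
serve equally well, because the two new vertices at the far end are going to be paired with each
other. -/
theorem widen_iota_new (hs : F.IsSite h) (hb : b ≤ F.mult h) :
    ((F.widen h hs).iota (F.mate h, F.oppGap h b + 1) = (h, b + 1) ∧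
      (F.widen h hs).iota (F.mate h, F.oppGap h b + 2) = (h, b + 2)) ∨
    ((F.widen h hs).iota (F.mate h, F.oppGap h b + 1) = (h, b + 2) ∧
      (F.widen h hs).iota (F.mate h, F.oppGap h b + 2) = (h, b + 1)) := by
  have hm : (F.widen h hs).mult (F.mate h) = F.mult h + 2 := by simp [widen, F.mult_mate]
  have hmt : (F.widen h hs).mate (F.mate h) = h := F.mate_mate h
  have htt : (F.widen h hs).twist (F.mate h) = F.twist h := F.twist_mate h
  simp only [iota, hm, hmt, htt, oppGap, Prod.mk.injEq, true_and]
  by_cases c : F.twist h = 0 <;> simp only [c, if_true, if_false]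
  · omega
  · exact Or.inl ⟨trivial, trivial⟩

end Frame

namespace SWB

/-- The inverse of a pull-through: the edge at `x` is pushed over the band of `h`, through the gap
`b` of `h`. -/
theorem exists_pullThrough (Θ : SWB) {h b c₁ c₂ : ℕ} (hs : Θ.IsSite h) (hb : b ≤ Θ.mult h)
    (hc : (c₁ = b + 1 ∧ c₂ = b + 2) ∨ (c₁ = b + 2 ∧ c₂ = b + 1)) {x : ℕ × ℕ} (hx : x ∈ Θ.verts)
    (hn : ¬ (Θ.widen h hs).Btw (h, c₁) (h, c₂) (Θ.widenMap h b x))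
    (hzone : ∀ w ∈ Θ.verts, (Θ.widen h hs).Btw (h, c₁) (Θ.widenMap h b w) (Θ.widenMap h b x) →
      (Θ.widen h hs).Btw (h, c₁) (Θ.widenMap h b (Θ.pair w)) (Θ.widenMap h b x)) :
    ∃ Θ' : SWB, Θ'.toFrame = Θ.widen h hs ∧
      (∀ w ∈ Θ.verts, w ≠ x → w ≠ Θ.pair x →
        Θ'.pair (Θ.widenMap h b w) = Θ.widenMap h b (Θ.pair w)) ∧
      Θ'.pair (h, c₁) = Θ.widenMap h b x ∧
      IsPullThrough Θ' (Θ.mate h) (Θ.oppGap h b + 1) Θ := by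
  have hmh := TCD.mate_ne hs
  have hs2 := hs.2
  have hs3 := (TCD.isSite_mate hs).2
  have hmm := Θ.mult_mate h
  have hb' := Frame.oppGap_le hb
  have hmult : ∀ k, (Θ.widen h hs).mult k = Θ.mult k + if k = h ∨ k = Θ.mate h then 2 else 0 :=
    fun _ => rfl
  have hrank : (Θ.widen h hs).rank = Θ.rank := rfl
  have hnewv : ∀ a, 1 ≤ a → a ≤ Θ.mult h + 2 →
      (h, a) ∈ (Θ.widen h hs).verts ∧ (Θ.mate h, a) ∈ (Θ.widen h hs).verts := by
    intro a h1 h2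
    simp only [Frame.mem_verts, hmult, hmm]
    simp [h1, h2]
  have hc1 := (hnewv c₁ (by omega) (by omega)).1
  have hc2 := (hnewv c₂ (by omega) (by omega)).1
  have hz1 := (hnewv (Θ.oppGap h b + 1) (by omega) (by omega)).2
  have hz2 := (hnewv (Θ.oppGap h b + 2) (by omega) (by omega)).2
  have hnw := Frame.widenMap_new (b := b) hs
  have hcov := fun v hv => Frame.widen_cover (v := v) hs hb hv
  have hinj : ∀ {v w}, Θ.widenMap h b v = Θ.widenMap h b w → v = w := fun {v w} e => by
    rw [← Frame.narrowMap_widenMap (b := b) hs v, e, Frame.narrowMap_widenMap hs]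
  obtain ⟨Θ', hF, h1, h2, h3, h4⟩ := exists_insert Θ (Θ.widen h hs) (Θ.widenMap h b) (h, c₁) (h, c₂)
    (Θ.mate h, Θ.oppGap h b + 1) (Θ.mate h, Θ.oppGap h b + 2) x
    (fun v hv => Frame.widenMap_mem hs hv) (fun u _ v _ h => Frame.widenMap_prec hs h)
    (fun v hv => by
      have := hcov v hv
      rcases hc with ⟨rfl, rfl⟩ | ⟨rfl, rfl⟩
      · exact this
      · rw [← or_assoc, or_comm (a := v = (h, b + 2)), or_assoc]; exact this)
    (fun w _ => by
      have := hnw w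
      rcases hc with ⟨rfl, rfl⟩ | ⟨rfl, rfl⟩
      · exact this
      · exact ⟨this.2.1, this.1, this.2.2⟩)
    hc1 hc2 hz1 hz2 (by simp; omega) (by simp) (by simp [hmh.symm]) (by simp [hmh.symm])
    (by simp [hmh.symm]) (by simp [hmh.symm])
    (fun w _ => by simp only [Frame.Btw, Frame.prec, hrank]; omega)
    (fun w _ => by simp only [Frame.Btw, Frame.prec, hrank]; omega)
    hx hn hzone
  refine ⟨Θ', hF, h1, h2, ?_⟩
  have hT : Θ'.toTCD = Θ.toTCD := by rw [hF]; rfl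
  have hrank' : Θ'.rank = Θ.rank := congrArg TCD.rank hT
  have hmate' : Θ'.mate = Θ.mate := congrArg TCD.mate hT
  have hiota : Θ'.iota = (Θ.widen h hs).iota := congrArg Frame.iota hF
  have hverts : Θ'.verts = (Θ.widen h hs).verts := congrArg Frame.verts hF
  have hint : ∀ v, v ∈ Θ'.intVerts ↔ v ∈ (Θ.widen h hs).verts ∧ Θ.IsSite v.1 := by
    intro v
    rw [hF]; rfl
  have hni := Frame.widen_iota_new hs hb
  obtain ⟨U, hUe, hU⟩ : ∃ U : Set (ℕ × ℕ),
      U = {(Θ.mate h, Θ.oppGap h b + 1), (Θ.mate h, Θ.oppGap h b + 1 + 1),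
        Θ'.iota (Θ.mate h, Θ.oppGap h b + 1), Θ'.iota (Θ.mate h, Θ.oppGap h b + 1 + 1)} ∧
      ∀ v, v ∈ U ↔ v = (h, b + 1) ∨ v = (h, b + 2) ∨ v = (Θ.mate h, Θ.oppGap h b + 1) ∨
        v = (Θ.mate h, Θ.oppGap h b + 2) := by
    refine ⟨_, rfl, fun v => ?_⟩
    rw [hiota]
    simp only [Set.mem_insert_iff, Set.mem_singleton_iff]
    rcases hni with ⟨e1, e2⟩ | ⟨e1, e2⟩ <;> rw [e1, e2] <;> tauto
  have hpx : Θ'.pair (h, c₁) ≠ (h, c₂) := by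
    rw [h2]; rcases hc with ⟨rfl, rfl⟩ | ⟨rfl, rfl⟩
    · exact (hnw x).2.1
    · exact (hnw x).1
  have hpy : Θ'.pair (h, c₂) ≠ (h, c₁) := by
    rw [h3]; rcases hc with ⟨rfl, rfl⟩ | ⟨rfl, rfl⟩
    · exact (hnw _).1
    · exact (hnw _).2.1
  have hrep : ∀ v ∈ Θ'.verts, (¬ (v = (h, b + 1) ∨ v = (h, b + 2) ∨
      v = (Θ.mate h, Θ.oppGap h b + 1) ∨ v = (Θ.mate h, Θ.oppGap h b + 2))) →
      ∃ w ∈ Θ.verts, Θ.widenMap h b w = v := by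
    intro v hv hvU
    have := hcov v (hverts ▸ hv)
    tauto
  have hnU : ∀ w, ¬ (Θ.widenMap h b w = (h, b + 1) ∨ Θ.widenMap h b w = (h, b + 2) ∨
      Θ.widenMap h b w = (Θ.mate h, Θ.oppGap h b + 1) ∨
      Θ.widenMap h b w = (Θ.mate h, Θ.oppGap h b + 2)) := by
    intro w
    have := hnw w
    tauto
  refine ⟨(hint _).2 ⟨hz1, TCD.isSite_mate hs⟩, (hint _).2 ⟨hz2, TCD.isSite_mate hs⟩, h4, ?_,
    hT.symm, ?_, U, Θ.narrowMap h b, hUe, ?_, ?_⟩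
  · rw [hiota]
    rcases hc with ⟨rfl, rfl⟩ | ⟨rfl, rfl⟩ <;> rcases hni with ⟨e1, e2⟩ | ⟨e1, e2⟩ <;> rw [e1, e2] <;>
      assumption
  · intro k
    rw [hmate', Θ.mate_mate, hF, hmult]
    simp only [or_comm]
    omega
  · refine ⟨⟨?_, ?_, ?_⟩, ?_⟩
    · rintro v ⟨hv, hvU⟩
      rw [hU] at hvU
      obtain ⟨w, hw, rfl⟩ := hrep v hv hvU
      rwa [Frame.narrowMap_widenMap hs]
    · rintro v ⟨hv, hvU⟩ v' ⟨hv', hvU'⟩ e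
      rw [hU] at hvU hvU'
      obtain ⟨w, hw, rfl⟩ := hrep v hv hvU
      obtain ⟨w', hw', rfl⟩ := hrep v' hv' hvU'
      rw [Frame.narrowMap_widenMap hs, Frame.narrowMap_widenMap hs] at e
      rw [e]
    · intro w hw
      refine ⟨Θ.widenMap h b w, ⟨hverts ▸ Frame.widenMap_mem hs hw, ?_⟩,
        Frame.narrowMap_widenMap hs w⟩
      rw [hU]
      exact hnU w
    · rintro v ⟨hv, hvU⟩ v' ⟨hv', hvU'⟩ e
      rw [hU] at hvU hvU'
      obtain ⟨w, hw, rfl⟩ := hrep v hv hvU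
      obtain ⟨w', hw', rfl⟩ := hrep v' hv' hvU'
      rw [Frame.narrowMap_widenMap hs, Frame.narrowMap_widenMap hs]
      rw [hF] at e
      rcases Frame.prec_trichotomy hw hw' with h | rfl | h
      · exact h
      · exact absurd e (Frame.prec_irrefl _)
      · exact absurd e (Frame.prec_asymm (Frame.widenMap_prec hs h))
  · rintro v ⟨hv, hvU⟩ v' ⟨hv', hvU'⟩
    have hvU2 := hvU
    have hvU2' := hvU'
    rw [hU] at hvU hvU'
    obtain ⟨w, hw, rfl⟩ := hrep v hv hvU
    obtain ⟨w', hw', rfl⟩ := hrep v' hv' hvU'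
    rw [Frame.narrowMap_widenMap hs, Frame.narrowMap_widenMap hs]
    have hp1 : Θ'.pair (Θ.widenMap h b x) = (h, c₁) := by rw [← h2, Θ'.pair_pair]
    have hp2 : Θ'.pair (Θ.widenMap h b (Θ.pair x)) = (h, c₂) := by rw [← h3, Θ'.pair_pair]
    have hcU : ∀ c, c = c₁ ∨ c = c₂ → ((h, c) = (h, b + 1) ∨ (h, c) = (h, b + 2) ∨
        (h, c) = (Θ.mate h, Θ.oppGap h b + 1) ∨ (h, c) = (Θ.mate h, Θ.oppGap h b + 2)) := by
      intro c e
      rcases (by omega : c = b + 1 ∨ c = b + 2) with rfl | rfl <;> simp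
    have hios : ∀ w ∈ Θ.verts, Θ.IsSite w.1 →
        Θ'.iota (Θ.widenMap h b w) = Θ.widenMap h b (Θ.iota w) := by
      intro w hw hws
      rw [hiota]
      exact Frame.widen_iota hs hb ⟨hw, hws⟩
    have hpo : ∀ w ∈ Θ.verts, w ≠ x → w ≠ Θ.pair x →
        Θ'.pair (Θ.widenMap h b w) = Θ.widenMap h b (Θ.pair w) := h1
    -- Only `x` and its partner are joined to new vertices, so a contracted path through new
    -- vertices can only restore the edge between these two.
    have ho : ∀ w ∈ Θ.verts, ∀ z, (z = (h, b + 1) ∨ z = (h, b + 2) ∨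
        z = (Θ.mate h, Θ.oppGap h b + 1) ∨ z = (Θ.mate h, Θ.oppGap h b + 2)) →
        Θ'.curveGraph.Adj (Θ.widenMap h b w) z → w = x ∨ w = Θ.pair x := by
      intro w hw z hz ha
      by_contra hne
      push Not at hne
      rcases curveGraph_adj.1 ha with ⟨_, rfl⟩ | ⟨hi, rfl⟩
      · rw [hpo w hw hne.1 hne.2] at hz
        exact hnU _ hz
      · rw [hios w hw ((hint _).1 hi).2] at hz
        exact hnU _ hz
    constructor
    · intro ha
      rcases curveGraph_adj.1 ha with ⟨_, e⟩ | ⟨hi, e⟩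
      · have hxy : (Θ'.curveGraph.contract U).Adj (Θ.widenMap h b x)
            (Θ.widenMap h b (Θ.pair x)) := by
          have a1 : Θ'.curveGraph.Adj (Θ.widenMap h b x) (h, c₁) :=
            curveGraph_adj.2 (Or.inl ⟨hverts ▸ Frame.widenMap_mem hs hx, hp1⟩)
          have a2 : Θ'.curveGraph.Adj (h, c₂) (Θ.widenMap h b (Θ.pair x)) :=
            curveGraph_adj.2 (Or.inl ⟨hverts ▸ hc2, h3⟩)
          have a3 : Θ'.curveGraph.Adj (Θ.mate h, Θ.oppGap h b + 1) (Θ.mate h, Θ.oppGap h b + 2) :=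
            curveGraph_adj.2 (Or.inl ⟨hverts ▸ hz1, h4⟩)
          have a4 : Θ'.curveGraph.Adj (Θ.mate h, Θ.oppGap h b + 1)
              (Θ'.iota (Θ.mate h, Θ.oppGap h b + 1)) :=
            curveGraph_adj.2 (Or.inr ⟨(hint _).2 ⟨hz1, TCD.isSite_mate hs⟩, rfl⟩)
          have a5 : Θ'.curveGraph.Adj (Θ.mate h, Θ.oppGap h b + 2)
              (Θ'.iota (Θ.mate h, Θ.oppGap h b + 2)) :=
            curveGraph_adj.2 (Or.inr ⟨(hint _).2 ⟨hz2, TCD.isSite_mate hs⟩, rfl⟩)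
          -- From `x` to the near end of the band, along it, back at the far end, and out again to
          -- the partner of `x`.
          have hwk : ∃ p : Θ'.curveGraph.Walk (Θ.widenMap h b x) (Θ.widenMap h b (Θ.pair x)),
              ∀ z ∈ p.support, z = Θ.widenMap h b x ∨ z = Θ.widenMap h b (Θ.pair x) ∨
                (z = (h, b + 1) ∨ z = (h, b + 2) ∨
                  z = (Θ.mate h, Θ.oppGap h b + 1) ∨ z = (Θ.mate h, Θ.oppGap h b + 2)) := by
            have k1 := hcU c₁ (Or.inl rfl)
            have k2 := hcU c₂ (Or.inr rfl)
            have hor : ((Θ'.iota (Θ.mate h, Θ.oppGap h b + 1) = (h, c₁) ∧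
                Θ'.iota (Θ.mate h, Θ.oppGap h b + 2) = (h, c₂)) ∨
                (Θ'.iota (Θ.mate h, Θ.oppGap h b + 1) = (h, c₂) ∧
                Θ'.iota (Θ.mate h, Θ.oppGap h b + 2) = (h, c₁))) := by
              rw [hiota]
              rcases hc with ⟨rfl, rfl⟩ | ⟨rfl, rfl⟩
              · exact hni
              · exact hni.symm
            rcases hor with ⟨e1, e2⟩ | ⟨e1, e2⟩ <;> rw [e1] at a4 <;> rw [e2] at a5
            · refine ⟨.cons a1 (.cons a4.symm (.cons a3 (.cons a5 (.cons a2 .nil)))), ?_⟩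
              intro z hz
              simp only [SimpleGraph.Walk.support_cons, SimpleGraph.Walk.support_nil,
                List.mem_cons, List.not_mem_nil, or_false] at hz
              rcases hz with rfl | rfl | rfl | rfl | rfl | rfl
              · exact Or.inl rfl
              · exact Or.inr (Or.inr k1)
              · exact Or.inr (Or.inr (Or.inr (Or.inr (Or.inl rfl))))
              · exact Or.inr (Or.inr (Or.inr (Or.inr (Or.inr rfl))))
              · exact Or.inr (Or.inr k2)
              · exact Or.inr (Or.inl rfl)
            · refine ⟨.cons a1 (.cons a5.symm (.cons a3.symm (.cons a4 (.cons a2 .nil)))), ?_⟩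
              intro z hz
              simp only [SimpleGraph.Walk.support_cons, SimpleGraph.Walk.support_nil,
                List.mem_cons, List.not_mem_nil, or_false] at hz
              rcases hz with rfl | rfl | rfl | rfl | rfl | rfl
              · exact Or.inl rfl
              · exact Or.inr (Or.inr k1)
              · exact Or.inr (Or.inr (Or.inr (Or.inr (Or.inr rfl))))
              · exact Or.inr (Or.inr (Or.inr (Or.inr (Or.inl rfl))))
              · exact Or.inr (Or.inr k2)
              · exact Or.inr (Or.inl rfl)
          obtain ⟨p, hp⟩ := hwk
          refine SimpleGraph.contract_adj_of_walk (fun e => (pair_ne hx) (hinj e).symm)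
            ?_ ?_ p (fun z hz => ?_)
          · rw [hU]; exact hnU _
          · rw [hU]; exact hnU _
          · rw [hU]; exact hp z hz
        by_cases e1 : w = x
        · subst e1; rw [← e]; exact hxy
        by_cases e2 : w = Θ.pair x
        · subst e2
          rw [Θ.pair_pair] at e
          subst e
          exact hxy.symm
        exact SimpleGraph.contract_adj_of_adj hvU2 hvU2'
          (curveGraph_adj.2 (Or.inl ⟨hv, by rw [hpo w hw e1 e2, e]⟩))
      · exact SimpleGraph.contract_adj_of_adj hvU2 hvU2' (curveGraph_adj.2 (Or.inr
          ⟨(hint _).2 ⟨hverts ▸ hv, hi.2⟩, by rw [hios w hw hi.2, e]⟩))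
    · intro ha
      obtain ⟨hne, -, -, ha | ⟨c, hcu, d, hdu, hac, had, -⟩⟩ :=
        SimpleGraph.of_contract_adj (fun _ => ()) (fun _ _ _ _ _ => rfl) ha
      · rw [curveGraph_adj]
        rcases curveGraph_adj.1 ha with ⟨_, e⟩ | ⟨hi, e⟩
        · left
          refine ⟨hw, ?_⟩
          by_cases e1 : w = x
          · subst e1
            rw [hp1] at e
            exact absurd (hcU c₁ (Or.inl rfl)) (e ▸ hnU w')
          by_cases e2 : w = Θ.pair x
          · subst e2
            rw [hp2] at e
            exact absurd (hcU c₂ (Or.inr rfl)) (e ▸ hnU w')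
          rw [hpo w hw e1 e2] at e
          exact hinj e
        · right
          have hi' := ((hint _).1 hi).2
          rw [hios w hw hi'] at e
          exact ⟨⟨hw, hi'⟩, hinj e⟩
      · rw [hU] at hcu hdu
        rw [curveGraph_adj]
        left
        refine ⟨hw, ?_⟩
        have hne' : w ≠ w' := fun e => hne (by rw [e])
        rcases ho w hw c hcu hac with rfl | rfl <;> rcases ho w' hw' d hdu had.symm with rfl | rfl
        · exact absurd rfl hne'
        · rfl
        · exact Θ.pair_pair _
        · exact absurd rfl hne'

end SWB

/-! ### Making the strands at a site parallel to the adjacent band end -/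

namespace SWB

/-- All strands at the site `j` can be made to run parallel to the end `next j η` of the adjacent
band, by an isotopy. -/
theorem exists_parallel (Θ : SWB) {j : ℕ} {η : ℤˣ} (hadm : Θ.Admissible j η) :
    ∃ Θ' : SWB, Θ'.toTCD = Θ.toTCD ∧ Isotopic Θ' Θ ∧
      (∀ k, k ≠ TCD.next j η → k ≠ Θ.mate (TCD.next j η) → Θ'.mult k = Θ.mult k) ∧
      Θ.mult j ≤ Θ'.mult (TCD.next j η) ∧
      ∀ a, 1 ≤ a → a ≤ Θ.mult j → Θ'.pair (j, a) = (TCD.next j η,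
        (if η = 1 then Θ.mult j else Θ'.mult (TCD.next j η)) + 1 - a) := by
  have hhj := TCD.next_ne hadm
  have hmj := TCD.mate_next_ne hadm
  have hhs := hadm.2.1
  have hjs := hadm.1
  have hjn : TCD.next j η = if η = 1 then j + 1 else j - 1 := by
    rcases Int.units_eq_one_or η with e | e <;> rw [e]
    · rw [TCD.next_one]; rfl
    · rw [TCD.next_neg_one]; rfl
  generalize TCD.next j η = h at *
  have h2 := hhs.2
  have h2' := hjs.2
  have h1 := hjs.1
  -- The first `n` strands at `j`, counted from the side facing `h`, already run parallel into `h`.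
  -- For `η = -1` positions at `h` are counted from the top, so the formula remains valid when
  -- pushing the next strand over the band raises the multiplicity of `h` by two.
  suffices H : ∀ n ≤ Θ.mult j, ∃ Θ' : SWB, Θ'.toTCD = Θ.toTCD ∧ Isotopic Θ' Θ ∧
      (∀ k, k ≠ h → k ≠ Θ.mate h → Θ'.mult k = Θ.mult k) ∧ n ≤ Θ'.mult h ∧
      ∀ a, (if η = 1 then Θ.mult j - n < a ∧ a ≤ Θ.mult j else 1 ≤ a ∧ a ≤ n) →
        Θ'.pair (j, a) = (h, (if η = 1 then Θ.mult j else Θ'.mult h) + 1 - a) by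
    obtain ⟨Θ', e1, e2, e3, e4, e5⟩ := H _ le_rfl
    exact ⟨Θ', e1, e2, e3, e4, fun a ha ha' => e5 a (by split_ifs <;> omega)⟩
  intro n
  induction n with
  | zero =>
    intro _
    exact ⟨Θ, rfl, .refl _, fun _ _ _ => rfl, Nat.zero_le _, fun a ha => by
      split_ifs at ha <;> omega⟩
  | succ n ih =>
    intro hn
    obtain ⟨Θ₁, e1, e2, e3, e4, e5⟩ := ih (by omega)
    have hmate : Θ₁.mate = Θ.mate := congrArg TCD.mate e1
    have hrank : Θ₁.rank = Θ.rank := congrArg TCD.rank e1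
    have hs : Θ₁.IsSite h := by rw [e1]; exact hhs
    have hfj := e3 j hhj.symm hmj.symm
    have hwr : (Θ₁.widen h hs).rank = Θ.rank := hrank
    have hwm : (Θ₁.widen h hs).mult h = Θ₁.mult h + 2 := by simp [Frame.widen]
    have hwo : ∀ k, k ≠ h → k ≠ Θ.mate h → (Θ₁.widen h hs).mult k = Θ.mult k := by
      intro k hk hk'
      rw [← e3 k hk hk']
      simp [Frame.widen, hk, hmate, hk']
    have hmh : Θ.mate h ≠ h := TCD.mate_ne hhs
    have hιj : ∀ b a, Θ₁.widenMap h b (j, a) = (j, a) := by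
      intro b a
      simp [Frame.widenMap, hhj.symm, hmate, hmj.symm]
    have hιh : ∀ b a, Θ₁.widenMap h b (h, a) = (h, if b < a then a + 2 else a) := by
      intro b a
      simp [Frame.widenMap, hmate, hmh.symm]
    have hι1 : ∀ b v, (Θ₁.widenMap h b v).1 = v.1 := fun _ _ => rfl
    rcases Int.units_eq_one_or η with rfl | rfl
    · simp only [if_true] at hjn e5 ⊢
      subst hjn
      -- Between the next strand at `j` and the chosen gap of `h` lie exactly the `n` parallel edges
      -- already made, with both of their ends.
      have hzone : ∀ w ∈ Θ₁.verts, (Θ₁.widen (j + 1) hs).Btw (j + 1, n + 1)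
          (Θ₁.widenMap (j + 1) n w) (Θ₁.widenMap (j + 1) n (j, Θ.mult j - n)) →
          (Θ₁.widen (j + 1) hs).Btw (j + 1, n + 1) (Θ₁.widenMap (j + 1) n (Θ₁.pair w))
            (Θ₁.widenMap (j + 1) n (j, Θ.mult j - n)) := by
        rintro ⟨k, a⟩ hw hb
        obtain ⟨w1, w2⟩ := hw
        dsimp only at w1 w2
        have hk : k = j ∨ k = j + 1 := by
          rw [hιj] at hb
          simp only [Frame.Btw, Frame.prec, hι1] at hb
          omega
        rcases hk with rfl | rfl
        · rw [hιj, hιj] at hb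
          have ha : Θ.mult k - n < a := by
            simp only [Frame.Btw, Frame.prec, hwr] at hb; omega
          rw [hfj] at w2
          rw [e5 a ⟨ha, w2⟩, hιj, hιh, if_neg (by omega)]
          simp only [Frame.Btw, Frame.prec, hwr, true_and]; omega
        · rw [hιj, hιh] at hb
          have ha : a ≤ n := by
            simp only [Frame.Btw, Frame.prec, hwr] at hb; split_ifs at hb <;> omega
          have := e5 (Θ.mult j + 1 - a) ⟨by omega, by omega⟩
          rw [show Θ.mult j + 1 - (Θ.mult j + 1 - a) = a by omega] at this
          rw [← this, Θ₁.pair_pair, hιj, hιj]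
          simp only [Frame.Btw, Frame.prec, hwr, true_and]; omega
      -- The gap directly behind the `n` strands already made; of the two new vertices the one
      -- nearer to `j` is joined to the next strand.
      obtain ⟨Θ₂, g1, g2, g3, g4⟩ := exists_pullThrough Θ₁ (b := n) (c₁ := n + 1) (c₂ := n + 2)
        hs e4 (Or.inl ⟨rfl, rfl⟩) (x := (j, Θ.mult j - n))
        (by rw [Frame.mem_verts]; dsimp only; omega)
        (by rw [hιj]; simp only [Frame.Btw, Frame.prec, hwr, true_and]; omega)
        hzone
      have gm : Θ₂.mult = (Θ₁.widen (j + 1) hs).mult := congrArg Frame.mult g1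
      refine ⟨Θ₂, by rw [g1]; exact e1, .trans _ _ _ (.rel _ _ ⟨_, _, g4⟩) e2, ?_, ?_, ?_⟩
      · intro k hk hk'
        rw [gm, hwo k hk hk']
      · rw [gm, hwm]; omega
      · intro a ha
        by_cases hx : a = Θ.mult j - n
        · rw [hιj] at g3
          rw [hx, ← g3, Θ₂.pair_pair]
          ext <;> dsimp only; omega
        · have h5 := e5 a (by omega)
          have := g2 (j, a) ⟨by dsimp only; omega, by dsimp only; omega⟩ (by simp [hx]) (by
            intro e
            rw [← congrArg Θ₁.pair e.symm, Θ₁.pair_pair] at h5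
            simp at h5)
          rwa [h5, hιj, hιh, if_neg (by omega)] at this
    · simp only [if_neg (show ¬ (-1 : ℤˣ) = 1 by decide)] at hjn e5 ⊢
      obtain rfl : j = h + 1 := by omega
      -- The mirror image: the gap lies `n` places below the top of `h`, and the upper one of the
      -- new vertices faces `j`.
      have hzone : ∀ w ∈ Θ₁.verts, (Θ₁.widen h hs).Btw (h, Θ₁.mult h - n + 2)
          (Θ₁.widenMap h (Θ₁.mult h - n) w) (Θ₁.widenMap h (Θ₁.mult h - n) (h + 1, n + 1)) →
          (Θ₁.widen h hs).Btw (h, Θ₁.mult h - n + 2)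
            (Θ₁.widenMap h (Θ₁.mult h - n) (Θ₁.pair w))
            (Θ₁.widenMap h (Θ₁.mult h - n) (h + 1, n + 1)) := by
        rintro ⟨k, a⟩ hw hb
        obtain ⟨w1, w2⟩ := hw
        dsimp only at w1 w2
        have hk : k = h ∨ k = h + 1 := by
          rw [hιj] at hb
          simp only [Frame.Btw, Frame.prec, hι1] at hb
          omega
        rcases hk with rfl | rfl
        · rw [hιj, hιh] at hb
          have ha : Θ₁.mult k - n < a := by
            simp only [Frame.Btw, Frame.prec, hwr] at hb; split_ifs at hb <;> omega
          have := e5 (Θ₁.mult k + 1 - a) ⟨by omega, by omega⟩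
          rw [show Θ₁.mult k + 1 - (Θ₁.mult k + 1 - a) = a by omega] at this
          rw [← this, Θ₁.pair_pair, hιj, hιj]
          simp only [Frame.Btw, Frame.prec, hwr, true_and]; omega
        · rw [hιj, hιj] at hb
          have ha : a ≤ n := by
            simp only [Frame.Btw, Frame.prec, hwr] at hb; omega
          rw [e5 a ⟨w1, ha⟩, hιj, hιh, if_pos (by omega)]
          simp only [Frame.Btw, Frame.prec, hwr, true_and]; omega
      obtain ⟨Θ₂, g1, g2, g3, g4⟩ := exists_pullThrough Θ₁ (b := Θ₁.mult h - n)
        (c₁ := Θ₁.mult h - n + 2) (c₂ := Θ₁.mult h - n + 1)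
        hs (by omega) (Or.inr ⟨rfl, rfl⟩) (x := (h + 1, n + 1))
        (by rw [Frame.mem_verts]; dsimp only; omega)
        (by rw [hιj]; simp only [Frame.Btw, Frame.prec, hwr, true_and]; omega)
        hzone
      have gm : Θ₂.mult = (Θ₁.widen h hs).mult := congrArg Frame.mult g1
      refine ⟨Θ₂, by rw [g1]; exact e1, .trans _ _ _ (.rel _ _ ⟨_, _, g4⟩) e2, ?_, ?_, ?_⟩
      · intro k hk hk'
        rw [gm, hwo k hk hk']
      · rw [gm, hwm]; omega
      · intro a ha
        rw [gm, hwm]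
        by_cases hx : a = n + 1
        · rw [hιj] at g3
          rw [hx, ← g3, Θ₂.pair_pair]
          ext <;> dsimp only; omega
        · have h5 := e5 a (by omega)
          have := g2 (h + 1, a) ⟨by dsimp only; omega, by dsimp only; omega⟩ (by simp [hx]) (by
            intro e
            rw [← congrArg Θ₁.pair e.symm, Θ₁.pair_pair] at h5
            simp at h5)
          rw [h5, hιj, hιh, if_pos (by omega)] at this
          rw [this]
          ext <;> dsimp only; omega

end SWB

/-! ### Undoing a handle slide: frames -/

namespace Frame

variable {F : Frame} {j : ℕ} {η : ℤˣ} (hadm : F.Admissible j η)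

/-- The frame from which a handle slide leads back to `F`. -/
def unslide (F : Frame) (j : ℕ) (η : ℤˣ) (hadm : F.Admissible j η) : Frame where
  toTCD := F.toTCD.slide j η hadm
  oneBoundary := TCD.slide_oneBoundary hadm F.oneBoundary
  -- A slide adds `f(p)` to the band slid over, so it is subtracted here. The truncated subtraction
  -- is a true one only when `F.mult j ≤ F.mult (TCD.next j η)`, which the comparison with the slid
  -- frame assumes.
  mult k := F.mult (siteMove (F.target j η) j k) -
    if siteMove (F.target j η) j k = TCD.next j η ∨
      siteMove (F.target j η) j k = F.mate (TCD.next j η) then F.mult j else 0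
  mult_mate k := by
    have e : siteMove (F.target j η) j ((F.toTCD.slide j η hadm).mate k) =
        F.mate (siteMove (F.target j η) j k) := siteMove_siteMove _ _ _
    have e1 : F.mate (siteMove (F.target j η) j k) = TCD.next j η ↔
        siteMove (F.target j η) j k = F.mate (TCD.next j η) :=
      ⟨fun e => by rw [← e, F.mate_mate], fun e => by rw [e, F.mate_mate]⟩
    have e2 : F.mate (siteMove (F.target j η) j k) = F.mate (TCD.next j η) ↔
        siteMove (F.target j η) j k = TCD.next j η := ⟨TCD.mate_inj, fun e => by rw [e]⟩
    simp only [e, F.mult_mate, e1, e2, or_comm]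
  mult_outside k hk := by
    have hk' : 2 * F.rank + 1 < k := hk
    have h1 := hadm.1.2
    have h2 := (TCD.isSite_target hadm).2
    rw [siteMove_apply, if_neg (by omega), if_neg (by omega), if_neg (by omega),
      F.mult_outside k hk', Nat.zero_sub]

/-- The shift of the indices of the vertices in a handle slide. -/
def slideShift (F : Frame) (j : ℕ) (η : ℤˣ) (k : ℕ) : ℕ :=
  -- Before the slide the moved site is the neighbour of the far end; after it, both blocks of
  -- strands share the far end. The moved block comes second if the site was to the right (`side`
  -- equal to `1`) and first otherwise. At the near end the strands facing `j` are new, so the old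
  -- ones are shifted only if `j` is on the left.
  if k = j then (if F.side (TCD.next j η) η = 1 then F.mult (TCD.next j η) - F.mult j else 0)
  else if k = F.mate (TCD.next j η) then (if F.side (TCD.next j η) η = 1 then 0 else F.mult j)
  else if k = TCD.next j η then (if η = 1 then F.mult j else 0)
  else 0

/-- The inclusion of the old vertices into the vertices after a handle slide. -/
def slideMap (F : Frame) (j : ℕ) (η : ℤˣ) (v : ℕ × ℕ) : ℕ × ℕ :=
  (if siteMove (F.target j η) j v.1 = j then F.mate (TCD.next j η)
    else siteMove (F.target j η) j v.1,
    v.2 + F.slideShift j η (siteMove (F.target j η) j v.1))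

/-- The vertices that are created by a handle slide. -/
def slideSet (F : Frame) (j : ℕ) (η : ℤˣ) : Set (ℕ × ℕ) :=
  {v | v ∈ F.verts ∧ (v.1 = j ∨ (v.1 = TCD.next j η ∧
    if η = 1 then v.2 ≤ F.mult j else F.mult (TCD.next j η) - F.mult j < v.2))}

theorem slideMap_apply (k a : ℕ) : F.slideMap j η (siteMove j (F.target j η) k, a) =
    (if k = j then F.mate (TCD.next j η) else k, a + F.slideShift j η k) := by
  simp only [slideMap, siteMove_siteMove]

theorem unslide_mult (k : ℕ) : (F.unslide j η hadm).mult (siteMove j (F.target j η) k) =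
    F.mult k - if k = TCD.next j η ∨ k = F.mate (TCD.next j η) then F.mult j else 0 := by
  simp only [unslide, siteMove_siteMove]

theorem unslide_mult' (k : ℕ) : (F.unslide j η hadm).mult k =
    F.mult (siteMove (F.target j η) j k) - if siteMove (F.target j η) j k = TCD.next j η ∨
      siteMove (F.target j η) j k = F.mate (TCD.next j η) then F.mult j else 0 := rfl

theorem exists_eq_siteMove (j t : ℕ) (v : ℕ × ℕ) : ∃ k a, v = (siteMove j t k, a) :=
  ⟨siteMove t j v.1, v.2, by rw [siteMove_siteMove]⟩

theorem slideMap_mem (hadm : F.Admissible j η) (hle : F.mult j ≤ F.mult (TCD.next j η))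
    {v : ℕ × ℕ} (hv : v ∈ (F.unslide j η hadm).verts) :
    F.slideMap j η v ∈ F.verts ∧ F.slideMap j η v ∉ F.slideSet j η := by
  obtain ⟨k, a, rfl⟩ := exists_eq_siteMove j (F.target j η) v
  obtain ⟨h1, h2⟩ := hv
  dsimp only at h1 h2
  rw [unslide_mult] at h2
  have hhj := TCD.next_ne hadm
  have hmj := TCD.mate_next_ne hadm
  have hmh := TCD.mate_ne hadm.2.1
  have hm := F.mult_mate (TCD.next j η)
  simp only [slideSet, Set.mem_ofPred_eq, mem_verts, slideMap_apply, slideShift]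
  by_cases e1 : k = j
  · subst e1
    rw [if_neg (by omega)] at h2
    simp only [if_true, hm, hmh, hmj, false_and, or_false]
    split_ifs <;> simp <;> omega
  · by_cases e2 : k = F.mate (TCD.next j η)
    · subst e2
      rw [if_pos (by omega)] at h2
      simp only [if_true, if_false, hmj, hmh, hm, false_and, or_false] at *
      split_ifs <;> simp <;> omega
    · by_cases e3 : k = TCD.next j η
      · subst e3
        rw [if_pos (by omega)] at h2
        simp only [e1, e2, if_true, if_false, true_and, false_or]
        split_ifs <;> omega
      · rw [if_neg (by omega)] at h2
        simp [e1, e2, e3]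
        omega

theorem exists_slideMap_eq (hle : F.mult j ≤ F.mult (TCD.next j η)) {v : ℕ × ℕ}
    (hv : v ∈ F.verts) (hv' : v ∉ F.slideSet j η) :
    ∃ w ∈ (F.unslide j η hadm).verts, F.slideMap j η w = v := by
  obtain ⟨k, a⟩ := v
  obtain ⟨h1, h2⟩ := hv
  dsimp only at h1 h2
  have hhj := TCD.next_ne hadm
  have hmj := TCD.mate_next_ne hadm
  have hmh := TCD.mate_ne hadm.2.1
  have hm := F.mult_mate (TCD.next j η)
  simp only [slideSet, Set.mem_ofPred_eq, mem_verts, h1, h2, true_and, not_or] at hv'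
  obtain ⟨e1, e3⟩ := hv'
  have key : ∀ l b, (if l = j then F.mate (TCD.next j η) else l) = k → 1 ≤ b →
      b + F.slideShift j η l = a →
      b ≤ F.mult l - (if l = TCD.next j η ∨ l = F.mate (TCD.next j η) then F.mult j else 0) →
      ∃ w ∈ (F.unslide j η hadm).verts, F.slideMap j η w = (k, a) := by
    intro l b q1 q2 q3 q4
    refine ⟨(siteMove j (F.target j η) l, b), ⟨q2, ?_⟩, ?_⟩
    · dsimp only; rw [unslide_mult]; exact q4
    · rw [slideMap_apply, q1, q3]
  by_cases e2 : k = F.mate (TCD.next j η)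
  · subst e2
    by_cases hδ : F.side (TCD.next j η) η = 1
    · by_cases ha : a ≤ F.mult (TCD.next j η) - F.mult j
      · refine key (F.mate (TCD.next j η)) a (by simp) h1 ?_ ?_
        · simp [slideShift, hmj, hδ]
        · rw [if_pos (Or.inr rfl), hm]; exact ha
      · refine key j (a - (F.mult (TCD.next j η) - F.mult j)) (by simp) (by omega) ?_ ?_
        · simp [slideShift, hδ]; omega
        · rw [if_neg (by omega)]; omega
    · by_cases ha : a ≤ F.mult j
      · refine key j a (by simp) h1 ?_ ?_
        · simp [slideShift, hδ]
        · rw [if_neg (by omega)]; exact ha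
      · refine key (F.mate (TCD.next j η)) (a - F.mult j) (by simp) (by omega) ?_ ?_
        · simp [slideShift, hmj, hδ]; omega
        · rw [if_pos (Or.inr rfl)]; omega
  · by_cases e4 : k = TCD.next j η
    · subst e4
      by_cases hη : η = 1
      · subst hη
        simp at e3
        refine key (TCD.next j 1) (a - F.mult j) (by simp [e1]) (by omega) ?_ ?_
        · simp [slideShift, hhj, hmh.symm]; omega
        · rw [if_pos (Or.inl rfl)]; omega
      · simp [hη] at e3
        refine key (TCD.next j η) a (by simp [e1]) h1 ?_ ?_
        · simp [slideShift, hhj, hmh.symm, hη]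
        · rw [if_pos (Or.inl rfl)]; omega
    · refine key k a (by simp [e1]) h1 ?_ ?_
      · simp [slideShift, e1, e2, e4]
      · rw [if_neg (by omega)]; omega

/-- Only two neighbouring sites are merged, the moved one and the far end of the band, and
`slideShift` stacks their vertices in the order of these sites. Elsewhere the order of the sites is
unchanged. -/
theorem slideMap_prec (hadm : F.Admissible j η) (hle : F.mult j ≤ F.mult (TCD.next j η))
    {u v : ℕ × ℕ} (hu : u ∈ (F.unslide j η hadm).verts)
    (hv : v ∈ (F.unslide j η hadm).verts) (h : (F.unslide j η hadm).prec u v) :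
    F.prec (F.slideMap j η u) (F.slideMap j η v) := by
  obtain ⟨k, a, rfl⟩ := exists_eq_siteMove j (F.target j η) u
  obtain ⟨l, b, rfl⟩ := exists_eq_siteMove j (F.target j η) v
  obtain ⟨h1, h2⟩ := hu
  obtain ⟨h3, h4⟩ := hv
  dsimp only at h1 h2 h3 h4
  rw [unslide_mult] at h2 h4
  have hhj := TCD.next_ne hadm
  have hmj := TCD.mate_next_ne hadm
  have hmh := TCD.mate_ne hadm.2.1
  have hm := F.mult_mate (TCD.next j η)
  have ht := TCD.isSite_target hadm
  have hms := TCD.isSite_mate hadm.2.1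
  have hjs := hadm.1
  have hteq := TCD.target_eq hadm
  have hmono : ∀ k l, k ≠ j → l ≠ j →
      (siteMove j (F.target j η) k < siteMove j (F.target j η) l ↔ k < l) := by
    intro k l hk hl
    simp only [siteMove_apply, hk, hl, if_false]
    split_ifs <;> omega
  have hτj : siteMove j (F.target j η) j = F.target j η := siteMove_self_left _ _
  have htop : ∀ k, siteMove j (F.target j η) k = 2 * F.rank + 1 ↔ k = 2 * F.rank + 1 := by
    intro k
    obtain ⟨_, _⟩ := ht
    obtain ⟨_, _⟩ := hjs
    simp only [siteMove_apply]
    split_ifs <;> omega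
  have hle' : ∀ k, siteMove j (F.target j η) k ≤ 2 * F.rank ↔ k ≤ 2 * F.rank := by
    intro k
    obtain ⟨_, _⟩ := ht
    obtain ⟨_, _⟩ := hjs
    simp only [siteMove_apply]
    split_ifs <;> omega
  have hinj : ∀ k l, siteMove j (F.target j η) k = siteMove j (F.target j η) l ↔ k = l :=
    fun k l => (siteMove j (F.target j η)).injective.eq_iff
  have hr : (F.unslide j η hadm).rank = F.rank := rfl
  simp only [prec, hr, htop, hle', hinj] at h
  rw [slideMap_apply, slideMap_apply]
  rcases h with h | ⟨rfl, h5, h6⟩ | ⟨rfl, h5, h6⟩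
  · have hδ := Int.units_eq_one_or (F.side (TCD.next j η) η)
    have m1 := hmono k (F.mate (TCD.next j η))
    have m2 := hmono (F.mate (TCD.next j η)) l
    have i1 := hinj k (F.mate (TCD.next j η))
    have i2 := hinj (F.mate (TCD.next j η)) l
    by_cases hk : k = j
    · have hl : l ≠ j := by rintro rfl; rw [hk] at h; exact lt_irrefl _ h
      rw [hk, if_neg (by omega)] at h2
      rw [hk, hτj] at h
      rw [if_pos hk, if_neg hl]
      by_cases hl2 : l = F.mate (TCD.next j η)
      · rw [hl2] at h ⊢
        rcases hδ with hδ | hδ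
        · rw [hδ] at hteq; simp at hteq; omega
        · right; left
          simp only [slideShift, hδ, hk, hmj, if_true, if_false, true_and,
            if_neg (show ¬ (-1 : ℤˣ) = 1 by decide)]
          exact ⟨hms.2, by omega⟩
      · left
        dsimp only
        rcases hδ with hδ | hδ <;> rw [hδ] at hteq <;> simp at hteq <;> omega
    · by_cases hl : l = j
      · rw [hl, hτj] at h
        rw [if_neg hk, if_pos hl]
        by_cases hk2 : k = F.mate (TCD.next j η)
        · rw [hk2] at h h2 ⊢
          rw [if_pos (Or.inr rfl)] at h2
          rcases hδ with hδ | hδ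
          · right; left
            simp only [slideShift, hδ, hl, hmj, if_true, if_false, true_and]
            exact ⟨hms.2, by omega⟩
          · rw [hδ] at hteq; simp at hteq; omega
        · left
          dsimp only
          rcases hδ with hδ | hδ <;> rw [hδ] at hteq <;> simp at hteq <;> omega
      · rw [if_neg hk, if_neg hl]
        exact Or.inl ((hmono k l hk hl).1 h)
  · right; left
    refine ⟨rfl, ?_, by dsimp only; omega⟩
    dsimp only
    split_ifs
    · exact hms.2
    · exact h5
  · right; right
    have := hjs.2
    refine ⟨rfl, ?_, by dsimp only; omega⟩
    dsimp only
    rw [if_neg (by omega)]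
    exact h5

end Frame

namespace Frame

variable {F : Frame} {j : ℕ} {η : ℤˣ}

theorem unslide_iota (hadm : F.Admissible j η) (k a : ℕ) :
    (F.unslide j η hadm).iota (siteMove j (F.target j η) k, a) =
      (siteMove j (F.target j η) (F.mate k),
        if (F.twist k + if k = j ∨ k = F.mate j then F.twist (TCD.next j η) else 0) = 0 then
          F.mult k - (if k = TCD.next j η ∨ k = F.mate (TCD.next j η) then F.mult j else 0) + 1 - a
        else a) := by
  have h1 : (F.unslide j η hadm).mate (siteMove j (F.target j η) k) =
    siteMove j (F.target j η) (F.mate k) := TCD.slide_mate hadm k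
  have h2 : (F.unslide j η hadm).twist (siteMove j (F.target j η) k) = _ := TCD.slide_twist hadm k
  simp only [iota, h1, h2, unslide_mult]

/-- The case with content is the band slid over: its old strands are shifted at both ends, and the
shifts agree under the involution for either value of the twist. -/
theorem slideMap_iota (hadm : F.Admissible j η) (hle : F.mult j ≤ F.mult (TCD.next j η))
    {k a : ℕ} (hv : (siteMove j (F.target j η) k, a) ∈ (F.unslide j η hadm).verts) (hkj : k ≠ j)
    (hkm : k ≠ F.mate j) :
    F.slideMap j η ((F.unslide j η hadm).iota (siteMove j (F.target j η) k, a)) =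
      F.iota (F.slideMap j η (siteMove j (F.target j η) k, a)) := by
  obtain ⟨h1, h2⟩ := hv
  dsimp only at h1 h2
  rw [unslide_mult] at h2
  have hhj := TCD.next_ne hadm
  have hmj := TCD.mate_next_ne hadm
  have hmh := TCD.mate_ne hadm.2.1
  have hm := F.mult_mate (TCD.next j η)
  have htm := F.twist_mate (TCD.next j η)
  have hmkj : F.mate k ≠ j := fun e => hkm (by rw [← e, F.mate_mate])
  rw [unslide_iota, slideMap_apply, slideMap_apply, if_neg hkj, if_neg hmkj,
    if_neg (by omega : ¬ (k = j ∨ k = F.mate j)), add_zero]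
  simp only [iota]
  by_cases e1 : k = TCD.next j η
  · subst e1
    rw [if_pos (Or.inl rfl)] at h2 ⊢
    by_cases ht : F.twist (TCD.next j η) = 0 <;> rcases Int.units_eq_one_or η with rfl | rfl <;>
      simp [slideShift, TCD.side, hhj, hmj, hmh.symm, ht] <;> omega
  · by_cases e2 : k = F.mate (TCD.next j η)
    · subst e2
      rw [if_pos (Or.inr rfl)] at h2 ⊢
      rw [F.mate_mate, htm, hm]
      rw [hm] at h2
      by_cases ht : F.twist (TCD.next j η) = 0 <;> rcases Int.units_eq_one_or η with rfl | rfl <;>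
        simp [slideShift, TCD.side, hhj, hmj, hmh.symm, ht] <;> omega
    · have e3 : F.mate k ≠ TCD.next j η := fun e => e2 (by rw [← e, F.mate_mate])
      have e4 : F.mate k ≠ F.mate (TCD.next j η) := fun e => e1 (TCD.mate_inj e)
      simp [slideShift, hkj, hmkj, e1, e2, e3, e4]

/-- The four vertices of the path that replaces a strand at the slid site. -/
theorem slideMap_path (hadm : F.Admissible j η) (hle : F.mult j ≤ F.mult (TCD.next j η)) {a : ℕ}
    (ha : 1 ≤ a) (ha' : a ≤ F.mult j) : ∃ c, 1 ≤ c ∧ c ≤ F.mult j ∧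
      (F.unslide j η hadm).iota (F.target j η, a) = (siteMove j (F.target j η) (F.mate j),
        if F.twist j = 0 then F.mult j + 1 - c else c) ∧
      F.slideMap j η ((F.unslide j η hadm).iota (F.target j η, a)) = F.iota (j, c) ∧
      F.iota (F.slideMap j η (F.target j η, a)) = (TCD.next j η,
        (if η = 1 then F.mult j else F.mult (TCD.next j η)) + 1 - c) ∧
      (F.slideMap j η (F.target j η, a)).1 = F.mate (TCD.next j η) := by
  have hhj := TCD.next_ne hadm
  have hmj := TCD.mate_next_ne hadm
  have hmh := TCD.mate_ne hadm.2.1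
  have hm := F.mult_mate (TCD.next j η)
  have htm := F.twist_mate (TCD.next j η)
  have hpj := TCD.mate_ne hadm.1
  have hph : F.mate j ≠ TCD.next j η := hadm.2.2
  have hpm : F.mate j ≠ F.mate (TCD.next j η) := fun e => hhj (TCD.mate_inj e).symm
  have hτj : siteMove j (F.target j η) j = F.target j η := siteMove_self_left _ _
  have key : ∀ x y : ZMod 2, (x + y = 0 ↔ (x = 0 ↔ y = 0)) := by decide
  -- The parallel edges between `j` and the band end reverse the order of the strands, and so does
  -- the band if it is untwisted. The two reversals cancel exactly when the twist is zero.
  refine ⟨if F.twist (TCD.next j η) = 0 then a else F.mult j + 1 - a, ?_, ?_, ?_, ?_, ?_, ?_⟩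
  · split_ifs <;> omega
  · split_ifs <;> omega
  · rw [← hτj, unslide_iota, hτj]
    by_cases ht : F.twist (TCD.next j η) = 0 <;> by_cases ht' : F.twist j = 0 <;>
      simp [ht, ht', key, hhj.symm, hmj.symm]; omega
  · rw [← hτj, unslide_iota, slideMap_apply]
    by_cases ht : F.twist (TCD.next j η) = 0 <;> by_cases ht' : F.twist j = 0 <;>
      simp [ht, ht', key, hhj.symm, hmj.symm, hpj, iota, slideShift, hph, hpm]; omega
  · rw [← hτj, slideMap_apply]
    by_cases ht : F.twist (TCD.next j η) = 0 <;> rcases Int.units_eq_one_or η with rfl | rfl <;>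
      simp [slideShift, TCD.side, ht, iota, hm, htm, F.mate_mate] <;> omega
  · rw [← hτj, slideMap_apply, if_pos rfl]

end Frame

/-! ### Undoing a handle slide: data -/

namespace SWB

variable {Θ : SWB} {j : ℕ} {η : ℤˣ}

/-- The slide set is the union of the parallel edges, each of which has one end at `j` and one at
the adjacent band end. -/
theorem slideSet_pair (hadm : Θ.Admissible j η) (hle : Θ.mult j ≤ Θ.mult (TCD.next j η))
    (hp : ∀ a, 1 ≤ a → a ≤ Θ.mult j → Θ.pair (j, a) = (TCD.next j η,
      (if η = 1 then Θ.mult j else Θ.mult (TCD.next j η)) + 1 - a))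
    {v : ℕ × ℕ} (hv : v ∈ Θ.slideSet j η) :
    Θ.pair v ∈ Θ.slideSet j η ∧ (v.1 = j ∨ (Θ.pair v).1 = j) := by
  have hjm : ∀ a, 1 ≤ a → a ≤ Θ.mult j → (j, a) ∈ Θ.slideSet j η := fun a h1 h2 =>
    ⟨⟨h1, h2⟩, Or.inl rfl⟩
  obtain ⟨k, a⟩ := v
  obtain ⟨⟨h1, h2⟩, h3⟩ := hv
  dsimp only at h1 h2 h3
  rcases h3 with rfl | ⟨rfl, h3⟩
  · rw [hp a h1 h2]
    refine ⟨⟨?_, Or.inr ⟨rfl, ?_⟩⟩, Or.inl rfl⟩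
    · simp only [Frame.mem_verts]
      split_ifs <;> omega
    · dsimp only
      split_ifs <;> omega
  · have h4 := hp ((if η = 1 then Θ.mult j else Θ.mult (TCD.next j η)) + 1 - a)
      (by split_ifs at h3 ⊢ <;> omega) (by split_ifs at h3 ⊢ <;> omega)
    rw [show (if η = 1 then Θ.mult j else Θ.mult (TCD.next j η)) + 1 -
      ((if η = 1 then Θ.mult j else Θ.mult (TCD.next j η)) + 1 - a) = a by
        split_ifs at h3 ⊢ <;> omega] at h4
    rw [← h4, Θ.pair_pair]
    exact ⟨hjm _ (by split_ifs at h3 ⊢ <;> omega) (by split_ifs at h3 ⊢ <;> omega), Or.inr rfl⟩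

/-- The slide back adds the same twist a second time, which cancels in `ZMod 2`, and restores the
strands that `unslide` has taken off the band; the latter needs `hle`. -/
theorem isSlideFrame_unslide (F : Frame) (hadm : F.Admissible j η)
    (hle : F.mult j ≤ F.mult (TCD.next j η)) :
    IsSlideFrame (F.unslide j η hadm) (F.target j η) (-F.side (TCD.next j η) η)
      (siteMove (F.target j η) j) F := by
  have hhj := TCD.next_ne hadm
  have hmj := TCD.mate_next_ne hadm
  have hτj : siteMove j (F.target j η) j = F.target j η := siteMove_self_left _ _
  have hn : TCD.next (F.target j η) (-F.side (TCD.next j η) η) = _ := TCD.next_target hadm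
  have hmate : ∀ k, (F.unslide j η hadm).mate (siteMove j (F.target j η) k) =
    siteMove j (F.target j η) (F.mate k) := TCD.slide_mate hadm
  have htw : ∀ k, (F.unslide j η hadm).twist (siteMove j (F.target j η) k) = F.twist k + _ :=
    TCD.slide_twist hadm
  have hinj : ∀ k l, siteMove j (F.target j η) k = siteMove j (F.target j η) l ↔ k = l :=
    fun k l => (siteMove j (F.target j η)).injective.eq_iff
  have hht : (F.unslide j η hadm).twist (siteMove j (F.target j η) (F.mate (TCD.next j η))) =
      F.twist (TCD.next j η) := by
    rw [htw, F.twist_mate, if_neg, add_zero]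
    rintro (e | e)
    · exact hmj e
    · exact hhj (TCD.mate_inj e)
  have hmm : (F.unslide j η hadm).mult (F.target j η) = F.mult j := by
    conv_lhs => rw [← hτj]
    rw [Frame.unslide_mult, if_neg (by omega), Nat.sub_zero]
  have key : ∀ x y : ZMod 2, x = x + y + y := by decide
  refine ⟨rfl, fun k => ?_, fun k => ?_, fun k => ?_⟩
  · obtain ⟨k, rfl⟩ := (siteMove j (F.target j η)).surjective k
    rw [hmate, siteMove_siteMove, siteMove_siteMove]
  · obtain ⟨k, rfl⟩ := (siteMove j (F.target j η)).surjective k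
    have hmt : (F.unslide j η hadm).mate (F.target j η) = siteMove j (F.target j η) (F.mate j) := by
      rw [← hmate, hτj]
    have e1 : siteMove j (F.target j η) k = F.target j η ↔ k = j := by
      rw [← hinj k j, hτj]
    rw [siteMove_siteMove, hn, hht, htw, hmt]
    simp only [e1, hinj]
    split_ifs
    · exact key _ _
    · simp
  · obtain ⟨k, rfl⟩ := (siteMove j (F.target j η)).surjective k
    rw [siteMove_siteMove, hn, hmate, F.mate_mate, hmm, Frame.unslide_mult]
    simp only [hinj]
    by_cases e1 : k = TCD.next j η
    · rw [if_pos (Or.inl e1), if_pos (Or.inr e1), e1]; omega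
    · by_cases e2 : k = F.mate (TCD.next j η)
      · rw [if_pos (Or.inr e2), if_pos (Or.inl e2), e2, F.mult_mate]; omega
      · rw [if_neg (by tauto), if_neg (by tauto)]; omega

theorem isSlideSet_unslide (F : Frame) (hadm : F.Admissible j η)
    (hle : F.mult j ≤ F.mult (TCD.next j η)) :
    IsSlideSet (F.unslide j η hadm) (F.target j η) (-F.side (TCD.next j η) η)
      (siteMove (F.target j η) j) F (F.slideSet j η) := by
  have hhj := TCD.next_ne hadm
  have hn : TCD.next (F.target j η) (-F.side (TCD.next j η) η) = _ := TCD.next_target hadm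
  have hmate : ∀ k, (F.unslide j η hadm).mate (siteMove j (F.target j η) k) =
    siteMove j (F.target j η) (F.mate k) := TCD.slide_mate hadm
  have hτj : siteMove j (F.target j η) j = F.target j η := siteMove_self_left _ _
  have hmm : (F.unslide j η hadm).mult (F.target j η) = F.mult j := by
    conv_lhs => rw [← hτj]
    have hmj := TCD.mate_next_ne hadm
    rw [Frame.unslide_mult, if_neg (by omega), Nat.sub_zero]
  -- The set consists of `F.mult j` vertices at each of two sites, which gives the cardinality `2
  -- f(p)`.
  have hU : F.slideSet j η = ↑(({j} : Finset ℕ) ×ˢ Finset.Icc 1 (F.mult j) ∪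
      ({TCD.next j η} : Finset ℕ) ×ˢ (if η = 1 then Finset.Icc 1 (F.mult j) else
        Finset.Ioc (F.mult (TCD.next j η) - F.mult j) (F.mult (TCD.next j η)))) := by
    ext ⟨k, a⟩
    simp only [Frame.slideSet, Frame.mem_verts, Set.mem_ofPred_eq, Finset.coe_union, Set.mem_union,
      Finset.mem_coe, Finset.mem_product, Finset.mem_singleton, Finset.mem_Icc]
    constructor
    · rintro ⟨⟨h1, h2⟩, rfl | ⟨rfl, h3⟩⟩
      · exact Or.inl ⟨rfl, h1, h2⟩
      · refine Or.inr ⟨rfl, ?_⟩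
        split_ifs at h3 ⊢
        · exact Finset.mem_Icc.2 ⟨h1, h3⟩
        · exact Finset.mem_Ioc.2 ⟨h3, h2⟩
    · rintro (⟨rfl, h1, h2⟩ | ⟨rfl, h3⟩)
      · exact ⟨⟨h1, h2⟩, Or.inl rfl⟩
      · split_ifs at h3 ⊢
        · rw [Finset.mem_Icc] at h3
          exact ⟨⟨h3.1, by omega⟩, Or.inr ⟨rfl, h3.2⟩⟩
        · rw [Finset.mem_Ioc] at h3
          exact ⟨⟨by omega, h3.2⟩, Or.inr ⟨rfl, h3.1⟩⟩
  have hjn : TCD.next j η = if η = 1 then j + 1 else j - 1 := by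
    rcases Int.units_eq_one_or η with e | e <;> rw [e]
    · rw [TCD.next_one]; rfl
    · rw [TCD.next_neg_one]; rfl
  have hs1 := hadm.1.2
  have hs2 := hadm.2.1.2
  have hs3 := hadm.1.1
  refine ⟨by rw [hU]; exact Finset.finite_toSet _, ?_, fun v hv => hv.1, ?_, ?_, ?_⟩
  · rw [hU, Set.ncard_coe_finset, Finset.card_union_of_disjoint, Finset.card_product,
      Finset.card_product, hmm]
    · split_ifs <;> simp <;> omega
    · rw [Finset.disjoint_left]
      rintro ⟨k, a⟩ h1 h2
      simp only [Finset.mem_product, Finset.mem_singleton] at h1 h2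
      exact hhj (h2.1.symm.trans h1.1)
  · rintro ⟨k, a⟩ ⟨⟨h1, h2⟩, h3⟩ ⟨l, b⟩ ⟨⟨h4, h5⟩, h6⟩ ⟨m, c⟩ hv h7 h8
    refine ⟨hv, ?_⟩
    obtain ⟨h9, h10⟩ := hv
    simp only [Frame.prec] at *
    have c1 : k = j → F.mult k = F.mult j := congrArg _
    have c2 : l = j → F.mult l = F.mult j := congrArg _
    have c3 : m = j → F.mult m = F.mult j := congrArg _
    have c4 : m = TCD.next j η → F.mult m = F.mult (TCD.next j η) := congrArg _
    split_ifs at * <;> omega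
  · intro v hv e
    rw [siteMove_self_left] at e
    exact ⟨hv, Or.inl e⟩
  · rintro v ⟨-, h | ⟨h, -⟩⟩
    · left; rw [siteMove_self_left, h]
    · right; rw [hn, hmate, F.mate_mate, siteMove_siteMove, h]

/-- If the strands at `j` run parallel to the end of the adjacent band, then the datum is the result
of a handle slide. -/
theorem exists_unslide (Θ : SWB) (hadm : Θ.Admissible j η)
    (hle : Θ.mult j ≤ Θ.mult (TCD.next j η))
    (hp : ∀ a, 1 ≤ a → a ≤ Θ.mult j → Θ.pair (j, a) = (TCD.next j η,
      (if η = 1 then Θ.mult j else Θ.mult (TCD.next j η)) + 1 - a)) :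
    ∃ Θ' : SWB, Θ'.toFrame = Θ.unslide j η hadm ∧
      IsHandleSlide Θ' (Θ.target j η) (-Θ.side (TCD.next j η) η) Θ := by
  have hτj : siteMove j (Θ.target j η) j = Θ.target j η := siteMove_self_left _ _
  have hmem := fun v hv => Frame.slideMap_mem (v := v) hadm hle hv
  have hsurj := fun v hv hv' => Frame.exists_slideMap_eq (v := v) hadm hle hv hv'
  have hmo := fun u hu v hv h => Frame.slideMap_prec (u := u) (v := v) hadm hle hu hv h
  have hUp := fun v hv => (slideSet_pair (v := v) hadm hle hp hv).1
  have hUp' : ∀ v, v ∈ Θ.slideSet j η ↔ Θ.pair v ∈ Θ.slideSet j η := fun v =>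
    ⟨hUp v, fun h => by have := hUp _ h; rwa [Θ.pair_pair] at this⟩
  have hpath := fun a h1 h2 => Frame.slideMap_path (a := a) hadm hle h1 h2
  -- The parallel edges form a union of parts of the pairing, so the pairing restricts to the
  -- vertices outside the slide set.
  obtain ⟨Θ', hF, hpair⟩ := exists_transport Θ (Θ.unslide j η hadm) (Θ.slideMap j η)
    (fun v hv => (hmem v hv).1) hmo (fun v hv => hsurj _ (pair_mem (hmem v hv).1)
      (mt (hUp' _).2 (hmem v hv).2))
  refine ⟨Θ', hF, Or.inl ⟨?_, siteMove (Θ.target j η) j, Θ.slideSet j η, Θ.slideMap j η, ?_, ?_, ?_,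
    ?_, ?_⟩⟩
  · rw [hF]; exact TCD.slide_admissible hadm
  · rw [hF]; exact TCD.slide_isSlidePerm hadm
  · rw [hF]; exact isSlideFrame_unslide _ hadm hle
  · rw [hF]; exact isSlideSet_unslide _ hadm hle
  · rw [hF]
    refine ⟨⟨fun v hv => hmem v hv, ?_, fun v hv => ?_⟩, fun u hu v hv h => hmo u hu v hv h⟩
    · intro u hu v hv e
      rcases Frame.prec_trichotomy hu hv with h | h | h
      · exact absurd (e ▸ hmo u hu v hv h) (Frame.prec_irrefl _)
      · exact h
      · exact absurd (e ▸ hmo v hv u hu h) (Frame.prec_irrefl _)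
    · obtain ⟨w, hw, e⟩ := hsurj v hv.1 hv.2
      exact ⟨w, hw, e⟩
  have hjs := hadm.1
  have hms := TCD.isSite_mate hadm.2.1
  have hhj := TCD.next_ne hadm
  have hmj := TCD.mate_next_ne hadm
  have hverts : Θ'.verts = (Θ.unslide j η hadm).verts := by rw [hF]
  have hiota : Θ'.iota = (Θ.unslide j η hadm).iota := by rw [hF]
  have hmate : ∀ k, Θ'.mate (siteMove j (Θ.target j η) k) =
      siteMove j (Θ.target j η) (Θ.mate k) := by rw [hF]; exact TCD.slide_mate hadm
  have hsite : ∀ k, Θ'.IsSite (siteMove j (Θ.target j η) k) ↔ Θ.IsSite k := by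
    rw [hF]; exact TCD.slide_isSite hadm
  have hmult : Θ'.mult (Θ.target j η) = Θ.mult j := by
    rw [hF]
    conv_lhs => rw [← hτj]
    rw [Frame.unslide_mult, if_neg (by omega), Nat.sub_zero]
  rw [← hverts] at hmem hsurj hpair
  rw [← hiota] at hpath
  have hinj : ∀ u ∈ Θ'.verts, ∀ v ∈ Θ'.verts, Θ.slideMap j η u = Θ.slideMap j η v → u = v := by
    rw [hverts]
    intro u hu v hv e
    rcases Frame.prec_trichotomy hu hv with h | h | h
    · exact absurd (e ▸ hmo u hu v hv h) (Frame.prec_irrefl _)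
    · exact h
    · exact absurd (e ▸ hmo v hv u hu h) (Frame.prec_irrefl _)
  have htv : ∀ a, (Θ.target j η, a) ∈ Θ'.verts ↔ 1 ≤ a ∧ a ≤ Θ.mult j := by
    intro a; rw [Frame.mem_verts]; simp only [hmult]
  have hti : ∀ a, (Θ.target j η, a) ∈ Θ'.verts → (Θ.target j η, a) ∈ Θ'.intVerts := fun a ha =>
    ⟨ha, by show Θ'.IsSite _; rw [← hτj, hsite]; exact hjs⟩
  -- the path through the vertex `(j, c)`
  have hpj : ∀ c, 1 ≤ c → c ≤ Θ.mult j → ∃ u ∈ Θ'.verts, u.1 = Θ.target j η ∧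
      Θ.slideMap j η (Θ'.iota u) = Θ.iota (j, c) ∧
      Θ.iota (Θ.slideMap j η u) = Θ.pair (j, c) ∧
      (Θ.slideMap j η u).1 = Θ.mate (TCD.next j η) := by
    intro c h1 h2
    let z : ℕ × ℕ := (siteMove j (Θ.target j η) (Θ.mate j), if Θ.twist j = 0 then Θ.mult j + 1 - c else c)
    have hz : z ∈ Θ'.intVerts := by
      have hph : Θ.mate j ≠ TCD.next j η := hadm.2.2
      have hpm : Θ.mate j ≠ Θ.mate (TCD.next j η) := fun e => hhj (TCD.mate_inj e).symm
      refine ⟨⟨?_, ?_⟩, ?_⟩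
      · dsimp only [z]; split_ifs <;> omega
      · have hm : Θ'.mult (siteMove j (Θ.target j η) (Θ.mate j)) = Θ.mult j := by
          have hc : ¬ (Θ.mate j = TCD.next j η ∨ Θ.mate j = Θ.mate (TCD.next j η)) :=
            fun h => h.elim hph hpm
          rw [hF, Frame.unslide_mult, if_neg hc, Nat.sub_zero, Θ.mult_mate]
        show (if Θ.twist j = 0 then _ else _) ≤ Θ'.mult (siteMove j (Θ.target j η) (Θ.mate j))
        rw [hm]
        split_ifs <;> omega
      · rw [hsite]; exact TCD.isSite_mate hjs
    have hz1 : (Θ'.iota z).1 = Θ.target j η := by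
      show Θ'.mate _ = _
      rw [hmate, Θ.mate_mate, hτj]
    have hzz := Frame.iota_iota hz.1
    have hzm := (Frame.iota_mem hz).1
    obtain ⟨a, ha⟩ : ∃ a, Θ'.iota z = (Θ.target j η, a) := ⟨_, Prod.ext hz1 rfl⟩
    rw [ha] at hzz hzm
    obtain ⟨c', h3, h4, h5, h6, h7, h8⟩ := hpath a ((htv a).1 hzm).1 ((htv a).1 hzm).2
    have hcc : c' = c := by
      rw [hzz] at h5
      have := congrArg Prod.snd h5
      dsimp only [z] at this
      split_ifs at this <;> omega
    subst hcc
    exact ⟨_, hzm, rfl, h6, by rw [h7, hp _ h3 h4], h8⟩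
  have hpt : ∀ u ∈ Θ'.verts, u.1 = Θ.target j η → ∃ c, 1 ≤ c ∧ c ≤ Θ.mult j ∧
      Θ.slideMap j η (Θ'.iota u) = Θ.iota (j, c) ∧
      Θ.iota (Θ.slideMap j η u) = Θ.pair (j, c) ∧
      (Θ.slideMap j η u).1 = Θ.mate (TCD.next j η) := by
    rintro ⟨k, a⟩ hu rfl
    have := (htv a).1 hu
    obtain ⟨c', h3, h4, h5, h6, h7, h8⟩ := hpath a this.1 this.2
    exact ⟨c', h3, h4, h6, by rw [h7, hp _ h3 h4], h8⟩
  have hjv : ∀ c, 1 ≤ c → c ≤ Θ.mult j → (j, c) ∈ Θ.intVerts := fun c h1 h2 => ⟨⟨h1, h2⟩, hjs⟩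
  -- Strands outside the slid band `p` are carried along unchanged.
  have hold : ∀ u ∈ Θ'.intVerts, u.1 ≠ Θ.target j η → (Θ'.iota u).1 ≠ Θ.target j η →
      Θ.slideMap j η (Θ'.iota u) = Θ.iota (Θ.slideMap j η u) ∧
      Θ.slideMap j η u ∈ Θ.intVerts := by
    intro u hu h1 h2
    obtain ⟨k, a, rfl⟩ := Frame.exists_eq_siteMove j (Θ.target j η) u
    have hkj : k ≠ j := by rintro rfl; exact h1 hτj
    have hkm : k ≠ Θ.mate j := by
      rintro rfl
      apply h2
      show Θ'.mate _ = _
      rw [hmate, Θ.mate_mate, hτj]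
    refine ⟨?_, (hmem _ hu.1).1, ?_⟩
    · rw [hiota]
      exact Frame.slideMap_iota hadm hle (hverts ▸ hu.1) hkj hkm
    · rw [Frame.slideMap_apply, if_neg hkj]
      exact (hsite k).1 hu.2
  have hint : ∀ u ∈ Θ'.verts, Θ.slideMap j η u ∈ Θ.intVerts → u ∈ Θ'.intVerts := by
    intro u hu h
    obtain ⟨k, a, rfl⟩ := Frame.exists_eq_siteMove j (Θ.target j η) u
    refine ⟨hu, (hsite k).2 ?_⟩
    by_cases hkj : k = j
    · rw [hkj]; exact hjs
    · have := h.2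
      rwa [Frame.slideMap_apply, if_neg hkj] at this
  have hUj : ∀ p, p ∈ Θ.slideSet j η → p.1 ≠ j → ∃ c, 1 ≤ c ∧ c ≤ Θ.mult j ∧ p = Θ.pair (j, c) := by
    intro p hp1 hp2
    obtain ⟨h1, h2 | h2⟩ := slideSet_pair hadm hle hp hp1
    · exact absurd h2 hp2
    · obtain ⟨⟨h3, h4⟩, -⟩ := h1
      rw [h2] at h4
      refine ⟨(Θ.pair p).2, h3, h4, ?_⟩
      rw [← h2, Θ.pair_pair]
  have hj1 : ∀ p ∈ Θ.verts, p.1 = j → ∃ c, 1 ≤ c ∧ c ≤ Θ.mult j ∧ p = (j, c) := by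
    rintro ⟨k, c⟩ ⟨h1, h2⟩ rfl
    exact ⟨c, h1, h2, rfl⟩
  ext p q
  rw [slideGraph, SimpleGraph.fromRel_adj]
  constructor
  · intro hpq
    refine ⟨hpq.ne, ?_⟩
    rcases curveGraph_adj.1 hpq with ⟨hpv, rfl⟩ | ⟨hpv, rfl⟩
    · by_cases hU : p ∈ Θ.slideSet j η
      · by_cases hpj' : p.1 = j
        · obtain ⟨c, h1, h2, rfl⟩ := hj1 p hpv hpj'
          obtain ⟨u, g1, g2, g3, g4, g5⟩ := hpj c h1 h2
          refine Or.inr (Or.inr ⟨u, g1, g2, Or.inr (Or.inl ⟨g4.symm, ?_⟩)⟩)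
          rw [g3, Frame.iota_iota hpv]
        · obtain ⟨c, h1, h2, rfl⟩ := hUj p hU hpj'
          obtain ⟨u, g1, g2, g3, g4, g5⟩ := hpj c h1 h2
          refine Or.inl (Or.inr ⟨u, g1, g2, Or.inr (Or.inl ⟨g4.symm, ?_⟩)⟩)
          rw [g3, Frame.iota_iota (hjv c h1 h2).1, Θ.pair_pair]
      · obtain ⟨u, hu, rfl⟩ := hsurj p hpv hU
        refine Or.inl (Or.inl ⟨u, Θ'.pair u, curveGraph_adj.2 (Or.inl ⟨hu, rfl⟩), ?_, rfl,
          (hpair u hu).symm⟩)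
        -- An edge of the pairing is never among the removed ones, which are required not to belong
        -- to `E`.
        rintro ⟨w, hw, -, hne, e⟩
        rcases Sym2.eq_iff.1 e with ⟨rfl, e⟩ | ⟨e, e'⟩
        · exact hne e
        · exact hne (by rw [← e, ← e', Θ'.pair_pair])
    · by_cases hpj' : p.1 = j
      · obtain ⟨c, h1, h2, rfl⟩ := hj1 p hpv.1 hpj'
        obtain ⟨u, g1, g2, g3, g4, g5⟩ := hpj c h1 h2
        refine Or.inl (Or.inr ⟨u, g1, g2, Or.inr (Or.inr ⟨?_, g3.symm⟩)⟩)
        rw [g3, Frame.iota_iota hpv.1]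
      by_cases hqj : (Θ.iota p).1 = j
      · obtain ⟨c, h1, h2, h3⟩ := hj1 _ (Frame.iota_mem hpv).1 hqj
        obtain ⟨u, g1, g2, g3, g4, g5⟩ := hpj c h1 h2
        have h4 : p = Θ.iota (j, c) := by rw [← h3, Frame.iota_iota hpv.1]
        refine Or.inr (Or.inr ⟨u, g1, g2, Or.inr (Or.inr ⟨?_, h4.trans g3.symm⟩)⟩)
        rw [g3, ← h4]
      by_cases hU : p ∈ Θ.slideSet j η
      · obtain ⟨c, h1, h2, rfl⟩ := hUj p hU hpj'
        obtain ⟨u, g1, g2, g3, g4, g5⟩ := hpj c h1 h2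
        refine Or.inr (Or.inr ⟨u, g1, g2, Or.inl ⟨?_, g4.symm⟩⟩)
        rw [← g4, Frame.iota_iota (hmem u g1).1]
      by_cases hU' : Θ.iota p ∈ Θ.slideSet j η
      · obtain ⟨c, h1, h2, h3⟩ := hUj _ hU' hqj
        obtain ⟨u, g1, g2, g3, g4, g5⟩ := hpj c h1 h2
        refine Or.inl (Or.inr ⟨u, g1, g2, Or.inl ⟨?_, h3.trans g4.symm⟩⟩)
        rw [← Frame.iota_iota (hmem u g1).1, g4, ← h3, Frame.iota_iota hpv.1]
      obtain ⟨u, hu, rfl⟩ := hsurj p hpv.1 hU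
      have hui := hint u hu hpv
      -- If `u` were at the moved site, `ι p` would be an end of a parallel edge; if its partner
      -- were there, `ι p` would lie on the site `j`. Both cases have been treated.
      have n1 : u.1 ≠ Θ.target j η := by
        intro e
        obtain ⟨c, h1, h2, g3, g4, g5⟩ := hpt u hu e
        rw [g4] at hU'
        exact hU' (hUp _ ⟨(hjv c h1 h2).1, Or.inl rfl⟩)
      have n2 : (Θ'.iota u).1 ≠ Θ.target j η := by
        intro e
        obtain ⟨c, h1, h2, g3, g4, g5⟩ := hpt _ (Frame.iota_mem hui).1 e
        rw [Frame.iota_iota hu] at g3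
        rw [g3, Frame.iota_iota (hjv c h1 h2).1] at hqj
        exact hqj rfl
      refine Or.inl (Or.inl ⟨u, Θ'.iota u, curveGraph_adj.2 (Or.inr ⟨hui, rfl⟩), ?_, rfl,
        (hold u hui n1 n2).1.symm⟩)
      rintro ⟨w, hw, hw1, hne, e⟩
      rcases Sym2.eq_iff.1 e with ⟨rfl, e⟩ | ⟨e, e'⟩
      · exact n1 hw1
      · exact n2 (by rw [e', hw1])
  · rintro ⟨hne, hpq⟩
    have key : ∀ p q : ℕ × ℕ, ((∃ u v, Θ'.curveGraph.Adj u v ∧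
      (¬ ∃ w ∈ Θ'.verts, w.1 = Θ.target j η ∧ Θ'.pair w ≠ Θ'.iota w ∧ s(u, v) = s(w, Θ'.iota w)) ∧
      p = Θ.slideMap j η u ∧ q = Θ.slideMap j η v) ∨
    (∃ u ∈ Θ'.verts, u.1 = Θ.target j η ∧
      ((p = Θ.slideMap j η u ∧ q = Θ.iota (Θ.slideMap j η u)) ∨
        (p = Θ.iota (Θ.slideMap j η u) ∧ q = Θ.iota (Θ.slideMap j η (Θ'.iota u))) ∨
        (p = Θ.iota (Θ.slideMap j η (Θ'.iota u)) ∧ q = Θ.slideMap j η (Θ'.iota u))))) →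
        Θ.curveGraph.Adj p q := by
      rintro p q (⟨u, v, huv, hn, rfl, rfl⟩ | ⟨u, hu, hut, h⟩)
      · have hpp : ∀ u ∈ Θ'.verts, Θ.curveGraph.Adj (Θ.slideMap j η u)
            (Θ.slideMap j η (Θ'.pair u)) := fun u hu =>
          curveGraph_adj.2 (Or.inl ⟨(hmem u hu).1, (hpair u hu).symm⟩)
        rcases curveGraph_adj.1 huv with ⟨hu, rfl⟩ | ⟨hu, rfl⟩
        · exact hpp u hu
        · by_cases n1 : u.1 = Θ.target j η
          -- A strand of the slid band survives as an edge only if it coincides with an edge of the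
          -- pairing, and then it is carried over as such.
          · by_cases e : Θ'.pair u = Θ'.iota u
            · rw [← e]; exact hpp u hu.1
            · exact absurd ⟨u, hu.1, n1, e, rfl⟩ hn
          by_cases n2 : (Θ'.iota u).1 = Θ.target j η
          · by_cases e : Θ'.pair (Θ'.iota u) = Θ'.iota (Θ'.iota u)
            · have := hpp _ (Frame.iota_mem hu).1
              rw [e, Frame.iota_iota hu.1] at this
              exact this.symm
            · exact absurd ⟨Θ'.iota u, (Frame.iota_mem hu).1, n2, e, by
                rw [Frame.iota_iota hu.1, Sym2.eq_swap]⟩ hn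
          · obtain ⟨h1, h2⟩ := hold u hu n1 n2
            exact curveGraph_adj.2 (Or.inr ⟨h2, h1.symm⟩)
      · obtain ⟨c, h1, h2, g3, g4, g5⟩ := hpt u hu hut
        have hou : Θ.slideMap j η u ∈ Θ.intVerts := ⟨(hmem u hu).1, by rw [g5]; exact hms⟩
        rcases h with ⟨rfl, rfl⟩ | ⟨rfl, rfl⟩ | ⟨rfl, rfl⟩
        · exact curveGraph_adj.2 (Or.inr ⟨hou, rfl⟩)
        · rw [g4, g3, Frame.iota_iota (hjv c h1 h2).1]
          exact (curveGraph_adj.2 (Or.inl ⟨(hjv c h1 h2).1, rfl⟩) :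
            Θ.curveGraph.Adj (j, c) _).symm
        · rw [g3, Frame.iota_iota (hjv c h1 h2).1]
          exact curveGraph_adj.2 (Or.inr ⟨hjv c h1 h2, rfl⟩)
    rcases hpq with h | h
    · exact key p q h
    · exact (key q p h).symm

/-- A slide of the chord datum lifts to a square with bands datum from which the given one is
reached by a handle slide and an isotopy. -/
theorem exists_lift_slide (Θ : SWB) (hadm : Θ.Admissible j η) :
    ∃ Θ' : SWB, Θ'.toTCD = Θ.toTCD.slide j η hadm ∧ Θ'.mult 0 = Θ.mult 0 ∧
      Θ'.mult (2 * Θ.rank + 1) = Θ.mult (2 * Θ.rank + 1) ∧ HSEquiv Θ Θ' := by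
  obtain ⟨Θ₁, e1, e2, e3, e4, e5⟩ := exists_parallel Θ hadm
  have hhj := TCD.next_ne hadm
  have hmj := TCD.mate_next_ne hadm
  have hadm' : Θ₁.Admissible j η := by rw [e1]; exact hadm
  have hmate : Θ₁.mate = Θ.mate := by rw [e1]
  have hrank : Θ₁.rank = Θ.rank := by rw [e1]
  have hj := e3 j hhj.symm hmj.symm
  rw [← hj] at e4 e5
  obtain ⟨Θ₂, f1, f2⟩ := exists_unslide Θ₁ hadm' e4 e5
  have hs1 := hadm.1
  have hs2 := TCD.isSite_target hadm'
  have hs3 := hadm.2.1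
  have hs4 := TCD.isSite_mate hs3
  have hfix : ∀ k, ¬ Θ.IsSite k → Θ₂.mult k = Θ.mult k := by
    intro k hk
    have hk' : siteMove (Θ₁.target j η) j k = k := by
      obtain ⟨_, _⟩ := hs1
      obtain ⟨_, _⟩ := hs2
      unfold TCD.IsSite at hk
      rw [siteMove_apply]
      split_ifs <;> omega
    have k1 : k ≠ TCD.next j η := fun e => hk (e ▸ hs3)
    have k2 : k ≠ Θ.mate (TCD.next j η) := fun e => hk (e ▸ hs4)
    rw [f1, Frame.unslide_mult', hk', hmate, if_neg (by tauto), Nat.sub_zero, e3 k k1 k2]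
  have hT : Θ₂.toTCD = Θ₁.toTCD.slide j η hadm' := by rw [f1]; rfl
  refine ⟨Θ₂, ?_, hfix 0 (by unfold TCD.IsSite; omega), hfix _ (by unfold TCD.IsSite; omega), ?_⟩
  · rw [hT]; congr 1
  -- The way from `Θ₂` to `Θ`: the slide back to `Θ₁`, where the strands are parallel, and then the
  -- isotopy to `Θ`.
  · refine Relation.ReflTransGen.head (Or.inr ⟨_, _, ?_, f2⟩)
      (Relation.ReflTransGen.single (Or.inl e2))
    rw [hT, TCD.slide_isSite']; exact hs2

end SWB

/-! ### Splitting a chord datum at a closed initial segment -/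

namespace TCD

variable {C : TCD} {k : ℕ}

/-- The part of a chord datum on the first `2 * k` sites. -/
def below (C : TCD) (k : ℕ) (hk : k ≤ C.rank) (hC : C.ClosedBelow (2 * k)) : TCD where
  rank := k
  mate i := if i ≤ 2 * k then C.mate i else i
  twist i := if i ≤ 2 * k then C.twist i else 0
  mate_mate i := by
    by_cases h : i ≤ 2 * k
    · simp only [h, if_true, hC i h, C.mate_mate]
    · simp only [h, if_false]
  mate_eq_self_iff i := by
    by_cases h : i ≤ 2 * k
    · rw [if_pos h, C.mate_eq_self_iff]; omega
    · rw [if_neg h]; omega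
  twist_mate i := by
    by_cases h : i ≤ 2 * k
    · simp only [h, if_true, hC i h, C.twist_mate]
    · simp only [h, if_false]
  twist_outside i hi := by
    split_ifs
    · exact C.twist_outside i (by omega)
    · rfl

/-- The part of a chord datum above the first `2 * k` sites. -/
def above (C : TCD) (k : ℕ) (hk : k ≤ C.rank) (hC : C.ClosedBelow (2 * k)) : TCD where
  rank := C.rank - k
  mate i := if i = 0 then 0 else C.mate (i + 2 * k) - 2 * k
  twist i := if i = 0 then 0 else C.twist (i + 2 * k)
  mate_mate i := by
    by_cases h : i = 0
    · simp [h]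
    · have := lt_mate_of_closedBelow hC (k := i + 2 * k) (by omega)
      rw [if_neg h, if_neg (by omega), Nat.sub_add_cancel (by omega), C.mate_mate]
      omega
  mate_eq_self_iff i := by
    by_cases h : i = 0
    · simp [h]
    · have := lt_mate_of_closedBelow hC (k := i + 2 * k) (by omega)
      have h' := C.mate_eq_self_iff (i + 2 * k)
      rw [if_neg h]
      omega
  twist_mate i := by
    by_cases h : i = 0
    · simp [h]
    · have := lt_mate_of_closedBelow hC (k := i + 2 * k) (by omega)
      rw [if_neg h, if_neg (by omega), if_neg h, Nat.sub_add_cancel (by omega), C.twist_mate]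
  twist_outside i hi := by
    split_ifs
    · rfl
    · exact C.twist_outside _ (by omega)

variable {hk : k ≤ C.rank} {hC : C.ClosedBelow (2 * k)}

/-- Collapsing all boundary vertices above `2 * k` to the last lower one respects reachability: no
band leads from below to above, and the one line that does ends up at the collapsed point. -/
theorem below_oneBoundary (h : C.OneBoundary) : (C.below k hk hC).OneBoundary := by
  intro x y hx hy
  have hx1 : x.1 ≤ 2 * k := hx.2
  have hy1 : y.1 ≤ 2 * k := hy.2
  have hs : ∀ i, C.IsSite i → i ≤ 2 * k → (C.below k hk hC).IsSite i := fun i h h' => ⟨h.1, h'⟩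
  have key := reachable_map (G := (C.below k hk hC).boundaryGraph)
    (fun z => if z.1 ≤ 2 * k then z else (2 * k, 1)) ?_ ?_
    (h x y ⟨hx.1, by omega⟩ ⟨hy.1, by omega⟩)
  · simpa only [hx1, hy1, if_true] using key
  · intro i h1 h2
    dsimp only
    by_cases hi : i + 1 ≤ 2 * k
    · rw [if_pos (by omega), if_pos hi]
      exact Reachable.line (hs _ h1 (by omega)) (hs _ h2 hi)
    · rw [if_neg hi]
      split_ifs
      · rw [show i = 2 * k by omega]
      · rfl
  · intro i κ h1
    dsimp only
    by_cases hi : i ≤ 2 * k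
    · have := Reachable.band (hs i h1 hi) κ
      rw [if_pos hi, if_pos (hC i hi)]
      simpa only [below, side, hi, if_true] using this
    · have := lt_mate_of_closedBelow hC (k := i) (by omega)
      rw [if_neg hi, if_neg (by omega)]

/-- The same collapse with the roles exchanged: everything below goes to `(1, -1)`. -/
theorem above_oneBoundary (h : C.OneBoundary) : (C.above k hk hC).OneBoundary := by
  intro x y hx hy
  have hx1 := hx.1
  have hy1 := hy.1
  have hx2 : x.1 ≤ 2 * (C.rank - k) := hx.2
  have hy2 : y.1 ≤ 2 * (C.rank - k) := hy.2
  have hs : ∀ i, C.IsSite i → 2 * k < i → (C.above k hk hC).IsSite (i - 2 * k) := fun i h h' => by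
    have := h.2
    refine ⟨by omega, ?_⟩
    show _ ≤ 2 * (C.rank - k)
    omega
  have key := reachable_map (G := (C.above k hk hC).boundaryGraph)
    (fun z => if z.1 ≤ 2 * k then (1, -1) else (z.1 - 2 * k, z.2)) ?_ ?_
    (h (x.1 + 2 * k, x.2) (y.1 + 2 * k, y.2) ⟨by dsimp only; omega, by dsimp only; omega⟩
      ⟨by dsimp only; omega, by dsimp only; omega⟩)
  · dsimp only at key
    rw [if_neg (by omega), if_neg (by omega)] at key
    simpa only [Nat.add_sub_cancel] using key
  · intro i h1 h2
    dsimp only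
    by_cases hi : 2 * k < i
    · rw [if_neg (by omega), if_neg (by omega)]
      have h3 := hs _ h2 (by omega)
      rw [show i + 1 - 2 * k = i - 2 * k + 1 by omega] at h3 ⊢
      exact Reachable.line (hs _ h1 hi) h3
    · rw [if_pos (by omega)]
      split_ifs
      · rfl
      · rw [show i + 1 - 2 * k = 1 by omega]
  · intro i κ h1
    dsimp only
    by_cases hi : i ≤ 2 * k
    · rw [if_pos hi, if_pos (hC i hi)]
    · have := lt_mate_of_closedBelow hC (k := i) (by omega)
      rw [if_neg hi, if_neg (by omega)]
      have h3 := Reachable.band (hs i h1 (by omega)) κ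
      have hi0 : ¬ i - 2 * k = 0 := by omega
      have hi1 : i - 2 * k + 2 * k = i := Nat.sub_add_cancel (by omega)
      have e1 : (C.above k hk hC).mate (i - 2 * k) = C.mate i - 2 * k := by
        simp only [above, hi0, if_false, hi1]
      have e2 : (C.above k hk hC).twist (i - 2 * k) = C.twist i := by
        simp only [above, hi0, if_false, hi1]
      simpa only [side, e1, e2] using h3

end TCD

/-! ### Cutting a datum along a horizontal line -/

namespace SWB

variable {Θ : SWB} {k l : ℕ} {u : ℕ → ℕ × ℕ}

/-- `u 1, …, u l` are, in increasing order, the vertices on the sites up to `2 * k` that are paired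
with vertices above. -/
structure IsCut (Θ : SWB) (k l : ℕ) (u : ℕ → ℕ × ℕ) : Prop where
  mem : ∀ a, 1 ≤ a → a ≤ l → u a ∈ Θ.verts
  le : ∀ a, 1 ≤ a → a ≤ l → (u a).1 ≤ 2 * k
  lt : ∀ a, 1 ≤ a → a ≤ l → 2 * k < (Θ.pair (u a)).1
  surj : ∀ v ∈ Θ.verts, v.1 ≤ 2 * k → 2 * k < (Θ.pair v).1 → ∃ a, 1 ≤ a ∧ a ≤ l ∧ u a = v
  mono : ∀ a b, 1 ≤ a → a < b → b ≤ l → Θ.prec (u a) (u b)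

theorem verts_finite (Θ : SWB) : Θ.verts.Finite := by
  refine ((Set.finite_Iic (2 * Θ.rank + 1)).biUnion fun i _ =>
    ((Set.finite_Iic (Θ.mult i)).image (Prod.mk i))).subset fun v hv => ?_
  simp only [Set.mem_iUnion]
  exact ⟨v.1, Frame.le_of_mem_verts hv, v.2, hv.2, rfl⟩

theorem exists_isCut (Θ : SWB) (hk : k ≤ Θ.rank) : ∃ l u, Θ.IsCut k l u := by
  classical
  -- The vertices concerned have first coordinate at most `2 * k`, hence at most `2 * Θ.rank`, where
  -- the lexicographic order is the vertex order; so they can be enumerated by sorting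
  -- lexicographically.
  have hfin : {v : ℕ ×ₗ ℕ | ofLex v ∈ Θ.verts ∧ (ofLex v).1 ≤ 2 * k ∧
      2 * k < (Θ.pair (ofLex v)).1}.Finite :=
    (Θ.verts_finite.preimage (f := (ofLex : ℕ ×ₗ ℕ → ℕ × ℕ)) ofLex.injective.injOn).subset
      fun v hv => hv.1
  set S := hfin.toFinset with hS
  have hmS : ∀ v : ℕ ×ₗ ℕ, v ∈ S ↔ ofLex v ∈ Θ.verts ∧ (ofLex v).1 ≤ 2 * k ∧
      2 * k < (Θ.pair (ofLex v)).1 := fun v => by rw [hS, Set.Finite.mem_toFinset]; rfl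
  let e := S.orderEmbOfFin rfl
  have hu : ∀ a (_ : 1 ≤ a) (h2 : a ≤ S.card),
      (if h : a - 1 < S.card then ofLex (e ⟨a - 1, h⟩) else (0, 0)) =
        ofLex (e ⟨a - 1, by omega⟩) := fun a h1 h2 => dif_pos _
  have hmem : ∀ i, _ := fun i => (hmS (e i)).1 (S.orderEmbOfFin_mem rfl i)
  refine ⟨S.card, fun a => if h : a - 1 < S.card then ofLex (e ⟨a - 1, h⟩) else (0, 0),
    ⟨?_, ?_, ?_, ?_, ?_⟩⟩
  · intro a h1 h2
    rw [hu a h1 h2]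
    exact (hmem _).1
  · intro a h1 h2
    rw [hu a h1 h2]
    exact (hmem _).2.1
  · intro a h1 h2
    rw [hu a h1 h2]
    exact (hmem _).2.2
  · intro v h1 h2 h3
    have : toLex v ∈ Set.range e := by
      rw [S.range_orderEmbOfFin rfl]
      exact (hmS _).2 ⟨h1, h2, h3⟩
    obtain ⟨⟨i, hi⟩, e1⟩ := this
    refine ⟨i + 1, by omega, hi, ?_⟩
    rw [hu (i + 1) (by omega) hi]
    simp only [Nat.add_sub_cancel, e1]
    rfl
  · intro a b h1 h2 h3
    rw [hu a h1 (by omega), hu b (by omega) h3]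
    have hlt : e ⟨a - 1, by omega⟩ < e ⟨b - 1, by omega⟩ :=
      e.lt_iff_lt.2 (by rw [Fin.mk_lt_mk]; omega)
    rw [Prod.Lex.lt_iff] at hlt
    have := (hmem ⟨a - 1, by omega⟩).2.1
    rcases hlt with h | ⟨h, h'⟩
    · exact Or.inl h
    · exact Or.inr (Or.inl ⟨h, by omega, h'⟩)

/-- The cut edges are nested because they do not cross. Their upper ends therefore appear in
reverse, in accordance with the reversed order of the northern vertices of a frame. -/
theorem IsCut.anti (h : Θ.IsCut k l u) {a b : ℕ} (h1 : 1 ≤ a) (h2 : a < b)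
    (h3 : b ≤ l) : Θ.prec (Θ.pair (u b)) (Θ.pair (u a)) := by
  have ha := h.mem a h1 (by omega)
  have hb := h.mem b (by omega) h3
  have hm := h.mono a b h1 h2 h3
  have hlt : Θ.prec (u b) (Θ.pair (u a)) := Or.inl (by
    have := h.le b (by omega) h3
    have := h.lt a h1 (by omega)
    omega)
  rcases Frame.prec_trichotomy (pair_mem ha) (pair_mem hb) with h' | h' | h'
  · exact absurd ⟨hm, hlt, h'⟩ (Θ.crossingless _ ha _ hb)
  · rw [pair_inj h'] at hm
    exact absurd hm (Frame.prec_irrefl _)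
  · exact h'

/-- The lower piece is the restriction of the pairing to the lower vertices and the upper ends of
the cut edges; the latter serve as northern vertices, in the correct order by `IsCut.anti`. -/
theorem exists_below (h : Θ.IsCut k l u) (hk : k ≤ Θ.rank) (hC : Θ.ClosedBelow (2 * k)) :
    ∃ Θ₁ : SWB, Θ₁.toTCD = Θ.toTCD.below k hk hC ∧
      (∀ i, Θ₁.mult i = if i ≤ 2 * k then Θ.mult i else if i = 2 * k + 1 then l else 0) ∧
      (∀ p q, p.1 ≤ 2 * k → q.1 ≤ 2 * k → (Θ₁.curveGraph.Adj p q ↔ Θ.curveGraph.Adj p q)) ∧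
      (∀ a q, Θ₁.curveGraph.Adj (2 * k + 1, a) q ↔ 1 ≤ a ∧ a ≤ l ∧ q = u a) := by
  let F : Frame :=
    { toTCD := Θ.toTCD.below k hk hC
      oneBoundary := TCD.below_oneBoundary Θ.oneBoundary
      mult := fun i => if i ≤ 2 * k then Θ.mult i else if i = 2 * k + 1 then l else 0
      mult_mate := fun i => by
        by_cases hi : i ≤ 2 * k
        · simp only [TCD.below, hi, if_true, hC i hi, Θ.mult_mate]
        · simp only [TCD.below, hi, if_false]
      mult_outside := fun i hi => by
        change 2 * k + 1 < i at hi
        rw [if_neg (by omega), if_neg (by omega)] }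
  have hlow : ∀ p : ℕ × ℕ, p.1 ≤ 2 * k → (p ∈ F.verts ↔ p ∈ Θ.verts) := fun p hp => by
    simp only [Frame.mem_verts, F, hp, if_true]
  have htop : ∀ a, (2 * k + 1, a) ∈ F.verts ↔ 1 ≤ a ∧ a ≤ l := fun a => by
    simp only [Frame.mem_verts, F, show ¬ 2 * k + 1 ≤ 2 * k by omega, if_false, if_true]
  have hv : ∀ p ∈ F.verts, p.1 ≤ 2 * k ∧ p ∈ Θ.verts ∨
      ∃ a, 1 ≤ a ∧ a ≤ l ∧ p = (2 * k + 1, a) := fun p hp => by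
    have hp' : p.1 ≤ 2 * k + 1 := Frame.le_of_mem_verts hp
    by_cases h1 : p.1 ≤ 2 * k
    · exact Or.inl ⟨h1, (hlow p h1).1 hp⟩
    · have e : p = (2 * k + 1, p.2) := Prod.ext (by dsimp only; omega) rfl
      rw [e, htop] at hp
      exact Or.inr ⟨p.2, hp.1, hp.2, e⟩
  let o : ℕ × ℕ → ℕ × ℕ := fun v => if v.1 ≤ 2 * k then v else Θ.pair (u v.2)
  have ol : ∀ v : ℕ × ℕ, v.1 ≤ 2 * k → o v = v := fun v hv => if_pos hv
  have ot : ∀ a, o (2 * k + 1, a) = Θ.pair (u a) := fun a => if_neg (by dsimp only; omega)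
  have hmem : ∀ v ∈ F.verts, o v ∈ Θ.verts := by
    intro v hm
    rcases hv v hm with ⟨h1, h2⟩ | ⟨a, h1, h2, rfl⟩
    · rwa [ol v h1]
    · rw [ot]; exact pair_mem (h.mem a h1 h2)
  have hprec : ∀ v ∈ F.verts, ∀ w ∈ F.verts, F.prec v w → Θ.prec (o v) (o w) := by
    intro v hm w hm' hvw
    have hrank : F.rank = k := rfl
    rcases hv v hm with ⟨h1, h2⟩ | ⟨a, h1, h2, rfl⟩ <;>
      rcases hv w hm' with ⟨h3, h4⟩ | ⟨b, h3, h4, rfl⟩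
    · rw [ol v h1, ol w h3]
      unfold Frame.prec at *
      rw [hrank] at hvw
      omega
    · rw [ol v h1, ot]
      have := h.lt b h3 h4
      exact Or.inl (by omega)
    · unfold Frame.prec at hvw
      rw [hrank] at hvw
      dsimp only at hvw
      omega
    · rw [ot, ot]
      unfold Frame.prec at hvw
      rw [hrank] at hvw
      exact h.anti h3 (by dsimp only at hvw; omega) h2
  have hcl : ∀ v ∈ F.verts, ∃ w ∈ F.verts, o w = Θ.pair (o v) := by
    intro v hm
    rcases hv v hm with ⟨h1, h2⟩ | ⟨a, h1, h2, rfl⟩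
    · rw [ol v h1]
      by_cases h3 : (Θ.pair v).1 ≤ 2 * k
      · exact ⟨_, (hlow _ h3).2 (pair_mem h2), ol _ h3⟩
      · obtain ⟨a, h4, h5, rfl⟩ := h.surj v h2 h1 (by omega)
        exact ⟨(2 * k + 1, a), (htop a).2 ⟨h4, h5⟩, ot a⟩
    · have h3 := h.le a h1 h2
      exact ⟨u a, (hlow _ h3).2 (h.mem a h1 h2), by rw [ol _ h3, ot, Θ.pair_pair]⟩
  obtain ⟨Θ₁, e₁, hp⟩ := exists_transport Θ F o hmem hprec hcl
  have hFm : ∀ i, Θ₁.mult i = F.mult i := fun i => by rw [e₁]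
  have hlt : ∀ p : ℕ × ℕ, p.1 ≤ 2 * k → Θ₁.iota p = Θ.iota p := fun p hp => by
    rw [e₁]
    simp only [Frame.iota, F, TCD.below, hp, if_true]
  have hint : ∀ p : ℕ × ℕ, p ∈ Θ₁.intVerts ↔ p.1 ≤ 2 * k ∧ p ∈ Θ.intVerts := fun p => by
    have hs : Θ₁.IsSite p.1 ↔ 1 ≤ p.1 ∧ p.1 ≤ 2 * k := by rw [e₁]; rfl
    have hs' : Θ.IsSite p.1 ↔ 1 ≤ p.1 ∧ p.1 ≤ 2 * Θ.rank := Iff.rfl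
    have hi : p ∈ Θ₁.intVerts ↔ p ∈ F.verts ∧ Θ₁.IsSite p.1 := by rw [← e₁]; rfl
    have hi' : p ∈ Θ.intVerts ↔ p ∈ Θ.verts ∧ Θ.IsSite p.1 := Iff.rfl
    rw [hi, hi', hs, hs']
    constructor
    · rintro ⟨h1, h2, h3⟩
      exact ⟨h3, (hlow p h3).1 h1, h2, by omega⟩
    · rintro ⟨h1, h2, h3, -⟩
      exact ⟨(hlow p h1).2 h2, h3, h1⟩
  have hpv : ∀ v ∈ F.verts, Θ₁.pair v ∈ F.verts := fun v hv => by
    rw [← e₁] at hv ⊢; exact pair_mem hv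
  refine ⟨Θ₁, by rw [e₁], hFm, ?_, ?_⟩
  · intro p q h1 h2
    have hpair : p ∈ Θ.verts → (Θ₁.pair p = q ↔ Θ.pair p = q) := fun hm => by
      have hm' := (hlow p h1).2 hm
      have hh := hp p hm'
      rw [ol p h1] at hh
      rw [← hh]
      rcases hv _ (hpv p hm') with ⟨h3, -⟩ | ⟨a, h3, h4, h5⟩
      · rw [ol _ h3]
      · rw [h5, ot]
        have := h.lt a h3 h4
        constructor
        · rintro rfl; dsimp only at h2; omega
        · rintro rfl; omega
    rw [curveGraph_adj, curveGraph_adj, hint, hlt p h1, e₁, hlow p h1]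
    constructor
    · rintro (⟨h3, h4⟩ | ⟨h3, h4⟩)
      · exact Or.inl ⟨h3, (hpair h3).1 h4⟩
      · exact Or.inr ⟨h3.2, h4⟩
    · rintro (⟨h3, h4⟩ | ⟨h3, h4⟩)
      · exact Or.inl ⟨h3, (hpair h3).2 h4⟩
      · exact Or.inr ⟨⟨h1, h3⟩, h4⟩
  · intro a q
    rw [curveGraph_adj, hint, e₁, htop]
    have hpair : 1 ≤ a → a ≤ l → Θ₁.pair (2 * k + 1, a) = u a := fun h1 h2 => by
      have hm := (htop a).2 ⟨h1, h2⟩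
      have hh := hp _ hm
      rw [ot, Θ.pair_pair] at hh
      rcases hv _ (hpv _ hm) with ⟨h3, -⟩ | ⟨b, h3, h4, h5⟩
      · rwa [ol _ h3] at hh
      · rw [h5, ot] at hh
        have := h.lt b h3 h4
        have := h.le a h1 h2
        rw [hh] at *
        omega
    constructor
    · rintro (⟨⟨h1, h2⟩, h3⟩ | ⟨⟨h1, -⟩, -⟩)
      · exact ⟨h1, h2, by rw [← h3, hpair h1 h2]⟩
      · dsimp only at h1; omega
    · rintro ⟨h1, h2, rfl⟩
      exact Or.inl ⟨⟨h1, h2⟩, hpair h1 h2⟩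

end SWB

namespace SWB

variable {Θ : SWB} {k l : ℕ} {u : ℕ → ℕ × ℕ}

/-- The upper piece consists of the upper vertices together with the lower ends of the cut edges,
which serve as southern vertices and keep their order. -/
theorem exists_above (h : Θ.IsCut k l u) (hk : k ≤ Θ.rank) (hC : Θ.ClosedBelow (2 * k)) :
    ∃ Θ₂ : SWB, Θ₂.toTCD = Θ.toTCD.above k hk hC ∧
      (∀ i, Θ₂.mult i = if i = 0 then l else Θ.mult (i + 2 * k)) ∧
      (∀ p q, 1 ≤ p.1 → 1 ≤ q.1 → (Θ₂.curveGraph.Adj p q ↔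
        Θ.curveGraph.Adj (p.1 + 2 * k, p.2) (q.1 + 2 * k, q.2))) ∧
      (∀ a q, Θ₂.curveGraph.Adj (0, a) q ↔
        1 ≤ a ∧ a ≤ l ∧ Θ.pair (u a) = (q.1 + 2 * k, q.2) ∧ 1 ≤ q.1) := by
  let F : Frame :=
    { toTCD := Θ.toTCD.above k hk hC
      oneBoundary := TCD.above_oneBoundary Θ.oneBoundary
      mult := fun i => if i = 0 then l else Θ.mult (i + 2 * k)
      mult_mate := fun i => by
        by_cases hi : i = 0
        · simp only [TCD.above, hi, if_true]
        · have := TCD.lt_mate_of_closedBelow hC (k := i + 2 * k) (by omega)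
          have h0 : ¬ Θ.mate (i + 2 * k) - 2 * k = 0 := by omega
          simp only [TCD.above, hi, if_false, h0]
          rw [Nat.sub_add_cancel (by omega), Θ.mult_mate]
      mult_outside := fun i hi => by
        change 2 * (Θ.rank - k) + 1 < i at hi
        rw [if_neg (by omega), Θ.mult_outside _ (by omega)] }
  have hrank : F.rank = Θ.rank - k := rfl
  have hup : ∀ p : ℕ × ℕ, 1 ≤ p.1 → (p ∈ F.verts ↔ (p.1 + 2 * k, p.2) ∈ Θ.verts) :=
    fun p hp => by
      simp only [Frame.mem_verts, F, show ¬ p.1 = 0 by omega, if_false]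
  have hbot : ∀ a, (0, a) ∈ F.verts ↔ 1 ≤ a ∧ a ≤ l := fun a => by
    simp only [Frame.mem_verts, F, if_true]
  have hv : ∀ p ∈ F.verts, 1 ≤ p.1 ∧ (p.1 + 2 * k, p.2) ∈ Θ.verts ∨
      ∃ a, 1 ≤ a ∧ a ≤ l ∧ p = (0, a) := fun p hp => by
    by_cases h1 : 1 ≤ p.1
    · exact Or.inl ⟨h1, (hup p h1).1 hp⟩
    · have e : p = (0, p.2) := Prod.ext (by dsimp only; omega) rfl
      rw [e, hbot] at hp
      exact Or.inr ⟨p.2, hp.1, hp.2, e⟩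
  let o : ℕ × ℕ → ℕ × ℕ := fun v => if v.1 = 0 then u v.2 else (v.1 + 2 * k, v.2)
  have ol : ∀ v : ℕ × ℕ, 1 ≤ v.1 → o v = (v.1 + 2 * k, v.2) := fun v hv => if_neg (by omega)
  have ot : ∀ a, o (0, a) = u a := fun a => if_pos rfl
  have hdown : ∀ v : ℕ × ℕ, 2 * k < v.1 → ∃ w : ℕ × ℕ, 1 ≤ w.1 ∧ v = (w.1 + 2 * k, w.2) :=
    fun v hv => ⟨(v.1 - 2 * k, v.2), by dsimp only; omega, Prod.ext (by dsimp only; omega) rfl⟩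
  have hmem : ∀ v ∈ F.verts, o v ∈ Θ.verts := by
    intro v hm
    rcases hv v hm with ⟨h1, h2⟩ | ⟨a, h1, h2, rfl⟩
    · rwa [ol v h1]
    · rw [ot]; exact h.mem a h1 h2
  have hprec : ∀ v ∈ F.verts, ∀ w ∈ F.verts, F.prec v w → Θ.prec (o v) (o w) := by
    intro v hm w hm' hvw
    rcases hv v hm with ⟨h1, h2⟩ | ⟨a, h1, h2, rfl⟩ <;>
      rcases hv w hm' with ⟨h3, h4⟩ | ⟨b, h3, h4, rfl⟩
    · rw [ol v h1, ol w h3]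
      unfold Frame.prec at *
      rw [hrank] at hvw
      dsimp only
      omega
    · unfold Frame.prec at hvw
      rw [hrank] at hvw
      dsimp only at hvw
      omega
    · rw [ol w h3, ot]
      have := h.le a h1 h2
      exact Or.inl (by dsimp only; omega)
    · rw [ot, ot]
      unfold Frame.prec at hvw
      rw [hrank] at hvw
      exact h.mono a b h1 (by dsimp only at hvw; omega) h4
  have hcl : ∀ v ∈ F.verts, ∃ w ∈ F.verts, o w = Θ.pair (o v) := by
    intro v hm
    rcases hv v hm with ⟨h1, h2⟩ | ⟨a, h1, h2, rfl⟩
    · rw [ol v h1]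
      by_cases h3 : (Θ.pair (v.1 + 2 * k, v.2)).1 ≤ 2 * k
      · obtain ⟨a, h4, h5, h6⟩ := h.surj _ (pair_mem h2) h3
          (by rw [Θ.pair_pair]; dsimp only; omega)
        exact ⟨(0, a), (hbot a).2 ⟨h4, h5⟩, by rw [ot, h6]⟩
      · obtain ⟨w, h4, h5⟩ := hdown _ (not_le.1 h3)
        exact ⟨w, (hup _ h4).2 (h5 ▸ pair_mem h2), by rw [h5, ol _ h4]⟩
    · obtain ⟨w, h4, h5⟩ := hdown _ (h.lt a h1 h2)
      exact ⟨w, (hup _ h4).2 (h5 ▸ pair_mem (h.mem a h1 h2)), by rw [ot, h5, ol _ h4]⟩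
  obtain ⟨Θ₂, e₂, hp⟩ := exists_transport Θ F o hmem hprec hcl
  have hFm : ∀ i, Θ₂.mult i = F.mult i := fun i => by rw [e₂]
  have hlt : ∀ p q : ℕ × ℕ, 1 ≤ p.1 → 1 ≤ q.1 →
      (Θ₂.iota p = q ↔ Θ.iota (p.1 + 2 * k, p.2) = (q.1 + 2 * k, q.2)) := fun p q hp hq => by
    have := TCD.lt_mate_of_closedBelow hC (k := p.1 + 2 * k) (by omega)
    rw [e₂]
    simp only [Frame.iota, F, TCD.above, show ¬ p.1 = 0 by omega, if_false, Prod.ext_iff]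
    refine and_congr_left fun _ => ?_
    omega
  have hint : ∀ p : ℕ × ℕ, p ∈ Θ₂.intVerts ↔ 1 ≤ p.1 ∧ (p.1 + 2 * k, p.2) ∈ Θ.intVerts :=
    fun p => by
      have hs : Θ₂.IsSite p.1 ↔ 1 ≤ p.1 ∧ p.1 ≤ 2 * (Θ.rank - k) := by rw [e₂]; rfl
      have hs' : Θ.IsSite (p.1 + 2 * k) ↔ 1 ≤ p.1 + 2 * k ∧ p.1 + 2 * k ≤ 2 * Θ.rank := Iff.rfl
      have hi : p ∈ Θ₂.intVerts ↔ p ∈ F.verts ∧ Θ₂.IsSite p.1 := by rw [← e₂]; rfl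
      have hi' : (p.1 + 2 * k, p.2) ∈ Θ.intVerts ↔
        (p.1 + 2 * k, p.2) ∈ Θ.verts ∧ Θ.IsSite (p.1 + 2 * k) := Iff.rfl
      rw [hi, hi', hs, hs']
      constructor
      · rintro ⟨h1, h2, h3⟩
        exact ⟨h2, (hup p h2).1 h1, by omega, by omega⟩
      · rintro ⟨h1, h2, h3, h4⟩
        exact ⟨(hup p h1).2 h2, h1, by omega⟩
  have hpv : ∀ v ∈ F.verts, Θ₂.pair v ∈ F.verts := fun v hv => by
    rw [← e₂] at hv ⊢; exact pair_mem hv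
  refine ⟨Θ₂, by rw [e₂], hFm, ?_, ?_⟩
  · intro p q h1 h2
    have hpair : (p.1 + 2 * k, p.2) ∈ Θ.verts →
        (Θ₂.pair p = q ↔ Θ.pair (p.1 + 2 * k, p.2) = (q.1 + 2 * k, q.2)) := fun hm => by
      have hm' := (hup p h1).2 hm
      have hh := hp p hm'
      rw [ol p h1] at hh
      rw [← hh]
      rcases hv _ (hpv p hm') with ⟨h3, -⟩ | ⟨a, h3, h4, h5⟩
      · rw [ol _ h3]
        simp only [Prod.ext_iff]
        refine and_congr_left fun _ => ?_
        omega
      · rw [h5, ot]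
        have := h.le a h3 h4
        constructor
        · rintro rfl; dsimp only at h2; omega
        · intro e; rw [e] at this; dsimp only at this; omega
    rw [curveGraph_adj, curveGraph_adj, hint, hlt p q h1 h2, e₂, hup p h1]
    constructor
    · rintro (⟨h3, h4⟩ | ⟨h3, h4⟩)
      · exact Or.inl ⟨h3, (hpair h3).1 h4⟩
      · exact Or.inr ⟨h3.2, h4⟩
    · rintro (⟨h3, h4⟩ | ⟨h3, h4⟩)
      · exact Or.inl ⟨h3, (hpair h3).2 h4⟩
      · exact Or.inr ⟨⟨h1, h3⟩, h4⟩
  · intro a q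
    rw [curveGraph_adj, hint, e₂, hbot]
    have hpair : 1 ≤ a → a ≤ l → 1 ≤ (Θ₂.pair (0, a)).1 ∧
        Θ.pair (u a) = ((Θ₂.pair (0, a)).1 + 2 * k, (Θ₂.pair (0, a)).2) := fun h1 h2 => by
      have hm := (hbot a).2 ⟨h1, h2⟩
      have hh := hp _ hm
      rw [ot] at hh
      rcases hv _ (hpv _ hm) with ⟨h3, -⟩ | ⟨b, h3, h4, h5⟩
      · exact ⟨h3, by rw [← hh, ol _ h3]⟩
      · rw [h5, ot] at hh
        have h6 := h.le b h3 h4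
        have h7 := h.lt a h1 h2
        rw [hh] at h6
        omega
    constructor
    · rintro (⟨⟨h1, h2⟩, rfl⟩ | ⟨⟨h1, -⟩, -⟩)
      · exact ⟨h1, h2, (hpair h1 h2).2, (hpair h1 h2).1⟩
      · dsimp only at h1; omega
    · rintro ⟨h1, h2, h3, h4⟩
      refine Or.inl ⟨⟨h1, h2⟩, ?_⟩
      rw [(hpair h1 h2).2, Prod.ext_iff] at h3
      exact Prod.ext (by simpa using h3.1) h3.2

theorem compositeGraph_adj {Θ₁ Θ₂ : SWB} {x y : (ℕ × ℕ) ⊕ ℕ} :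
    (compositeGraph Θ₁ Θ₂).Adj x y ↔
      (∃ p q, Θ₁.curveGraph.Adj p q ∧ x = lower Θ₁.rank p ∧ y = lower Θ₁.rank q) ∨
      (∃ p q, Θ₂.curveGraph.Adj p q ∧ x = upper Θ₁.rank p ∧ y = upper Θ₁.rank q) := by
  have hl : ∀ p q, lower Θ₁.rank p = lower Θ₁.rank q → p = q := by
    rintro ⟨p, p'⟩ ⟨q, q'⟩ e
    simp only [lower] at e
    split_ifs at e with h1 h2 h2 <;> simp_all
  have hu : ∀ p q, upper Θ₁.rank p = upper Θ₁.rank q → p = q := by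
    rintro ⟨p, p'⟩ ⟨q, q'⟩ e
    simp only [upper] at e
    split_ifs at e with h1 h2 h2 <;> simp_all
  rw [compositeGraph, SimpleGraph.fromRel_adj]
  constructor
  · rintro ⟨-, h | (⟨p, q, h, e, e'⟩ | ⟨p, q, h, e, e'⟩)⟩
    · exact h
    · exact Or.inl ⟨q, p, h.symm, e', e⟩
    · exact Or.inr ⟨q, p, h.symm, e', e⟩
  · intro h
    refine ⟨?_, Or.inl h⟩
    rintro rfl
    rcases h with ⟨p, q, h, e, e'⟩ | ⟨p, q, h, e, e'⟩
    · exact h.ne (hl _ _ (e.symm.trans e'))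
    · exact h.ne (hu _ _ (e.symm.trans e'))

/-- A datum in which the first `2 * k` sites are matched among themselves is a vertical
juxtaposition. -/
theorem exists_isJuxt (Θ : SWB) (hk : k ≤ Θ.rank) (hC : Θ.ClosedBelow (2 * k)) :
    ∃ Θ₁ Θ₂ : SWB, IsJuxt Θ₂ Θ₁ Θ ∧ Θ₁.rank = k := by
  obtain ⟨l, u, h⟩ := Θ.exists_isCut hk
  obtain ⟨Θ₁, e₁, m₁, a₁, b₁⟩ := exists_below h hk hC
  obtain ⟨Θ₂, e₂, m₂, a₂, b₂⟩ := exists_above h hk hC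
  have hr₁ : Θ₁.rank = k := by rw [e₁]; rfl
  have hr₂ : Θ₂.rank = Θ.rank - k := by rw [e₂]; rfl
  have hll : ∀ x y : ℕ × ℕ, (compositeGraph Θ₁ Θ₂).Adj (Sum.inl x) (Sum.inl y) ↔
      Θ.curveGraph.Adj x y ∧ (x.1 ≤ 2 * k ↔ y.1 ≤ 2 * k) := by
    intro x y
    rw [compositeGraph_adj, hr₁]
    constructor
    · rintro (⟨p, q, hpq, ex, ey⟩ | ⟨p, q, hpq, ex, ey⟩)
      · have hp := Frame.le_of_mem_verts (mem_verts_of_adj hpq)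
        have hq := Frame.le_of_mem_verts (mem_verts_of_adj hpq.symm)
        rw [hr₁] at hp hq
        simp only [lower] at ex ey
        split_ifs at ex ey with h1 h2
        cases ex; cases ey
        exact ⟨(a₁ _ _ (by omega) (by omega)).1 hpq, by omega⟩
      · simp only [upper] at ex ey
        split_ifs at ex ey with h1 h2
        cases ex; cases ey
        exact ⟨(a₂ _ _ (by omega) (by omega)).1 hpq, by dsimp only; omega⟩
    · rintro ⟨hxy, hs⟩
      by_cases hx : x.1 ≤ 2 * k
      · have hy := hs.1 hx
        refine Or.inl ⟨x, y, (a₁ _ _ hx hy).2 hxy, ?_, ?_⟩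
        · rw [lower, if_neg (by omega)]
        · rw [lower, if_neg (by omega)]
      · have hy : ¬ y.1 ≤ 2 * k := fun h => hx (hs.2 h)
        have ex : x = (x.1 - 2 * k + 2 * k, x.2) := Prod.ext (by dsimp only; omega) rfl
        have ey : y = (y.1 - 2 * k + 2 * k, y.2) := Prod.ext (by dsimp only; omega) rfl
        refine Or.inr ⟨(x.1 - 2 * k, x.2), (y.1 - 2 * k, y.2),
          (a₂ _ _ (by dsimp only; omega) (by dsimp only; omega)).2 ?_, ?_, ?_⟩
        · rw [← ex, ← ey]; exact hxy
        · rw [upper, if_neg (by dsimp only; omega), ← ex]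
        · rw [upper, if_neg (by dsimp only; omega), ← ey]
  -- A glued vertex is the midpoint of a cut edge: its only neighbours are the two ends of that
  -- edge.
  have hrl : ∀ a x, (compositeGraph Θ₁ Θ₂).Adj (Sum.inr a) (Sum.inl x) ↔
      1 ≤ a ∧ a ≤ l ∧ (x = u a ∨ x = Θ.pair (u a)) := by
    intro a x
    rw [compositeGraph_adj, hr₁]
    constructor
    · rintro (⟨⟨i, p⟩, q, hpq, ex, ey⟩ | ⟨⟨i, p⟩, q, hpq, ex, ey⟩)
      · simp only [lower] at ex ey
        split_ifs at ex ey with h1 h2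
        cases ex; cases ey
        subst h1
        obtain ⟨h3, h4, rfl⟩ := (b₁ _ _).1 hpq
        exact ⟨h3, h4, Or.inl rfl⟩
      · simp only [upper] at ex ey
        split_ifs at ex ey with h1 h2
        cases ex; cases ey
        subst h1
        obtain ⟨h3, h4, h5, -⟩ := (b₂ _ _).1 hpq
        exact ⟨h3, h4, Or.inr h5.symm⟩
    · rintro ⟨h1, h2, rfl | rfl⟩
      · refine Or.inl ⟨(2 * k + 1, a), u a, (b₁ _ _).2 ⟨h1, h2, rfl⟩, ?_, ?_⟩
        · rw [lower, if_pos rfl]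
        · have := h.le a h1 h2
          rw [lower, if_neg (by omega)]
      · have := h.lt a h1 h2
        have e : Θ.pair (u a) = ((Θ.pair (u a)).1 - 2 * k + 2 * k, (Θ.pair (u a)).2) :=
          Prod.ext (by dsimp only; omega) rfl
        refine Or.inr ⟨(0, a), ((Θ.pair (u a)).1 - 2 * k, (Θ.pair (u a)).2),
          (b₂ _ _).2 ⟨h1, h2, e, by dsimp only; omega⟩, ?_, ?_⟩
        · rw [upper, if_pos rfl]
        · rw [upper, if_neg (by dsimp only; omega), ← e]
  have hrr : ∀ a b, ¬ (compositeGraph Θ₁ Θ₂).Adj (Sum.inr a) (Sum.inr b) := by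
    intro a b
    rw [compositeGraph_adj, hr₁]
    rintro (⟨⟨i, p⟩, ⟨j, q⟩, hpq, ex, ey⟩ | ⟨⟨i, p⟩, ⟨j, q⟩, hpq, ex, ey⟩)
    · simp only [lower] at ex ey
      split_ifs at ex ey with h1 h2
      subst h1 h2
      obtain ⟨h3, h4, h5⟩ := (b₁ _ _).1 hpq
      have := h.le _ h3 h4
      rw [← h5] at this
      dsimp only at this
      omega
    · simp only [upper] at ex ey
      split_ifs at ex ey with h1 h2
      subst h1 h2
      have := ((b₂ _ _).1 hpq).2.2.2
      dsimp only at this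
      omega
  have hmate : ∀ i, 1 ≤ i → 2 * k < Θ.mate (i + 2 * k) := fun i hi =>
    TCD.lt_mate_of_closedBelow hC (by omega)
  refine ⟨Θ₁, Θ₂, ⟨?_, ?_, ?_, ?_, ?_, ?_, ?_, ?_, ?_⟩, hr₁⟩
  · rw [m₁, m₂, hr₁, if_neg (by omega), if_pos rfl, if_pos rfl]
  · omega
  · intro i hi
    rw [hr₁] at hi
    rw [e₁]
    exact (if_pos hi).symm
  · intro i hi
    have := hmate i hi
    rw [e₂, hr₁]
    simp only [TCD.above, show ¬ i = 0 by omega, if_false]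
    omega
  · intro i hi
    rw [hr₁] at hi
    rw [e₁]
    exact (if_pos hi).symm
  · intro i hi
    rw [e₂, hr₁]
    exact (if_neg (by omega)).symm
  · intro i hi
    rw [hr₁] at hi
    rw [m₁, if_pos hi]
  · intro i hi
    rw [m₂, if_neg (by omega), hr₁]
  · have hU : ∀ x : ℕ × ℕ, (Sum.inl x : (ℕ × ℕ) ⊕ ℕ) ∉ Set.range (Sum.inr : ℕ → (ℕ × ℕ) ⊕ ℕ) := by
      simp
    -- Since no band crosses the line, an edge that does is a cut edge of the pairing, and it is
    -- recovered by passing through its midpoint.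
    have cross : ∀ x y, Θ.curveGraph.Adj x y → x.1 ≤ 2 * k → ¬ y.1 ≤ 2 * k →
        ((compositeGraph Θ₁ Θ₂).contract (Set.range Sum.inr)).Adj (Sum.inl x) (Sum.inl y) := by
      intro x y hxy hx hy
      rcases curveGraph_adj.1 hxy with ⟨h1, rfl⟩ | ⟨h1, rfl⟩
      · obtain ⟨a, h3, h4, rfl⟩ := h.surj x h1 hx (not_le.1 hy)
        refine SimpleGraph.contract_adj_of_walk (fun e => pair_ne h1 (Sum.inl_injective e).symm)
          (hU _) (hU _)
          (.cons ((hrl a _).2 ⟨h3, h4, Or.inl rfl⟩).symm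
            (.cons ((hrl a _).2 ⟨h3, h4, Or.inr rfl⟩) .nil)) ?_
        intro z hz
        simp only [SimpleGraph.Walk.support_cons, SimpleGraph.Walk.support_nil,
          List.mem_cons, List.not_mem_nil, or_false] at hz
        rcases hz with rfl | rfl | rfl
        · exact Or.inl rfl
        · exact Or.inr (Or.inr ⟨a, rfl⟩)
        · exact Or.inr (Or.inl rfl)
      · exact absurd (hC _ hx) hy
    intro x y
    constructor
    · intro hxy
      by_cases hx : x.1 ≤ 2 * k <;> by_cases hy : y.1 ≤ 2 * k
      · exact SimpleGraph.contract_adj_of_adj (hU _) (hU _)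
          ((hll x y).2 ⟨hxy, iff_of_true hx hy⟩)
      · exact cross x y hxy hx hy
      · exact (cross y x hxy.symm hy hx).symm
      · exact SimpleGraph.contract_adj_of_adj (hU _) (hU _)
          ((hll x y).2 ⟨hxy, iff_of_false hx hy⟩)
    · intro hxy
      obtain ⟨hne, -, -, h1 | ⟨_, ⟨a, rfl⟩, _, ⟨b, rfl⟩, h1, h2, h3⟩⟩ :=
        SimpleGraph.of_contract_adj (id : (ℕ × ℕ) ⊕ ℕ → (ℕ × ℕ) ⊕ ℕ) (by
          rintro _ ⟨a, rfl⟩ _ ⟨b, rfl⟩ hab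
          exact absurd hab (hrr a b)) hxy
      · exact ((hll x y).1 h1).1
      · cases Sum.inr_injective h3
        obtain ⟨h4, h5, h6⟩ := (hrl a x).1 h1.symm
        obtain ⟨-, -, h7⟩ := (hrl a y).1 h2
        have hm := h.mem a h4 h5
        have hadj : Θ.curveGraph.Adj (u a) (Θ.pair (u a)) :=
          curveGraph_adj.2 (Or.inl ⟨hm, rfl⟩)
        rcases h6 with rfl | rfl <;> rcases h7 with rfl | rfl
        · exact absurd rfl hne
        · exact hadj
        · exact hadj.symm
        · exact absurd rfl hne

end SWB

/-! ### From blocks of sites to iterated juxtapositions -/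

namespace TCD

variable {C D : TCD} {L : ℕ}

/-- The sites after `L` carry a copy of `D`. -/
def BlockAt (C D : TCD) (L : ℕ) : Prop :=
  ∀ i, 1 ≤ i → i ≤ 2 * D.rank → C.mate (i + L) = D.mate i + L ∧ C.twist (i + L) = D.twist i

theorem TorAt.blockAt (h : C.TorAt L) : C.BlockAt Tor L := by
  obtain ⟨h1, h2, h3, h4⟩ := h
  have h5 := C.mate_mate (L + 1)
  have h6 := C.mate_mate (L + 2)
  have h7 := C.twist_mate (L + 1)
  have h8 := C.twist_mate (L + 2)
  rw [h1] at h5 h7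
  rw [h2] at h6 h8
  intro i hi hi'
  change i ≤ 2 * 2 at hi'
  rw [add_comm i, add_comm _ L]
  interval_cases i <;> simp [Tor, *]

theorem MobAt.blockAt (h : C.MobAt L) : C.BlockAt Mob L := by
  obtain ⟨h1, h2⟩ := h
  have h5 := C.mate_mate (L + 1)
  have h7 := C.twist_mate (L + 1)
  rw [h1] at h5 h7
  intro i hi hi'
  change i ≤ 2 * 1 at hi'
  rw [add_comm i, add_comm _ L]
  interval_cases i <;> simp [Mob, *]

theorem mate_zero (C : TCD) : C.mate 0 = 0 := mate_of_not (by rintro ⟨h, -⟩; omega)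

theorem BlockAt.closedBelow (h : C.BlockAt D 0) : C.ClosedBelow (2 * D.rank) := by
  intro i hi
  rcases Nat.eq_zero_or_pos i with rfl | h0
  · rw [mate_zero]; omega
  · have := (h i h0 hi).1
    rw [add_zero, add_zero] at this
    rw [this]
    exact (isSite_mate (C := D) ⟨h0, hi⟩).2

theorem BlockAt.eq (h : C.BlockAt D 0) (hr : C.rank = D.rank) : C = D := by
  have key : ∀ i, C.mate i = D.mate i ∧ C.twist i = D.twist i := by
    intro i
    by_cases hi : 1 ≤ i ∧ i ≤ 2 * D.rank
    · simpa using h i hi.1 hi.2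
    · have hi' : ¬ (1 ≤ i ∧ i ≤ 2 * C.rank) := by rw [hr]; exact hi
      rw [mate_of_not hi, mate_of_not hi', C.twist_outside i hi', D.twist_outside i hi]
      exact ⟨rfl, rfl⟩
  exact TCD.ext hr (funext fun i => (key i).1) (funext fun i => (key i).2)

theorem rank_eq_of_slides {C C₁ : TCD} (h : Relation.ReflTransGen Slides C C₁) :
    C₁.rank = C.rank := by
  induction h with
  | refl => rfl
  | tail _ hs ih => obtain ⟨j, η, h, rfl⟩ := hs; exact ih

/-- All twists vanish. -/
def Untwisted (C : TCD) : Prop := ∀ i, C.twist i = 0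

theorem tor_untwisted : Tor.Untwisted := fun _ => rfl

theorem not_mob_untwisted : ¬ Mob.Untwisted := fun h => absurd (h 1) (by simp [Mob])

end TCD

namespace SWB

variable {Θ Θ₁ Θ₂ : SWB} {D : TCD} {L : ℕ}

theorem IsJuxt.blockAt_lower (h : IsJuxt Θ₂ Θ₁ Θ) (hb : Θ.BlockAt D L)
    (hL : L + 2 * D.rank ≤ 2 * Θ₁.rank) : Θ₁.BlockAt D L := by
  intro i h1 h2
  rw [← h.mate_lower _ (by omega), ← h.twist_lower _ (by omega)]
  exact hb i h1 h2

theorem IsJuxt.blockAt_upper (h : IsJuxt Θ₂ Θ₁ Θ) (hb : Θ.BlockAt D (L + 2 * Θ₁.rank)) :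
    Θ₂.BlockAt D L := by
  intro i h1 h2
  have := hb i h1 h2
  rw [← add_assoc, h.mate_upper _ (by omega), h.twist_upper _ (by omega)] at this
  exact ⟨by omega, this.2⟩

theorem IsJuxt.mult_zero (h : IsJuxt Θ₂ Θ₁ Θ) : Θ₁.mult 0 = Θ.mult 0 :=
  (h.mult_lower 0 (by omega)).symm

theorem IsJuxt.mult_top (h : IsJuxt Θ₂ Θ₁ Θ) :
    Θ₂.mult (2 * Θ₂.rank + 1) = Θ.mult (2 * Θ.rank + 1) := by
  rw [← h.mult_upper _ (by omega), h.rank_eq]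
  congr 1
  omega

/-- A datum that consists of copies of `D` is an iterated vertical juxtaposition. -/
theorem exists_isStack (D : TCD) (n : ℕ) (Θ : SWB) (hr : Θ.rank = D.rank * (n + 1))
    (hb : ∀ r < n + 1, Θ.BlockAt D (2 * D.rank * r)) :
    ∃ l : ℕ → ℕ, l 0 = Θ.mult 0 ∧ l (n + 1) = Θ.mult (2 * Θ.rank + 1) ∧
      ∃ T : Fin (n + 1) → SWB,
        (∀ i : Fin (n + 1), T i ∈ Sq D.rank (l i) (l (i + 1)) ∧ (T i).toTCD = D) ∧
        IsStack (List.ofFn T) Θ := by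
  induction n generalizing Θ with
  | zero =>
    have hr' : Θ.rank = D.rank := by rw [hr]; ring
    refine ⟨fun i => if i = 0 then Θ.mult 0 else Θ.mult (2 * Θ.rank + 1), by simp, by simp,
      fun _ => Θ, fun i => ⟨⟨hr', ?_, ?_⟩, (hb 0 (by omega)).eq hr'⟩, by simp [IsStack]⟩
    · simp
    · simp [hr']
  | succ n ih =>
    have hb0 : Θ.BlockAt D 0 := hb 0 (by omega)
    -- The bottom block is cut off; the upper piece again consists of copies of `D`, one fewer.
    obtain ⟨Θ₁, Θ₂, hj, hk⟩ := exists_isJuxt (k := D.rank) Θ (by rw [hr]; nlinarith)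
      hb0.closedBelow
    have hr₂ : Θ₂.rank = D.rank * (n + 1) := by
      have := hj.rank_eq
      rw [hr, hk, mul_add _ (n + 1)] at this
      omega
    obtain ⟨l, l0, l1, T, hT, hs⟩ := ih Θ₂ hr₂ fun r hr => hj.blockAt_upper (by
      have := hb (r + 1) (by omega)
      rw [mul_add, mul_one] at this
      rwa [hk])
    have e₁ : Θ₁.toTCD = D := (hj.blockAt_lower hb0 (by omega)).eq hk
    refine ⟨fun i => if i = 0 then Θ.mult 0 else l (i - 1), by simp, ?_,
      Fin.cons Θ₁ T, fun i => ?_, ?_⟩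
    · simp [l1, hj.mult_top]
    · refine Fin.cases ?_ (fun i => ?_) i
      · refine ⟨⟨hk, ?_, ?_⟩, e₁⟩
        · simpa using hj.mult_zero
        · simpa [l0, hk] using hj.glue
      · simpa using hT i
    · rw [List.ofFn_succ, Fin.cons_zero]
      simp only [Fin.cons_succ]
      rw [List.ofFn_succ] at hs ⊢
      exact ⟨Θ₂, hs, hj⟩

/-- If both kinds of blocks occur, the datum is first cut between them, at height `4 * g`, and each
half is then a stack of its own kind; otherwise a single stack remains. -/
theorem exists_isTwoStack (Θ : SWB) (g t : ℕ) (hr : Θ.rank = 2 * g + t) (h0 : 0 < 2 * g + t)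
    (hT : ∀ r < g, Θ.TorAt (4 * r)) (hM : ∀ r < t, Θ.MobAt (4 * g + 2 * r)) :
    ∃ l : ℕ → ℕ, l 0 = Θ.mult 0 ∧ l (g + t) = Θ.mult (2 * Θ.rank + 1) ∧
      ∃ (T : Fin g → SWB) (M : Fin t → SWB),
        (∀ i : Fin g, T i ∈ SqTor (l i) (l (i + 1))) ∧
        (∀ i : Fin t, M i ∈ SqMob (l (g + i)) (l (g + i + 1))) ∧
        IsTwoStack (List.ofFn T) (List.ofFn M) Θ := by
  have hb : ∀ r < g, Θ.BlockAt TCD.Tor (2 * 2 * r) := fun r hr => (hT r hr).blockAt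
  have hb' : ∀ r < t, Θ.BlockAt TCD.Mob (2 * 1 * r + 2 * (2 * g)) := fun r hr => by
    have := (hM r hr).blockAt
    rwa [show 4 * g + 2 * r = 2 * 1 * r + 2 * (2 * g) by ring] at this
  rcases g with - | g
  · rcases t with - | t
    · omega
    obtain ⟨l, l0, l1, M, h1, h2⟩ := exists_isStack TCD.Mob t Θ
      (by rw [hr]; change _ = 1 * _; omega) hb'
    refine ⟨l, l0, by rw [← l1, Nat.zero_add], Fin.elim0, M, fun i => i.elim0, fun i => ?_, ?_⟩
    · rw [Nat.zero_add]; exact h1 i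
    · rw [List.ofFn_succ] at h2 ⊢
      exact h2
  rcases t with - | t
  · obtain ⟨l, l0, l1, T, h1, h2⟩ := exists_isStack TCD.Tor g Θ
      (by rw [hr]; change _ = 2 * _; omega) hb
    refine ⟨l, l0, l1, T, Fin.elim0, h1, fun i => i.elim0, ?_⟩
    rw [List.ofFn_succ] at h2 ⊢
    exact h2
  have hC : Θ.ClosedBelow (2 * (2 * (g + 1))) := by
    have : ∀ r ≤ g + 1, Θ.ClosedBelow (4 * r) := by
      intro r
      induction r with
      | zero =>
        intro _ k hk
        rw [Nat.le_zero.1 hk, TCD.mate_zero]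
      | succ r ih => exact fun h => (hT r (by omega)).closedBelow (ih (by omega))
    have := this (g + 1) le_rfl
    rwa [show 4 * (g + 1) = 2 * (2 * (g + 1)) by ring] at this
  obtain ⟨A, B, hj, hk⟩ := exists_isJuxt (k := 2 * (g + 1)) Θ (by omega) hC
  have hrB : B.rank = t + 1 := by have := hj.rank_eq; omega
  obtain ⟨l, l0, l1, T, h1, h2⟩ := exists_isStack TCD.Tor g A hk
    fun r hr => hj.blockAt_lower (hb r hr) (by
      change 2 * 2 * r + 2 * 2 ≤ _
      omega)
  obtain ⟨l', l0', l1', M, h1', h2'⟩ := exists_isStack TCD.Mob t B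
    (by rw [hrB]; change _ = 1 * _; omega)
    fun r hr => hj.blockAt_upper (by
      rw [hk]
      exact hb' r hr)
  -- Both halves meet in the same number of glued vertices, so their sequences of strand numbers can
  -- be concatenated.
  have hl : l (g + 1) = l' 0 := by rw [l1, l0', hj.glue]
  refine ⟨fun i => if i ≤ g + 1 then l i else l' (i - (g + 1)), ?_, ?_, T, M, fun i => ?_,
    fun i => ?_, ?_⟩
  · simp [l0, hj.mult_zero]
  · dsimp only
    rw [if_neg (by omega), show g + 1 + (t + 1) - (g + 1) = t + 1 by omega, l1', hj.mult_top]
  · dsimp only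
    rw [if_pos (by omega), if_pos (by omega)]
    exact h1 i
  · dsimp only
    have e : (if g + 1 + (i : ℕ) ≤ g + 1 then l (g + 1 + i) else l' (g + 1 + i - (g + 1))) =
        l' i := by
      split_ifs with h
      · rw [show (i : ℕ) = 0 by omega]; exact hl
      · congr 1; omega
    rw [e, if_neg (by omega), show g + 1 + (i : ℕ) + 1 - (g + 1) = i + 1 by omega]
    exact h1' i
  · rw [List.ofFn_succ] at h2 h2' ⊢
    rw [List.ofFn_succ (f := M)]
    exact ⟨A, B, h2, h2', hj⟩

/-- The lifts are taken backwards: each slide of the chord datum prepends a slide back and an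
isotopy to the way that leads to `Θ`. -/
theorem exists_lift_slides {C : TCD} (Θ : SWB)
    (h : Relation.ReflTransGen TCD.Slides Θ.toTCD C) :
    ∃ Φ : SWB, Φ.toTCD = C ∧ Φ.mult 0 = Θ.mult 0 ∧
      Φ.mult (2 * Φ.rank + 1) = Θ.mult (2 * Θ.rank + 1) ∧ HSEquiv Θ Φ := by
  induction h with
  | refl => exact ⟨Θ, rfl, rfl, rfl, .refl⟩
  | tail _ hs ih =>
    obtain ⟨Φ, rfl, h1, h2, h3⟩ := ih
    obtain ⟨j, η, h, rfl⟩ := hs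
    obtain ⟨Φ', e, h4, h5, h6⟩ := exists_lift_slide Φ h
    have hr : Φ'.rank = Φ.rank := by rw [e]; rfl
    exact ⟨Φ', e, h4.trans h1, by rw [hr, h5, h2], Relation.ReflTransGen.trans h6 h3⟩

/-! ### Orientability as an invariant, and the conclusion -/

theorem IsJuxt.untwisted_iff (h : IsJuxt Θ₂ Θ₁ Θ) :
    Θ.Untwisted ↔ Θ₁.Untwisted ∧ Θ₂.Untwisted := by
  constructor
  · refine fun hu => ⟨fun i => ?_, fun i => ?_⟩
    · by_cases hi : i ≤ 2 * Θ₁.rank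
      · rw [← h.twist_lower i hi, hu]
      · exact Θ₁.twist_outside i (by omega)
    · by_cases hi : 1 ≤ i
      · rw [← h.twist_upper i hi, hu]
      · exact Θ₂.twist_outside i (by omega)
  · rintro ⟨h1, h2⟩ i
    by_cases hi : i ≤ 2 * Θ₁.rank
    · rw [h.twist_lower i hi, h1]
    · rw [show i = i - 2 * Θ₁.rank + 2 * Θ₁.rank by omega, h.twist_upper _ (by omega), h2]

theorem IsStack.untwisted_iff {Ts : List SWB} {Φ : SWB} (h : IsStack Ts Φ) :
    Φ.Untwisted ↔ ∀ Θ ∈ Ts, Θ.Untwisted := by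
  induction Ts generalizing Φ with
  | nil => exact h.elim
  | cons Θ Ts ih =>
    rcases Ts with - | ⟨Θ', Ts⟩
    · change Φ = Θ at h
      simp [h]
    · obtain ⟨Ψ, h1, h2⟩ := h
      rw [h2.untwisted_iff, ih h1]
      simp only [List.forall_mem_cons]

theorem IsTwoStack.untwisted_iff {Ts Ms : List SWB} {Φ : SWB} (h : IsTwoStack Ts Ms Φ) :
    Φ.Untwisted ↔ (∀ Θ ∈ Ts, Θ.Untwisted) ∧ ∀ Θ ∈ Ms, Θ.Untwisted := by
  rcases Ms with - | ⟨M, Ms⟩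
  · have h' : IsStack Ts Φ := by rcases Ts with - | ⟨T, Ts⟩ <;> exact h
    simp [h'.untwisted_iff]
  · rcases Ts with - | ⟨T, Ts⟩
    · have h' : IsStack (M :: Ms) Φ := h
      simp [h'.untwisted_iff]
    · obtain ⟨A, B, h1, h2, h3⟩ := h
      rw [h3.untwisted_iff, h1.untwisted_iff, h2.untwisted_iff]

theorem Isotopic.toTCD_eq {Θ Θ' : SWB} (h : Isotopic Θ Θ') : Θ'.toTCD = Θ.toTCD := by
  induction h with
  | rel _ _ h => obtain ⟨i, a, h⟩ := h; exact h.2.2.2.2.1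
  | refl => rfl
  | symm _ _ _ ih => exact ih.symm
  | trans _ _ _ _ _ ih ih' => exact ih'.trans ih

/-- A slide changes only the twist of `p`, by that of `q`, and leaves the twist of `q` itself alone.
If either datum is untwisted, then `q` has twist zero and no twist changes at all. -/
theorem IsHandleSlide.untwisted_iff {Θ Θ' : SWB} {i : ℕ} {ε : ℤˣ}
    (h : IsHandleSlide Θ i ε Θ') : Θ'.Untwisted ↔ Θ.Untwisted := by
  rcases h with ⟨hadm, σ, -, -, -, hF, -⟩ | ⟨-, rfl⟩
  · constructor
    · intro hu
      have h0 := hF.twist_eq (TCD.next i ε)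
      have hn : ¬ (TCD.next i ε = i ∨ TCD.next i ε = Θ.mate i) := fun h =>
        h.elim (TCD.next_ne hadm) fun e => hadm.2.2 e.symm
      rw [hu, if_neg hn, add_zero] at h0
      intro k
      have hk := hF.twist_eq k
      rw [hu, ← h0, ite_self, add_zero] at hk
      exact hk.symm
    · intro hu k
      have hk := hF.twist_eq (σ.symm k)
      rwa [σ.apply_symm_apply, hu, hu, ite_self, add_zero] at hk
  · rfl

theorem HSEquiv.untwisted_iff {Θ Θ' : SWB} (h : HSEquiv Θ Θ') :
    Θ.Untwisted ↔ Θ'.Untwisted := by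
  induction h with
  | refl => rfl
  | tail _ hs ih =>
    rcases hs with hs | ⟨i, ε, -, hs⟩
    · rw [hs.toTCD_eq]; exact ih
    · rw [hs.untwisted_iff]; exact ih

theorem untwisted_iff_of_isTwoStack {g t : ℕ} {l : ℕ → ℕ} {T : Fin g → SWB} {M : Fin t → SWB}
    {Φ : SWB} (hT : ∀ i : Fin g, T i ∈ SqTor (l i) (l (i + 1)))
    (hM : ∀ i : Fin t, M i ∈ SqMob (l (g + i)) (l (g + i + 1)))
    (h : IsTwoStack (List.ofFn T) (List.ofFn M) Φ) : Φ.Untwisted ↔ t = 0 := by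
  rw [h.untwisted_iff]
  simp only [List.forall_mem_ofFn_iff]
  constructor
  · rintro ⟨-, h⟩
    by_contra ht
    have := h ⟨0, by omega⟩
    rw [(hM _).2] at this
    exact TCD.not_mob_untwisted this
  · rintro rfl
    exact ⟨fun i => by rw [(hT i).2]; exact TCD.tor_untwisted, fun i => i.elim0⟩

end SWB

/-- Every square with bands datum of rank `N > 0` and type `(n, m)` is handle slide equivalent to a
vertical juxtaposition of `g` data with chord datum `Tor`, followed by `t` data with chord datum
`Möb` on top of them, for a unique pair `(g, t)` with `t ∈ {0, 1, 2}` and `2g + t = N`. -/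
theorem corollary3 (N n m : ℕ) (hN : 0 < N) (Θ : SWB) (hΘ : Θ ∈ SWB.Sq N n m) :
    ∃! gt : ℕ × ℕ, (gt.2 = 0 ∨ gt.2 = 1 ∨ gt.2 = 2) ∧ 2 * gt.1 + gt.2 = N ∧
      ∃ l : ℕ → ℕ, l 0 = n ∧ l (gt.1 + gt.2) = m ∧
        ∃ (T : Fin gt.1 → SWB) (M : Fin gt.2 → SWB),
          (∀ i : Fin gt.1, T i ∈ SWB.SqTor (l i) (l (i + 1))) ∧
          (∀ i : Fin gt.2, M i ∈ SWB.SqMob (l (gt.1 + i)) (l (gt.1 + i + 1))) ∧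
          ∃ Φ : SWB, SWB.IsTwoStack (List.ofFn T) (List.ofFn M) Φ ∧ SWB.HSEquiv Θ Φ := by
  have hr : Θ.rank = N := hΘ.1
  obtain ⟨C, g, t, hs, ht, hC, hT, hM⟩ := TCD.exists_normal Θ.toTCD Θ.oneBoundary
  obtain ⟨Φ, rfl, h0, h1, h2⟩ := SWB.exists_lift_slides Θ hs
  have hN' : 2 * g + t = N := by
    rw [← hC, ← hr]
    clear hC hT hM h0 h1 h2
    exact TCD.rank_eq_of_slides hs
  obtain ⟨l, l0, l1, T, M, h3, h4, h5⟩ :=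
    SWB.exists_isTwoStack Φ g t hC (by omega) hT hM
  refine ⟨(g, t), ⟨by dsimp only; omega, hN', l, ?_, ?_, T, M, h3, h4, Φ, h5, h2⟩, ?_⟩
  · rw [l0, h0, hΘ.2.1]
  · rw [l1, h1, hr, hΘ.2.2]
  · rintro ⟨g', t'⟩ ⟨ht', hN'', l', -, -, T', M', h3', h4', Φ', h5', h2'⟩
    dsimp only at ht' hN''
    -- Both conditions say that `Θ` is untwisted. As `t` and `t'` have the same parity and are at
    -- most two, this forces `t = t'`, and then `g = g'`.
    have e : t = 0 ↔ t' = 0 := by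
      rw [← SWB.untwisted_iff_of_isTwoStack h3 h4 h5, ← h2.untwisted_iff, h2'.untwisted_iff,
        SWB.untwisted_iff_of_isTwoStack h3' h4' h5']
    rw [Prod.mk.injEq]
    omega
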